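/- Let $d\ge 1$, let $\Omega\subset\mathbb{R}^d$ be a polyhedral open bounded connected set, let $0<\underline\lambda\le\overline\lambda$, and let $\Lambda$ be a measurable map from $\Omega$ to the $d\times d$ real matrices such that, for a.e. $x\in\Omega$, $\Lambda(x)$ is symmetric with all its eigenvalues in $[\underline\lambda,\overline\lambda]$. **Discretisations.** A discretisation $\mathcal D=(\mathcal M,\mathcal E,\mathcal P)$ of $\Omega$ consists of the following. (1) A finite family $\mathcal M$ of nonempty connected open pairwise disjoint sets $K\subset\Omega$ with $\overline\Omega=\bigcup_{K\in\mathcal M}\overline K$; $|K|$ is the volume and $h_K$ the diameter of $K$, and $\partial K=\overline K\setminus K$. (2) A finite family $\mathcal E$ of pairwise disjoint sets $\sigma\subset\overline\Omega$, each a nonempty open subset of a hyperplane, with $(d-1)$-dimensional measure $|\sigma|>0$ and relative boundary $\overline\sigma\setminus\sigma$ of zero $(d-1)$-dimensional measure, together with subsets $\mathcal E_K\subset\mathcal E$ such that $\partial K=\bigcup_{\sigma\in\mathcal E_K}\overline\sigma$ for all $K\in\mathcal M$. With $\mathcal M_\sigma=\{K:\sigma\in\mathcal E_K\}$, each $\sigma$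 satisfies either $\#\mathcal M_\sigma=1$ and $\sigma\subset\partial\Omega=\overline\Omega\setminus\Omega$ ($\sigma\in\mathcal E_{\rm ext}$), or $\#\mathcal M_\sigma=2$ ($\sigma\in\mathcal E_{\rm int}$). Let $x_\sigma$ be the barycentre of $\sigma$ and, for $\sigma\in\mathcal E_K$, let $n_{K,\sigma}$ be the unit normal to $\sigma$ outward to $K$. (3) Points $x_K\in K$ such that $K$ is star-shaped with respect to $x_K$ and, for each $\sigma\in\mathcal E_K$, the distance $d_{K,\sigma}$ from $x_K$ to the hyperplane containing $\sigma$ is positive. Let $D_{K,\sigma}$ be the cone with vertex $x_K$ and basis $\sigma$. Set $h_{\mathcal D}=\max_K h_K$ and $\theta_{\mathcal D}=\max\Big(\max_{\sigma\in\mathcal E_{\rm int},\,K,L\in\mathcal M_\sigma}\frac{d_{K,\sigma}}{d_{L,\sigma}},\ \max_{K\in\mathcal M,\,\sigma\in\mathcal E_K}\frac{h_K}{d_{K,\sigma}}\Big)$. Let $X_{\mathcal D}$ be the space of real families $v=((v_K)_{K\in\mathcal M},(v_\sigma)_{\sigma\in\mathcal E})$, let $X_{\mathcal D,0}=\{v\in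 X_{\mathcal D}:v_\sigma=0\ \forall\sigma\in\mathcal E_{\rm ext}\}$, and let $|v|_X^2=\sum_{K}\sum_{\sigma\in\mathcal E_K}\frac{|\sigma|}{d_{K,\sigma}}(v_\sigma-v_K)^2$. Write $\Pi_{\mathcal M}v$ for the function equal to $v_K$ on each $K$, and $P_{\mathcal D}\varphi=((\varphi(x_K))_K,(\varphi(x_\sigma))_\sigma)$, where $\varphi\in C_c^\infty(\Omega)$ is extended by zero to $\mathbb R^d$. **Discrete gradient.** For $u\in X_{\mathcal D}$, let $\nabla_{\mathcal D}u$ be equal on $D_{K,\sigma}$ to $$\nabla_{K,\sigma}u=\nabla_Ku+R_{K,\sigma}u\;n_{K,\sigma},\qquad \nabla_Ku=\frac1{|K|}\sum_{\sigma\in\mathcal E_K}|\sigma|(u_\sigma-u_K)n_{K,\sigma},\qquad R_{K,\sigma}u=\frac{\sqrt d}{d_{K,\sigma}}\big(u_\sigma-u_K-\nabla_Ku\cdot(x_\sigma-x_K)\big).$$ **SUSHI fluxes.** For $\sigma,\sigma'\in\mathcal E_K$ let $$y^{\sigma\sigma'}=\frac{|\sigma'|}{|K|}n_{K,\sigma'}+\frac{\sqrt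 d}{d_{K,\sigma}}\Big(\delta_{\sigma\sigma'}-\frac{|\sigma'|}{|K|}n_{K,\sigma'}\cdot(x_\sigma-x_K)\Big)n_{K,\sigma},$$ where $\delta_{\sigma\sigma'}=1$ if $\sigma=\sigma'$ and $0$ otherwise, and let $$A_K^{\sigma\sigma'}=\sum_{\sigma''\in\mathcal E_K}y^{\sigma''\sigma}\cdot\Big(\int_{D_{K,\sigma''}}\Lambda\,dx\Big)y^{\sigma''\sigma'},\qquad F^{\mathcal D}_{K,\sigma}(u)=\sum_{\sigma'\in\mathcal E_K}A_K^{\sigma\sigma'}(u_K-u_{\sigma'}).$$ Put $\langle u,v\rangle_F=\sum_K\sum_{\sigma\in\mathcal E_K}F^{\mathcal D}_{K,\sigma}(u)(v_K-v_\sigma)$. **Statement.** Let $\mathcal F$ be a family of discretisations of $\Omega$ for which there is $\theta>0$ with $\theta_{\mathcal D}\le\theta$ for all $\mathcal D\in\mathcal F$. Then $\langle u,v\rangle_F=\int_\Omega\nabla_{\mathcal D}u\cdot\Lambda\nabla_{\mathcal D}v\,dx$ for all $\mathcal D\in\mathcal F$ and $u,v\in X_{\mathcal D}$, and the family of fluxes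 $((F^{\mathcal D}_{K,\sigma})_{K,\sigma})_{\mathcal D\in\mathcal F}$ is - continuous: there is $M>0$ with $\langle u,v\rangle_F\le M|u|_X|v|_X$ for all $\mathcal D\in\mathcal F$ and $u,v\in X_{\mathcal D}$; - coercive: there is $\alpha>0$ with $\alpha|u|_X^2\le\langle u,u\rangle_F$ for all $\mathcal D\in\mathcal F$ and $u\in X_{\mathcal D}$; - consistent: suppose that $\mathcal F$ contains discretisations of arbitrarily small size. If $u_{\mathcal D}\in X_{\mathcal D,0}$ for all $\mathcal D\in\mathcal F$, if $|u_{\mathcal D}|_X\le C$ for some $C>0$ and all $\mathcal D\in\mathcal F$, and if $u\in L^2(\Omega)$ satisfies $\lim_{h_{\mathcal D}\to0}\|\Pi_{\mathcal M}u_{\mathcal D}-u\|_{L^2(\Omega)}=0$, then $u$ has zero boundary values in the sense that its extension by zero belongs to $H^1(\mathbb R^d)$, and $$\lim_{h_{\mathcal D}\to0}\langle u_{\mathcal D},P_{\mathcal D}\varphi\rangle_F=\int_\Omega\Lambda\nabla\varphi\cdot\nabla u\,dx\qquad\forall\varphi\in C_c^\infty(\Omega);$$ - symmetric: $\langle u,v\rangle_F=\langle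 v,u\rangle_F$ for all $\mathcal D\in\mathcal F$ and $u,v\in X_{\mathcal D}$. -/

import Mathlib

open MeasureTheory Filter Topology
open scoped ContDiff

noncomputable section

namespace Sushi

/-- Euclidean space `ℝ^d`. -/
abbrev Pt (d : ℕ) := EuclideanSpace ℝ (Fin d)

/-- A discretisation `(M, E, P)` of `Ω ⊆ ℝ^d`: control volumes `cell K`, edges `edge σ` lying in
the hyperplanes `plane σ`, the sets `edgesOf K` of edges of a control volume, and the points
`center K`. Both families are finite and are indexed by `Fin numCells` and `Fin numEdges`. The
`(d-1)`-dimensional measure is the Hausdorff measure normalised so as to agree with Lebesgue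
measure on hyperplanes. -/
structure Discretisation (d : ℕ) (Ω : Set (Pt d)) where
  numCells : ℕ
  numEdges : ℕ
  cell : Fin numCells → Set (Pt d)
  edge : Fin numEdges → Set (Pt d)
  plane : Fin numEdges → AffineSubspace ℝ (Pt d)
  edgesOf : Fin numCells → Finset (Fin numEdges)
  center : Fin numCells → Pt d
  -- control volumes
  cell_isOpen : ∀ K, IsOpen (cell K)
  cell_isConnected : ∀ K, IsConnected (cell K)
  cell_subset : ∀ K, cell K ⊆ Ω
  cell_disjoint : Pairwise fun K L => Disjoint (cell K) (cell L)
  closure_eq : closure Ω = ⋃ K, closure (cell K)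
  -- edges
  edge_subset : ∀ σ, edge σ ⊆ closure Ω
  edge_disjoint : Pairwise fun σ τ => Disjoint (edge σ) (edge τ)
  edge_nonempty : ∀ σ, (edge σ).Nonempty
  plane_finrank : ∀ σ, Module.finrank ℝ (plane σ).direction + 1 = d
  edge_open : ∀ σ, ∃ U : Set (Pt d), IsOpen U ∧ edge σ = U ∩ (plane σ : Set (Pt d))
  edge_measure_pos : ∀ σ, 0 < μHE[d - 1] (edge σ)
  /-- The edges are polyhedral; all that is required is that their relative boundary has zero
  `(d-1)`-dimensional measure, which rules out, e.g., complements of fat Cantor sets. -/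
  edge_boundary_null : ∀ σ, μHE[d - 1] (closure (edge σ) \ edge σ) = 0
  boundary_eq : ∀ K, closure (cell K) \ cell K = ⋃ σ ∈ edgesOf K, closure (edge σ)
  /-- Each edge either belongs to exactly one control volume, and then lies on `∂Ω`, or belongs to
  exactly two. -/
  edge_cells : ∀ σ,
    ((Finset.univ.filter fun K => σ ∈ edgesOf K).card = 1 ∧ edge σ ⊆ closure Ω \ Ω) ∨
      (Finset.univ.filter fun K => σ ∈ edgesOf K).card = 2
  -- points
  center_mem : ∀ K, center K ∈ cell K
  starShaped : ∀ K, StarConvex ℝ (center K) (cell K)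
  dist_plane_pos : ∀ K, ∀ σ ∈ edgesOf K,
    0 < Metric.infDist (center K) (plane σ : Set (Pt d))

namespace Discretisation

variable {d : ℕ} {Ω : Set (Pt d)} (D : Discretisation d Ω)

/-- Index set of the control volumes. -/
abbrev Cell := Fin D.numCells

/-- Index set of the edges. -/
abbrev Edge := Fin D.numEdges

/-- `M_σ`: the control volumes having `σ` as an edge. -/
def cellsOf (σ : D.Edge) : Finset D.Cell := Finset.univ.filter fun K => σ ∈ D.edgesOf K

/-- `σ` is a boundary interface. -/
def IsExt (σ : D.Edge) : Prop := (D.cellsOf σ).card = 1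

/-- `σ` is an interior interface. -/
def IsInt (σ : D.Edge) : Prop := (D.cellsOf σ).card = 2

/-- `|K|`. -/
def cellVol (K : D.Cell) : ℝ := volume.real (D.cell K)

/-- `|σ|`. -/
def edgeVol (σ : D.Edge) : ℝ := (μHE[d - 1] : Measure (Pt d)).real (D.edge σ)

/-- The diameter `h_K`. -/
def cellDiam (K : D.Cell) : ℝ := Metric.diam (D.cell K)

/-- `x_σ`, the barycentre of `σ`. -/
def bary (σ : D.Edge) : Pt d := ⨍ y in D.edge σ, y ∂(μHE[d - 1])

/-- `d_{K,σ}`, the distance from `x_K` to the hyperplane that contains `σ`. -/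
def dist (K : D.Cell) (σ : D.Edge) : ℝ :=
  Metric.infDist (D.center K) (D.plane σ : Set (Pt d))

/-- `n` is a unit vector normal to `σ` and outward to `K`. -/
def IsOutwardUnitNormal (K : D.Cell) (σ : D.Edge) (n : Pt d) : Prop :=
  ‖n‖ = 1 ∧ (∀ w ∈ (D.plane σ).direction, inner ℝ n w = 0) ∧
    ∀ y ∈ D.edge σ, ∀ᶠ t : ℝ in 𝓝[>] 0, y - t • n ∈ D.cell K ∧ y + t • n ∉ D.cell K

/-- `n_{K,σ}`, the unit vector normal to `σ` outward to `K` (used for `σ ∈ E_K` only). -/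
def normal (K : D.Cell) (σ : D.Edge) : Pt d := Classical.epsilon (D.IsOutwardUnitNormal K σ)

/-- `D_{K,σ}`, the (open) cone with vertex `x_K` and basis `σ`. -/
def cone (K : D.Cell) (σ : D.Edge) : Set (Pt d) :=
  {x | ∃ y ∈ D.edge σ, ∃ t ∈ Set.Ioo (0 : ℝ) 1, x = D.center K + t • (y - D.center K)}

/-- The mesh size `h_D`. -/
def size : ℝ := ⨆ K, D.cellDiam K

/-- The mesh regularity `θ_D`, the largest of the ratios `d_{K,σ} / d_{L,σ}` (`σ` interior,
`K, L ∈ M_σ`) and `h_K / d_{K,σ}` (`σ ∈ E_K`). -/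
def theta : ℝ :=
  sSup ({r | ∃ σ, D.IsInt σ ∧ ∃ K ∈ D.cellsOf σ, ∃ L ∈ D.cellsOf σ, r = D.dist K σ / D.dist L σ} ∪
    {r | ∃ K, ∃ σ ∈ D.edgesOf K, r = D.cellDiam K / D.dist K σ})

/-- The space `X_D` of discrete unknowns `((v_K)_K, (v_σ)_σ)`. -/
abbrev X := (D.Cell → ℝ) × (D.Edge → ℝ)

/-- Membership in `X_{D,0}`: the unknowns vanish on the boundary interfaces. -/
def MemX0 (v : D.X) : Prop := ∀ σ, D.IsExt σ → v.2 σ = 0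

/-- The seminorm `|v|_X`. -/
def seminormX (v : D.X) : ℝ :=
  √(∑ K, ∑ σ ∈ D.edgesOf K, D.edgeVol σ / D.dist K σ * (v.2 σ - v.1 K) ^ 2)

/-- `Π_M v`: the function equal to `v_K` on each control volume `K`. -/
def proj (v : D.X) (x : Pt d) : ℝ := ∑ K, (D.cell K).indicator (fun _ => v.1 K) x

/-- `P_D φ`: the values of `φ` at the points `x_K` and `x_σ`. -/
def interp (φ : Pt d → ℝ) : D.X := (fun K => φ (D.center K), fun σ => φ (D.bary σ))

/-- `∇_K u`. -/
def gradCell (u : D.X) (K : D.Cell) : Pt d :=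
  (D.cellVol K)⁻¹ • ∑ σ ∈ D.edgesOf K, (D.edgeVol σ * (u.2 σ - u.1 K)) • D.normal K σ

/-- The stabilisation term `R_{K,σ} u`. -/
def stab (u : D.X) (K : D.Cell) (σ : D.Edge) : ℝ :=
  √(d : ℝ) / D.dist K σ *
    (u.2 σ - u.1 K - inner ℝ (D.gradCell u K) (D.bary σ - D.center K))

/-- The stabilised gradient `∇_{K,σ} u`. -/
def gradCone (u : D.X) (K : D.Cell) (σ : D.Edge) : Pt d :=
  D.gradCell u K + D.stab u K σ • D.normal K σ

/-- The discrete gradient `∇_D u`, equal to `∇_{K,σ} u` on each cone `D_{K,σ}`. -/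
def grad (u : D.X) (x : Pt d) : Pt d :=
  ∑ K, ∑ σ ∈ D.edgesOf K, (D.cone K σ).indicator (fun _ => D.gradCone u K σ) x

/-- The vectors `y^{σσ'}` of the control volume `K`. -/
def yVec (K : D.Cell) (σ σ' : D.Edge) : Pt d :=
  if σ = σ' then
    (D.edgeVol σ / D.cellVol K) • D.normal K σ +
      (√(d : ℝ) / D.dist K σ * (1 - D.edgeVol σ / D.cellVol K *
        inner ℝ (D.normal K σ) (D.bary σ - D.center K))) • D.normal K σ
  else
    (D.edgeVol σ' / D.cellVol K) • D.normal K σ' -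
      (√(d : ℝ) / (D.dist K σ * D.cellVol K) * D.edgeVol σ' *
        inner ℝ (D.normal K σ') (D.bary σ - D.center K)) • D.normal K σ

/-- `Λ_{K,σ} = ∫_{D_{K,σ}} Λ(x) dx`. -/
def coneIntegral (Λ : Pt d → Matrix (Fin d) (Fin d) ℝ) (K : D.Cell) (σ : D.Edge) :
    Matrix (Fin d) (Fin d) ℝ :=
  Matrix.of fun i j => ∫ x in D.cone K σ, Λ x i j

/-- The local matrix `A_K^{σσ'}`. -/
def localMatrix (Λ : Pt d → Matrix (Fin d) (Fin d) ℝ) (K : D.Cell) (σ σ' : D.Edge) : ℝ :=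
  ∑ τ ∈ D.edgesOf K,
    inner ℝ (D.yVec K τ σ) (Matrix.toEuclideanLin (D.coneIntegral Λ K τ) (D.yVec K τ σ'))

/-- The linear form `u ↦ u_K - u_σ` on `X_D`. -/
def diffForm (K : D.Cell) (σ : D.Edge) : D.X →ₗ[ℝ] ℝ :=
  LinearMap.proj K ∘ₗ LinearMap.fst ℝ (D.Cell → ℝ) (D.Edge → ℝ) -
    LinearMap.proj σ ∘ₗ LinearMap.snd ℝ (D.Cell → ℝ) (D.Edge → ℝ)

/-- A collection of numerical fluxes `(F_{K,σ})` on `D`: linear forms on `X_D`. -/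
abbrev Fluxes := D.Cell → D.Edge → (D.X →ₗ[ℝ] ℝ)

/-- The SUSHI fluxes `F_{K,σ}(u) = ∑_{σ'} A_K^{σσ'} (u_K - u_{σ'})`. -/
def sushiFlux (Λ : Pt d → Matrix (Fin d) (Fin d) ℝ) : D.Fluxes := fun K σ =>
  ∑ σ' ∈ D.edgesOf K, D.localMatrix Λ K σ σ' • D.diffForm K σ'

/-- The bilinear form `⟨u, v⟩_F`. -/
def form (F : D.Fluxes) (u v : D.X) : ℝ :=
  ∑ K, ∑ σ ∈ D.edgesOf K, F K σ u * (v.1 K - v.2 σ)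

end Discretisation

/-- `φ ∈ C_c^∞(U)`. -/
def IsTest {d : ℕ} (U : Set (Pt d)) (φ : Pt d → ℝ) : Prop :=
  ContDiff ℝ ∞ φ ∧ HasCompactSupport φ ∧ tsupport φ ⊆ U

/-- `u ∈ L²(U)` has the weak gradient `G ∈ L²(U)^d` on the open set `U`. -/
def HasWeakGradient {d : ℕ} (U : Set (Pt d)) (u : Pt d → ℝ) (G : Pt d → Pt d) : Prop :=
  MemLp u 2 (volume.restrict U) ∧ MemLp G 2 (volume.restrict U) ∧
    ∀ φ, IsTest U φ → ∫ x in U, u x • gradient φ x = -∫ x in U, φ x • G x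

/-- The extension of `u` by zero outside `Ω` belongs to `H^1(ℝ^d)`, the form in which membership
of `u` in `H^1_0(Ω)` is expressed. -/
def ZeroExtensionMemH1 {d : ℕ} (Ω : Set (Pt d)) (u : Pt d → ℝ) : Prop :=
  ∃ G, HasWeakGradient Set.univ (Ω.indicator u) G

/-- The diffusion field: `Λ` is measurable on `Ω` and, for a.e. `x ∈ Ω`, symmetric with all its
eigenvalues in `[lo, hi]`. -/
def IsDiffusionField {d : ℕ} (Ω : Set (Pt d)) (lo hi : ℝ)
    (Λ : Pt d → Matrix (Fin d) (Fin d) ℝ) : Prop :=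
  (∀ i j, Measurable fun x : Ω => Λ x i j) ∧
    ∀ᵐ x ∂(volume.restrict Ω), (Λ x).IsSymm ∧ spectrum ℝ (Λ x) ⊆ Set.Icc lo hi

section Families

variable {d : ℕ} {Ω : Set (Pt d)} {ι : Type*} (D : ι → Discretisation d Ω)

/-- The filter `h_D → 0` on a family of discretisations. -/
def sizeToZero : Filter ι := comap (fun i => (D i).size) (𝓝 0)

/-- Continuous family of fluxes. -/
def IsContinuousFamily (Φ : ∀ i, (D i).Fluxes) : Prop :=
  ∃ M > 0, ∀ i, ∀ u v : (D i).X,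
    (D i).form (Φ i) u v ≤ M * (D i).seminormX u * (D i).seminormX v

/-- Coercive family of fluxes. -/
def IsCoerciveFamily (Φ : ∀ i, (D i).Fluxes) : Prop :=
  ∃ α > 0, ∀ i, ∀ u : (D i).X, α * (D i).seminormX u ^ 2 ≤ (D i).form (Φ i) u u

/-- Consistent family of fluxes. A limit as `h_D → 0` presupposes that the family contains
discretisations of arbitrarily small size, hence the requirement `NeBot`. -/
def IsConsistentFamily (Λ : Pt d → Matrix (Fin d) (Fin d) ℝ) (Φ : ∀ i, (D i).Fluxes) : Prop :=
  (sizeToZero D).NeBot →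
    ∀ (w : ∀ i, (D i).X) (u : Pt d → ℝ),
      (∀ i, (D i).MemX0 (w i)) →
      (∃ C > 0, ∀ i, (D i).seminormX (w i) ≤ C) →
      MemLp u 2 (volume.restrict Ω) →
      Tendsto (fun i => eLpNorm (fun x => (D i).proj (w i) x - u x) 2 (volume.restrict Ω))
        (sizeToZero D) (𝓝 0) →
      ZeroExtensionMemH1 Ω u ∧
        ∀ G, HasWeakGradient Ω u G → ∀ φ, IsTest Ω φ →
          Tendsto (fun i => (D i).form (Φ i) (w i) ((D i).interp φ)) (sizeToZero D)
            (𝓝 (∫ x in Ω, inner ℝ (Matrix.toEuclideanLin (Λ x) (gradient φ x)) (G x)))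

/-- Symmetric family of fluxes. -/
def IsSymmetricFamily (Φ : ∀ i, (D i).Fluxes) : Prop :=
  ∀ i, ∀ u v : (D i).X, (D i).form (Φ i) u v = (D i).form (Φ i) v u

end Families

end Sushi

end

/-! Everything rests on two geometric identities in each cell: `sum_edgeVol_smul_normal`, `∑ |σ|
n_{K,σ} = 0`, and `sum_inner_bary_smul_normal`, `∑ |σ| (a · (x_σ - x_K)) n_{K,σ} = |K| a`. Cells are
only star-shaped, with edges that need not be convex, so these are not taken from a divergence
theorem with boundary traces. Instead a Lipschitz function is integrated by parts against the hat
function `1 - gauge` of the cell, whose gradient is the constant `-n_{K,σ} / d_{K,σ}` on each cone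
(`integral_lineDeriv_mul_hat`). The volumes and first moments of the cones turn the test functions
`1` and `a · (x - x_K)` into the two identities.

The second identity makes `∇_K` exact on affine functions and makes the stabilisation average to
zero over the cell. Hence the energy of the discrete gradient is `|K| |∇_K u|² + ∑ |D_{K,σ}| R²`
(`gradEnergy_eq`), and the bound `h_K ≤ θ d_{K,σ}` makes it equivalent to the seminorm, cell by cell
(`gradEnergy_le`, `cellEnergy_le`). As `y^{τσ}` is the coefficient of `u_σ - u_K` in `∇_{K,τ} u`,
the flux form is the integral of `∇_D u · Λ ∇_D v` (`form_sushiFlux_eq_sum`). Symmetry, continuity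
and coercivity then follow from the pointwise properties of `Λ`.

For consistency, a discrete integration by parts with error of the order of `h_D`
(`norm_setIntegral_smul_grad_add_le`) shows that the discrete gradients converge, in the sense of
distributions on the whole space, to the gradient of the zero extension of `u`. They are bounded in
`L²`, so along any ultrafilter they have a weak limit, which is that gradient. The discrete gradient
of an interpolant converges uniformly on the cones (`norm_gradCone_interp_sub_le`), so the form is
asymptotically a pairing of the fixed field `Λ∇φ` with a weakly convergent one. The limit does not
depend on the ultrafilter, hence the whole family converges. Strong compactness plays no role, since
convergence of `Π_M u_D` is assumed. -/

noncomputable section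

namespace Sushi

/-! ### Volume and first moment of a cone, by slicing parallel to its basis. -/

section Cones

variable {d : ℕ}

/-- The open cone with vertex `c` and basis `B`. -/
def coneOver (c : Pt d) (B : Set (Pt d)) : Set (Pt d) :=
  {x | ∃ y ∈ B, ∃ t ∈ Set.Ioo (0 : ℝ) 1, x = c + t • (y - c)}

/-- The height of `x` above `c` in the direction `n`, in units of `δ`. -/
def level (c n : Pt d) (δ : ℝ) (x : Pt d) : ℝ := inner ℝ n (x - c) / δ

/-- The central projection, with centre `c`, of `x` onto the hyperplane of level `1`. -/
def foot (c n : Pt d) (δ : ℝ) (x : Pt d) : Pt d := c + (level c n δ x)⁻¹ • (x - c)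

theorem continuous_level (c n : Pt d) (δ : ℝ) : Continuous (level c n δ) := by
  unfold level; fun_prop

theorem measurable_foot (c n : Pt d) (δ : ℝ) : Measurable (foot c n δ) := by
  have := (continuous_level c n δ).measurable
  unfold foot; fun_prop

theorem level_homothety {c n : Pt d} {δ : ℝ} (hδ : 0 < δ) {y : Pt d}
    (hy : inner ℝ n (y - c) = δ) (t : ℝ) : level c n δ (c + t • (y - c)) = t := by
  simp [level, inner_smul_right, hy, hδ.ne']

theorem foot_homothety {c n : Pt d} {δ : ℝ} (hδ : 0 < δ) {y : Pt d}
    (hy : inner ℝ n (y - c) = δ) {t : ℝ} (ht : t ≠ 0) : foot c n δ (c + t • (y - c)) = y := by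
  simp [foot, level_homothety hδ hy, smul_smul, ht]

theorem add_level_smul_foot {c n : Pt d} {δ : ℝ} {x : Pt d} (hx : level c n δ x ≠ 0) :
    c + level c n δ x • (foot c n δ x - c) = x := by
  simp [foot, smul_smul, hx]

theorem mem_coneOver_iff {c n : Pt d} {δ : ℝ} (hδ : 0 < δ) {B : Set (Pt d)}
    (hB : ∀ y ∈ B, inner ℝ n (y - c) = δ) {x : Pt d} :
    x ∈ coneOver c B ↔ level c n δ x ∈ Set.Ioo (0 : ℝ) 1 ∧ foot c n δ x ∈ B := by
  constructor
  · rintro ⟨y, hy, t, ht, rfl⟩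
    rw [level_homothety hδ (hB y hy), foot_homothety hδ (hB y hy) ht.1.ne']
    exact ⟨ht, hy⟩
  · rintro ⟨ht, hy⟩
    exact ⟨_, hy, _, ht, (add_level_smul_foot ht.1.ne').symm⟩

theorem measurableSet_coneOver {c n : Pt d} {δ : ℝ} (hδ : 0 < δ) {B : Set (Pt d)}
    (hB : ∀ y ∈ B, inner ℝ n (y - c) = δ) (hBm : MeasurableSet B) :
    MeasurableSet (coneOver c B) := by
  have : coneOver c B = level c n δ ⁻¹' Set.Ioo 0 1 ∩ foot c n δ ⁻¹' B := by
    ext x; exact mem_coneOver_iff hδ hB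
  rw [this]
  exact ((continuous_level c n δ).measurable measurableSet_Ioo).inter
    (measurable_foot c n δ hBm)

/-- The volume of the part of a cone whose levels belong to `A`. -/
theorem volume_level_inter_foot {c n : Pt d} {δ : ℝ} (hn : ‖n‖ = 1)
    (hδ : 0 < δ) {B : Set (Pt d)} (hB : ∀ y ∈ B, inner ℝ n (y - c) = δ) (hBm : MeasurableSet B)
    {A : Set ℝ} (hA : MeasurableSet A) :
    volume (level c n δ ⁻¹' (A ∩ Set.Ioo 0 1) ∩ foot c n δ ⁻¹' B) =
      ENNReal.ofReal δ * (∫⁻ t in A ∩ Set.Ioo 0 1, ENNReal.ofReal (t ^ (d - 1))) *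
        μHE[d - 1] B := by
  have hfin : Module.finrank ℝ (Pt d) = d := by simp
  have hmS : MeasurableSet (level c n δ ⁻¹' (A ∩ Set.Ioo 0 1) ∩ foot c n δ ⁻¹' B) :=
    ((continuous_level c n δ).measurable (hA.inter measurableSet_Ioo)).inter
      (measurable_foot c n δ hBm)
  have hn0 : n ≠ 0 := by rintro rfl; simp at hn
  have hv : δ • n ≠ 0 := smul_ne_zero hδ.ne' hn0
  have hvol : (volume : Measure (Pt d)) = μHE[Module.finrank ℝ (Pt d)] :=
    InnerProductSpace.euclideanHausdorffMeasure_eq_volume.symm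
  -- Slicing along `δ • n` instead of `n` makes the slice parameter equal to `level`, with the basis
  -- at parameter `1`; the price is the factor `‖δ • n‖ = δ`.
  rw [hvol, EuclideanGeometry.euclideanHausdorffMeasure_eq_lintegral c hv hmS, hfin, mul_assoc]
  congr 1
  · rw [enorm_smul, ← ofReal_norm n, hn, Real.enorm_of_nonneg hδ.le]; simp
  have hplane : ∀ (t : ℝ) (x : Pt d),
      x ∈ AffineSubspace.mk' (t • δ • n +ᵥ c) (Submodule.span ℝ {δ • n})ᗮ ↔
        level c n δ x = t := by
    intro t x
    rw [AffineSubspace.mem_mk', Submodule.mem_orthogonal_singleton_iff_inner_right]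
    simp only [vsub_eq_sub, vadd_eq_add, level]
    rw [show x - (t • δ • n + c) = (x - c) - (t * δ) • n by rw [smul_smul]; abel,
      inner_sub_right, inner_smul_left, inner_smul_right, inner_smul_left,
      real_inner_self_eq_norm_sq, hn, div_eq_iff hδ.ne']
    simp only [conj_trivial]
    constructor
    · intro h
      have : δ * (inner ℝ n (x - c) - t * δ) = 0 := by linarith
      have := (mul_eq_zero.1 this).resolve_left hδ.ne'
      linarith
    · intro h; rw [h]; ring
  have hslice : ∀ t : ℝ,
      μHE[d - 1] (level c n δ ⁻¹' (A ∩ Set.Ioo 0 1) ∩ foot c n δ ⁻¹' B ∩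
        (AffineSubspace.mk' (t • δ • n +ᵥ c) (Submodule.span ℝ {δ • n})ᗮ : Set (Pt d))) =
      (A ∩ Set.Ioo 0 1).indicator (fun t => ENNReal.ofReal (t ^ (d - 1)) * μHE[d - 1] B) t := by
    intro t
    by_cases ht : t ∈ A ∩ Set.Ioo 0 1
    -- The slice at level `t` is the basis scaled by `t` about the vertex, which is where the weight
    -- `t ^ (d - 1)` comes from.
    · have : level c n δ ⁻¹' (A ∩ Set.Ioo 0 1) ∩ foot c n δ ⁻¹' B ∩
          (AffineSubspace.mk' (t • δ • n +ᵥ c) (Submodule.span ℝ {δ • n})ᗮ : Set (Pt d)) =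
          AffineMap.homothety c t '' B := by
        ext x
        simp only [Set.mem_inter_iff, Set.mem_preimage, SetLike.mem_coe, hplane, Set.mem_image,
          AffineMap.homothety_apply]
        simp only [vsub_eq_sub, vadd_eq_add]
        constructor
        · rintro ⟨⟨h1, h2⟩, h3⟩
          refine ⟨_, h2, ?_⟩
          rw [← h3, add_comm]
          exact add_level_smul_foot (by rw [h3]; exact ht.2.1.ne')
        · rintro ⟨y, hy, rfl⟩
          rw [add_comm, level_homothety hδ (hB y hy), foot_homothety hδ (hB y hy) ht.2.1.ne']
          exact ⟨⟨ht, hy⟩, rfl⟩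
      rw [this, euclideanHausdorffMeasure_homothety_image _ _ ht.2.1.ne', Set.indicator_of_mem ht,
        ENNReal.smul_def, smul_eq_mul]
      congr 1
      rw [ENNReal.ofReal_pow ht.2.1.le, ENNReal.coe_pow]
      congr 1
      rw [← enorm_eq_nnnorm, Real.enorm_of_nonneg ht.2.1.le]
    · rw [Set.indicator_of_notMem ht]
      convert measure_empty
      · ext x
        simp only [Set.mem_inter_iff, Set.mem_preimage, SetLike.mem_coe, hplane,
          Set.mem_empty_iff_false, iff_false]
        rintro ⟨⟨h1, h2⟩, h3⟩
        exact ht (h3 ▸ h1)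
      · infer_instance
  simp_rw [hslice]
  rw [lintegral_indicator (hA.inter measurableSet_Ioo), lintegral_mul_const _ (by fun_prop)]

theorem setIntegral_Ioo_pow (k : ℕ) : ∫ t in Set.Ioo (0 : ℝ) 1, t ^ k = 1 / (k + 1) := by
  rw [← integral_Ioc_eq_integral_Ioo, ← intervalIntegral.integral_of_le zero_le_one,
    integral_pow]
  simp

theorem integrableOn_Ioo_pow (k : ℕ) : IntegrableOn (fun t : ℝ => t ^ k) (Set.Ioo 0 1) :=
  ((continuous_pow k).integrableOn_Icc (a := 0) (b := 1)).mono_set Set.Ioo_subset_Icc_self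

theorem lintegral_Ioo_pow (k : ℕ) :
    ∫⁻ t in Set.Ioo (0 : ℝ) 1, ENNReal.ofReal (t ^ k) = ENNReal.ofReal (1 / (k + 1)) := by
  rw [← setIntegral_Ioo_pow, ofReal_integral_eq_lintegral_ofReal (integrableOn_Ioo_pow k)]
  filter_upwards [ae_restrict_mem measurableSet_Ioo] with t ht
  exact pow_nonneg ht.1.le _

theorem volume_coneOver (hd : 0 < d) {c n : Pt d} {δ : ℝ} (hn : ‖n‖ = 1)
    (hδ : 0 < δ) {B : Set (Pt d)} (hB : ∀ y ∈ B, inner ℝ n (y - c) = δ) (hBm : MeasurableSet B) :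
    volume (coneOver c B) = ENNReal.ofReal (δ / d) * μHE[d - 1] B := by
  have h := volume_level_inter_foot (d := d) hn hδ hB hBm MeasurableSet.univ
  have : coneOver c B = level c n δ ⁻¹' (Set.univ ∩ Set.Ioo 0 1) ∩ foot c n δ ⁻¹' B := by
    ext x; rw [mem_coneOver_iff hδ hB]; simp
  rw [this, h, Set.univ_inter, lintegral_Ioo_pow, ← ENNReal.ofReal_mul hδ.le]
  congr 2
  have : ((d - 1 : ℕ) : ℝ) + 1 = d := by
    rw [← Nat.cast_add_one, Nat.sub_add_cancel hd]
  rw [this]; ring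

/-- The first moment of a cone with respect to its vertex. -/
theorem setIntegral_coneOver_sub (hd : 0 < d) {c n : Pt d} {δ : ℝ} (hn : ‖n‖ = 1)
    (hδ : 0 < δ) {B : Set (Pt d)} (hB : ∀ y ∈ B, inner ℝ n (y - c) = δ) (hBm : MeasurableSet B)
    (hBf : μHE[d - 1] B ≠ ⊤) :
    ∫ x in coneOver c B, (x - c) = (δ / (d + 1)) • ∫ y in B, (y - c) ∂(μHE[d - 1]) := by
  have hcm := measurableSet_coneOver hδ hB hBm
  have hlm := (continuous_level c n δ).measurable
  have hfm := measurable_foot c n δ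
  set ρ : Measure ℝ := (volume.restrict (Set.Ioo 0 1)).withDensity
    fun t => ENNReal.ofReal (δ * t ^ (d - 1)) with hρ
  set ν : Measure (Pt d) := (μHE[d - 1]).restrict B with hν
  have hνf : IsFiniteMeasure ν := ⟨by rw [hν, Measure.restrict_apply_univ]; exact hBf.lt_top⟩
  have hdens : ∀ t, ENNReal.ofReal (δ * t ^ (d - 1)) =
      ENNReal.ofReal δ * ENNReal.ofReal (t ^ (d - 1)) := fun t => ENNReal.ofReal_mul hδ.le
  -- In the coordinates `(level, foot)` the volume on the cone is a product measure, and `x - c` is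
  -- the product of the level and `foot - c`; the moment therefore factorises, and the extra factor
  -- `t` turns `t ^ (d - 1)` into `t ^ d`.
  have hmap : (volume.restrict (coneOver c B)).map (fun x => (level c n δ x, foot c n δ x)) =
      ρ.prod ν := by
    symm
    have : SFinite ρ := by rw [hρ]; infer_instance
    have : IsFiniteMeasure ρ := ⟨by
      rw [hρ, withDensity_apply _ MeasurableSet.univ, Measure.restrict_univ]
      simp_rw [hdens]
      rw [lintegral_const_mul _ (by fun_prop), lintegral_Ioo_pow]
      exact ENNReal.mul_lt_top ENNReal.ofReal_lt_top ENNReal.ofReal_lt_top⟩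
    refine Measure.prod_eq fun A C hA hC => ?_
    rw [Measure.map_apply (hlm.prodMk hfm) (hA.prod hC), Measure.restrict_apply
      ((hlm.prodMk hfm) (hA.prod hC)), hν, Measure.restrict_apply hC]
    have h := volume_level_inter_foot (d := d) hn hδ (B := C ∩ B) (fun y hy => hB y hy.2)
      (hC.inter hBm) hA
    have hset : (fun x => (level c n δ x, foot c n δ x)) ⁻¹' A ×ˢ C ∩ coneOver c B =
        level c n δ ⁻¹' (A ∩ Set.Ioo 0 1) ∩ foot c n δ ⁻¹' (C ∩ B) := by
      ext x
      simp only [Set.mem_inter_iff, Set.mem_preimage, Set.mem_prod, mem_coneOver_iff hδ hB]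
      tauto
    rw [hset, h, hρ, withDensity_apply _ hA, Measure.restrict_restrict hA]
    simp_rw [hdens]
    rw [lintegral_const_mul _ (by fun_prop)]
  have h1 : ∫ x in coneOver c B, (x - c) =
      ∫ z, z.1 • (z.2 - c) ∂(volume.restrict (coneOver c B)).map
        (fun x => (level c n δ x, foot c n δ x)) := by
    rw [integral_map (hlm.prodMk hfm).aemeasurable (by fun_prop)]
    refine setIntegral_congr_fun hcm fun x hx => ?_
    have := add_level_smul_foot (((mem_coneOver_iff hδ hB).1 hx).1.1.ne')
    simp only
    rw [eq_sub_of_add_eq' this]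
  rw [h1, hmap, integral_prod_smul (fun t : ℝ => t) (fun y : Pt d => y - c)]
  congr 1
  rw [hρ, integral_withDensity_eq_integral_toReal_smul (by fun_prop) (by simp)]
  have : ∀ t ∈ Set.Ioo (0 : ℝ) 1,
      (ENNReal.ofReal (δ * t ^ (d - 1))).toReal • t = δ * t ^ d := by
    intro t ht
    rw [ENNReal.toReal_ofReal (mul_nonneg hδ.le (pow_nonneg ht.1.le _)), smul_eq_mul, mul_assoc,
      ← pow_succ, Nat.sub_add_cancel hd]
  rw [setIntegral_congr_fun measurableSet_Ioo this, integral_const_mul, setIntegral_Ioo_pow]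
  ring

end Cones

/-! ### Hyperplanes and their unit normals. -/

/-- A hyperplane is the level set of a unit normal vector. -/
theorem exists_unit_normal {d : ℕ} (P : AffineSubspace ℝ (Pt d)) (hP : (P : Set (Pt d)).Nonempty)
    (hfin : Module.finrank ℝ P.direction + 1 = d) (c : Pt d)
    (hc : 0 < Metric.infDist c (P : Set (Pt d))) :
    ∃ n : Pt d, ‖n‖ = 1 ∧
      (∀ y, y ∈ P ↔ inner ℝ n (y - c) = Metric.infDist c (P : Set (Pt d))) ∧
      ∀ w, w ∈ P.direction ↔ inner ℝ n w = 0 := by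
  have : Nonempty P := hP.to_subtype
  set δ := Metric.infDist c (P : Set (Pt d)) with hδ
  obtain ⟨q, hq⟩ : ∃ q : Pt d, q = (EuclideanGeometry.orthogonalProjection P c : P) := ⟨_, rfl⟩
  have hqP : q ∈ P := hq ▸ EuclideanGeometry.orthogonalProjection_mem c
  have hdist : ‖q - c‖ = δ := by
    rw [hδ, ← EuclideanGeometry.dist_orthogonalProjection_eq_infDist P c, dist_comm,
      dist_eq_norm, hq]
  have hperp : ∀ w ∈ P.direction, inner ℝ (q - c) w = 0 := by
    intro w hw
    have := EuclideanGeometry.orthogonalProjection_vsub_mem_direction_orthogonal P c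
    rw [← hq] at this
    rw [real_inner_comm]
    exact (Submodule.mem_orthogonal _ _).1 this w hw
  have hself : inner ℝ (δ⁻¹ • (q - c)) (q - c) = δ := by
    rw [inner_smul_left, real_inner_self_eq_norm_sq, hdist]
    simp only [conj_trivial]
    field_simp
  have hnorm : ‖δ⁻¹ • (q - c)‖ = 1 := by
    rw [norm_smul, hdist, Real.norm_of_nonneg (inv_nonneg.2 hc.le), inv_mul_cancel₀ hc.ne']
  have hdir : ∀ w, w ∈ P.direction ↔ inner ℝ (δ⁻¹ • (q - c)) w = 0 := by
    intro w
    constructor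
    · intro hw
      rw [inner_smul_left, hperp w hw, mul_zero]
    · intro hw
      -- The direction is contained in the orthogonal complement of the normal, and both have
      -- dimension `d - 1`.
      have hle : P.direction ≤ (Submodule.span ℝ {δ⁻¹ • (q - c)})ᗮ := by
        intro v hv
        rw [Submodule.mem_orthogonal_singleton_iff_inner_right, inner_smul_left, hperp v hv,
          mul_zero]
      have hne : δ⁻¹ • (q - c) ≠ 0 := by
        intro h; rw [h] at hnorm; simp at hnorm
      have h1 := (Submodule.span ℝ {δ⁻¹ • (q - c)}).finrank_add_finrank_orthogonal
      rw [finrank_span_singleton hne, finrank_euclideanSpace, Fintype.card_fin] at h1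
      rw [Submodule.eq_of_le_of_finrank_eq hle (by omega)]
      rwa [Submodule.mem_orthogonal_singleton_iff_inner_right]
  refine ⟨δ⁻¹ • (q - c), hnorm, fun y => ?_, hdir⟩
  rw [← AffineSubspace.vsub_right_mem_direction_iff_mem hqP y, hdir, vsub_eq_sub,
    show y - q = (y - c) - (q - c) by abel, inner_sub_right, hself, sub_eq_zero]

/-- With `a = ⟨n, m⟩`, the vector `m - a n` is orthogonal to `n`, hence by hypothesis to `m`. This
forces `a² = 1`, and `m - a n` is then orthogonal to itself. -/
theorem eq_or_eq_neg_of_forall_inner {d : ℕ} {n m : Pt d} (hn : ‖n‖ = 1) (hm : ‖m‖ = 1)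
    (h : ∀ w, inner ℝ n w = 0 → inner ℝ m w = 0) : m = n ∨ m = -n := by
  have hnn : inner ℝ n n = (1 : ℝ) := by rw [real_inner_self_eq_norm_sq, hn]; norm_num
  have hmm : inner ℝ m m = (1 : ℝ) := by rw [real_inner_self_eq_norm_sq, hm]; norm_num
  set a : ℝ := inner ℝ n m with ha
  have h1 : inner ℝ m (m - a • n) = 0 := by
    apply h
    rw [inner_sub_right, inner_smul_right, hnn, ← ha]; ring
  have h2 : a ^ 2 = 1 := by
    rw [inner_sub_right, inner_smul_right, hmm, real_inner_comm, ← ha] at h1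
    linarith [sq a]
  have h3 : m - a • n = 0 := by
    rw [← inner_self_eq_zero (𝕜 := ℝ), inner_sub_left, h1, inner_smul_left, inner_sub_right,
      inner_smul_right, hnn, ← ha]
    simp
  rw [sub_eq_zero] at h3
  rcases sq_eq_one_iff.1 h2 with h | h
  · left; rw [h3, h, one_smul]
  · right; rw [h3, h, neg_one_smul]

/-! ### Geometry of a star-shaped cell: boundary, outward normals, cones. -/

namespace Discretisation

variable {d : ℕ} {Ω : Set (Pt d)} (D : Discretisation d Ω)

theorem edge_subset_plane (σ : D.Edge) : D.edge σ ⊆ D.plane σ := by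
  obtain ⟨U, -, h⟩ := D.edge_open σ
  rw [h]; exact Set.inter_subset_right

theorem closure_edge_subset_plane (σ : D.Edge) : closure (D.edge σ) ⊆ D.plane σ :=
  closure_minimal (D.edge_subset_plane σ) (AffineSubspace.closed_of_finiteDimensional _)

theorem measurableSet_edge (σ : D.Edge) : MeasurableSet (D.edge σ) := by
  obtain ⟨U, hU, h⟩ := D.edge_open σ
  rw [h]
  exact hU.measurableSet.inter (AffineSubspace.closed_of_finiteDimensional _).measurableSet

theorem dist_pos {K : D.Cell} {σ : D.Edge} (hσ : σ ∈ D.edgesOf K) : 0 < D.dist K σ :=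
  D.dist_plane_pos K σ hσ

theorem closure_edge_subset_boundary {K : D.Cell} {σ : D.Edge} (hσ : σ ∈ D.edgesOf K) :
    closure (D.edge σ) ⊆ closure (D.cell K) \ D.cell K := by
  rw [D.boundary_eq K]
  exact Set.subset_biUnion_of_mem (u := fun σ => closure (D.edge σ)) hσ

theorem edge_subset_boundary {K : D.Cell} {σ : D.Edge} (hσ : σ ∈ D.edgesOf K) :
    D.edge σ ⊆ closure (D.cell K) \ D.cell K :=
  subset_closure.trans (D.closure_edge_subset_boundary hσ)

theorem exists_edge_of_mem_boundary {K : D.Cell} {y : Pt d}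
    (hy : y ∈ closure (D.cell K) \ D.cell K) : ∃ σ ∈ D.edgesOf K, y ∈ closure (D.edge σ) := by
  rw [D.boundary_eq K] at hy
  simpa using hy

theorem exists_level_vector {K : D.Cell} {σ : D.Edge} (hσ : σ ∈ D.edgesOf K) :
    ∃ n : Pt d, ‖n‖ = 1 ∧ (∀ y, y ∈ D.plane σ ↔ inner ℝ n (y - D.center K) = D.dist K σ) ∧
      ∀ w, w ∈ (D.plane σ).direction ↔ inner ℝ n w = 0 :=
  exists_unit_normal _ ((D.edge_nonempty σ).mono (D.edge_subset_plane σ)) (D.plane_finrank σ) _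
    (D.dist_pos hσ)

/-- The half-open segment from the centre of a cell to a boundary point lies in the cell. -/
theorem segment_mem_cell {K : D.Cell} {y : Pt d} (hy : y ∈ closure (D.cell K) \ D.cell K)
    {t : ℝ} (ht0 : 0 ≤ t) (ht1 : t < 1) : D.center K + t • (y - D.center K) ∈ D.cell K := by
  set c := D.center K
  by_contra hnot
  -- If one point of the segment is missed, star-shapedness makes all later ones missed too. A whole
  -- subsegment then lies in the boundary, hence in finitely many hyperplanes; but each of these is
  -- at positive distance from the centre and meets the ray at most once.
  have hray : ∀ s ∈ Set.Ico t 1, c + s • (y - c) ∈ closure (D.cell K) \ D.cell K := by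
    intro s hs
    have hs0 : 0 ≤ s := ht0.trans hs.1
    constructor
    · exact map_mem_closure (f := fun z => c + s • (z - c)) (by fun_prop) hy.1
        fun z hz => (D.starShaped K).add_smul_sub_mem hz hs0 hs.2.le
    · intro hmem
      rcases hs0.eq_or_lt with h0 | hs0
      · have : t = s := le_antisymm hs.1 (h0 ▸ ht0)
        exact hnot (this ▸ hmem)
      apply hnot
      have := (D.starShaped K).add_smul_sub_mem hmem (t := t / s) (by positivity)
        ((div_le_one hs0).2 hs.1)
      rwa [add_sub_cancel_left, smul_smul, div_mul_cancel₀ _ hs0.ne'] at this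
  have hfin : (Set.Ico t 1) ⊆ ⋃ σ ∈ D.edgesOf K, {s : ℝ | c + s • (y - c) ∈ D.plane σ} := by
    intro s hs
    obtain ⟨σ, hσ, h⟩ := D.exists_edge_of_mem_boundary (hray s hs)
    simp only [Set.mem_iUnion]
    exact ⟨σ, hσ, D.closure_edge_subset_plane σ h⟩
  refine (Set.Ico_infinite ht1) (Set.Finite.subset ?_ hfin)
  refine Set.Finite.biUnion (Finset.finite_toSet _) fun σ hσ => Set.Subsingleton.finite ?_
  obtain ⟨n, -, hn, -⟩ := D.exists_level_vector hσ
  intro s hs s' hs'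
  simp only [Set.mem_ofPred_eq, hn, c, add_sub_cancel_left, inner_smul_right] at hs hs'
  have hpos := D.dist_pos hσ
  have : inner ℝ n (y - D.center K) ≠ 0 := by
    intro h; rw [h, mul_zero] at hs; exact hpos.ne hs
  exact mul_right_cancel₀ this (hs.trans hs'.symm)

theorem notMem_cell_of_one_le {K : D.Cell} {y : Pt d} (hy : y ∉ D.cell K)
    {t : ℝ} (ht : 1 ≤ t) : D.center K + t • (y - D.center K) ∉ D.cell K := by
  intro h
  apply hy
  have := (D.starShaped K).add_smul_sub_mem h (t := t⁻¹) (by positivity) (inv_le_one_of_one_le₀ ht)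
  rwa [add_sub_cancel_left, smul_smul, inv_mul_cancel₀ (by positivity), one_smul,
    add_sub_cancel] at this

/-- A ray issued from the centre of a cell meets the boundary of the cell at most once. -/
theorem eq_one_of_mem_boundary {K : D.Cell} {y : Pt d}
    (hy : y ∈ closure (D.cell K) \ D.cell K) {t : ℝ} (ht : 0 < t)
    (h : D.center K + t • (y - D.center K) ∈ closure (D.cell K) \ D.cell K) : t = 1 := by
  rcases lt_trichotomy t 1 with h1 | h1 | h1
  · exact absurd (D.segment_mem_cell hy ht.le h1) h.2
  · exact h1
  · have := D.segment_mem_cell h (t := t⁻¹) (by positivity) (inv_lt_one_of_one_lt₀ h1)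
    rw [add_sub_cancel_left, smul_smul, inv_mul_cancel₀ ht.ne', one_smul, add_sub_cancel] at this
    exact absurd this hy.2

/-- Near a point of an edge, the cell coincides with a half-space. -/
theorem eventually_mem_cell_iff {K : D.Cell} {σ : D.Edge} (hσ : σ ∈ D.edgesOf K) {n : Pt d}
    (hn : ∀ y, y ∈ D.plane σ ↔ inner ℝ n (y - D.center K) = D.dist K σ) {y : Pt d}
    (hy : y ∈ D.edge σ) :
    ∀ᶠ z in 𝓝 y, z ∈ D.cell K ↔ inner ℝ n (z - D.center K) < D.dist K σ := by
  set c := D.center K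
  set δ := D.dist K σ
  have hδ : 0 < δ := D.dist_pos hσ
  obtain ⟨U, hU, hUe⟩ := D.edge_open σ
  have hlevy : level c n δ y = 1 := by
    rw [level, (hn y).1 (D.edge_subset_plane σ hy), div_self hδ.ne']
  have hfooty : foot c n δ y = y := by simp [foot, hlevy]
  have hlc := continuous_level c n δ
  have hcont : ContinuousAt (foot c n δ) y := by
    have : level c n δ y ≠ 0 := by rw [hlevy]; exact one_ne_zero
    unfold foot
    exact continuousAt_const.add ((hlc.continuousAt.inv₀ this).smul (by fun_prop))
  have hUy : U ∈ 𝓝 (foot c n δ y) := by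
    rw [hfooty]; exact hU.mem_nhds (by rw [hUe] at hy; exact hy.1)
  have hpos : ∀ᶠ z in 𝓝 y, 0 < level c n δ z :=
    hlc.continuousAt.eventually (lt_mem_nhds (by rw [hlevy]; exact one_pos))
  filter_upwards [hcont.eventually hUy, hpos] with z hz1 hz2
  -- As the edge is relatively open in its plane, points near `y` still project into the edge.
  -- Membership in the cell is then decided along the ray by whether the level is below `1`.
  have hfoot : foot c n δ z ∈ closure (D.cell K) \ D.cell K := by
    apply D.edge_subset_boundary hσ
    rw [hUe]
    refine ⟨hz1, ?_⟩
    have h := hz2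
    simp only [level] at h
    simp only [SetLike.mem_coe, hn, foot, level]
    rw [add_sub_cancel_left, inner_smul_right]
    have : inner ℝ n (z - c) ≠ 0 := by
      intro h0; rw [h0, zero_div] at h; exact h.false
    field_simp
  have hz := add_level_smul_foot hz2.ne'
  rw [← div_lt_one hδ, ← level]
  constructor
  · intro hzK
    by_contra hle
    rw [not_lt] at hle
    exact D.notMem_cell_of_one_le hfoot.2 hle (by rw [hz]; exact hzK)
  · intro hlt
    have := D.segment_mem_cell hfoot hz2.le hlt
    rwa [hz] at this

theorem isOutwardUnitNormal_of_level {K : D.Cell} {σ : D.Edge} (hσ : σ ∈ D.edgesOf K) {n : Pt d}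
    (hn1 : ‖n‖ = 1)
    (hn : ∀ y, y ∈ D.plane σ ↔ inner ℝ n (y - D.center K) = D.dist K σ)
    (hdir : ∀ w, w ∈ (D.plane σ).direction ↔ inner ℝ n w = 0) :
    D.IsOutwardUnitNormal K σ n := by
  refine ⟨hn1, fun w hw => (hdir w).1 hw, fun y hy => ?_⟩
  have hev := D.eventually_mem_cell_iff hσ hn hy
  have hyp := (hn y).1 (D.edge_subset_plane σ hy)
  have hnn : inner ℝ n n = (1 : ℝ) := by rw [real_inner_self_eq_norm_sq, hn1]; norm_num
  have h1 : Tendsto (fun t : ℝ => y - t • n) (𝓝[>] 0) (𝓝 y) := by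
    have : Tendsto (fun t : ℝ => y - t • n) (𝓝 0) (𝓝 (y - (0 : ℝ) • n)) :=
      Continuous.tendsto (by fun_prop) 0
    simp only [zero_smul, sub_zero] at this
    exact this.mono_left nhdsWithin_le_nhds
  have h2 : Tendsto (fun t : ℝ => y + t • n) (𝓝[>] 0) (𝓝 y) := by
    have : Tendsto (fun t : ℝ => y + t • n) (𝓝 0) (𝓝 (y + (0 : ℝ) • n)) :=
      Continuous.tendsto (by fun_prop) 0
    simp only [zero_smul, add_zero] at this
    exact this.mono_left nhdsWithin_le_nhds
  filter_upwards [h1.eventually hev, h2.eventually hev, self_mem_nhdsWithin] with t ht1 ht2 ht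
  rw [ht1, ht2, show y - t • n - D.center K = (y - D.center K) - t • n by abel,
    show y + t • n - D.center K = (y - D.center K) + t • n by abel, inner_sub_right,
    inner_add_right, inner_smul_right, hnn, hyp]
  have : (0 : ℝ) < t := ht
  constructor <;> linarith

theorem isOutwardUnitNormal_normal {K : D.Cell} {σ : D.Edge} (hσ : σ ∈ D.edgesOf K) :
    D.IsOutwardUnitNormal K σ (D.normal K σ) := by
  obtain ⟨n, h1, h2, h3⟩ := D.exists_level_vector hσ
  exact Classical.epsilon_spec (p := D.IsOutwardUnitNormal K σ)
    ⟨n, D.isOutwardUnitNormal_of_level hσ h1 h2 h3⟩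

/-- This identifies the vector picked by `Classical.epsilon` with the one pointing from the centre
to the plane. Two unit normals agree up to sign, and opposite signs would put the same point near
the edge both inside and outside the cell. -/
theorem normal_spec {K : D.Cell} {σ : D.Edge} (hσ : σ ∈ D.edgesOf K) :
    ‖D.normal K σ‖ = 1 ∧
      (∀ y, y ∈ D.plane σ ↔ inner ℝ (D.normal K σ) (y - D.center K) = D.dist K σ) ∧
      ∀ w, w ∈ (D.plane σ).direction ↔ inner ℝ (D.normal K σ) w = 0 := by
  obtain ⟨n, h1, h2, h3⟩ := D.exists_level_vector hσ
  have hn := D.isOutwardUnitNormal_of_level hσ h1 h2 h3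
  have hm := D.isOutwardUnitNormal_normal hσ
  have : D.normal K σ = n := by
    rcases eq_or_eq_neg_of_forall_inner h1 hm.1 (fun w hw => hm.2.1 w ((h3 w).2 hw)) with h | h
    · exact h
    · exfalso
      obtain ⟨y, hy⟩ := D.edge_nonempty σ
      obtain ⟨t, ht1, ht2⟩ := ((hn.2.2 y hy).and (hm.2.2 y hy)).exists
      rw [h] at ht2
      apply ht2.2
      rw [smul_neg, ← sub_eq_add_neg]
      exact ht1.1
  rw [this]
  exact ⟨h1, h2, h3⟩

theorem norm_normal {K : D.Cell} {σ : D.Edge} (hσ : σ ∈ D.edgesOf K) : ‖D.normal K σ‖ = 1 :=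
  (D.normal_spec hσ).1

theorem inner_normal_of_mem_edge {K : D.Cell} {σ : D.Edge} (hσ : σ ∈ D.edgesOf K) {y : Pt d}
    (hy : y ∈ D.edge σ) : inner ℝ (D.normal K σ) (y - D.center K) = D.dist K σ :=
  ((D.normal_spec hσ).2.1 y).1 (D.edge_subset_plane σ hy)

/-- The two cells sharing an edge have opposite outward normals. -/
theorem normal_eq_neg {K L : D.Cell} (hKL : K ≠ L) {σ : D.Edge} (hK : σ ∈ D.edgesOf K)
    (hL : σ ∈ D.edgesOf L) : D.normal L σ = -D.normal K σ := by
  have hm := D.isOutwardUnitNormal_normal hL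
  have hn := D.isOutwardUnitNormal_normal hK
  rcases eq_or_eq_neg_of_forall_inner (D.norm_normal hK) hm.1
    (fun w hw => hm.2.1 w (((D.normal_spec hK).2.2 w).2 hw)) with h | h
  · exfalso
    obtain ⟨y, hy⟩ := D.edge_nonempty σ
    obtain ⟨t, ht1, ht2⟩ := ((hn.2.2 y hy).and (hm.2.2 y hy)).exists
    rw [h] at ht2
    exact Set.disjoint_left.1 (D.cell_disjoint hKL) ht1.1 ht2.1
  · exact h

theorem cone_eq_coneOver (K : D.Cell) (σ : D.Edge) :
    D.cone K σ = coneOver (D.center K) (D.edge σ) := rfl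

theorem measurableSet_cone {K : D.Cell} {σ : D.Edge} (hσ : σ ∈ D.edgesOf K) :
    MeasurableSet (D.cone K σ) :=
  measurableSet_coneOver (D.dist_pos hσ) (fun _ hy => D.inner_normal_of_mem_edge hσ hy)
    (D.measurableSet_edge σ)

/-- Openness lets the hat function be replaced by an affine function on a neighbourhood, so that its
line derivatives on the cone can be computed. -/
theorem isOpen_cone {K : D.Cell} {σ : D.Edge} (hσ : σ ∈ D.edgesOf K) :
    IsOpen (D.cone K σ) := by
  set c := D.center K
  set δ := D.dist K σ
  set n := D.normal K σ
  have hδ : 0 < δ := D.dist_pos hσ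
  obtain ⟨U, hU, hUe⟩ := D.edge_open σ
  have hlc := continuous_level c n δ
  rw [isOpen_iff_mem_nhds]
  intro x hx
  rw [cone_eq_coneOver, mem_coneOver_iff hδ (fun _ hy => D.inner_normal_of_mem_edge hσ hy)] at hx
  have hcont : ContinuousAt (foot c n δ) x := by
    unfold foot
    exact continuousAt_const.add ((hlc.continuousAt.inv₀ hx.1.1.ne').smul (by fun_prop))
  have hUx : U ∈ 𝓝 (foot c n δ x) := hU.mem_nhds (by have := hx.2; rw [hUe] at this; exact this.1)
  filter_upwards [hcont.eventually hUx,
    hlc.continuousAt.eventually (isOpen_Ioo.mem_nhds hx.1)] with z hz1 hz2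
  rw [cone_eq_coneOver, mem_coneOver_iff hδ (fun _ hy => D.inner_normal_of_mem_edge hσ hy)]
  refine ⟨hz2, ?_⟩
  rw [hUe]
  refine ⟨hz1, ((D.normal_spec hσ).2.1 _).2 ?_⟩
  have h := hz2.1
  simp only [level] at h
  have : inner ℝ (D.normal K σ) (z - D.center K) ≠ 0 := by
    intro h0; simp only [n, c, h0, zero_div] at h; exact h.false
  simp only [foot, level, add_sub_cancel_left, inner_smul_right]
  field_simp
  rfl

theorem cone_subset_cell {K : D.Cell} {σ : D.Edge} (hσ : σ ∈ D.edgesOf K) :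
    D.cone K σ ⊆ D.cell K := by
  rintro x ⟨y, hy, t, ht, rfl⟩
  exact D.segment_mem_cell (D.edge_subset_boundary hσ hy) ht.1.le ht.2

/-- A ray from the centre meets the boundary of the cell only once, so a common point would have a
single foot lying in two disjoint edges. -/
theorem disjoint_cone {K : D.Cell} {σ τ : D.Edge} (hσ : σ ∈ D.edgesOf K) (hτ : τ ∈ D.edgesOf K)
    (h : σ ≠ τ) : Disjoint (D.cone K σ) (D.cone K τ) := by
  rw [Set.disjoint_left]
  rintro x ⟨y, hy, t, ht, rfl⟩ ⟨z, hz, s, hs, hzs⟩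
  have hzy : z = D.center K + (t / s) • (y - D.center K) := by
    have : t • (y - D.center K) = s • (z - D.center K) := add_left_cancel hzs
    rw [div_eq_inv_mul, mul_smul, this, smul_smul, inv_mul_cancel₀ hs.1.ne', one_smul,
      add_sub_cancel]
  have hb := D.edge_subset_boundary hτ hz
  rw [hzy] at hb
  have h1 := D.eq_one_of_mem_boundary (D.edge_subset_boundary hσ hy) (div_pos ht.1 hs.1) hb
  rw [h1, one_smul, add_sub_cancel] at hzy
  exact Set.disjoint_left.1 (D.edge_disjoint h) hy (hzy ▸ hz)

end Discretisation

/-! ### The gauge of a cell is Lipschitz. -/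

/-- A continuous function that coincides at each point with one of finitely many `L`-Lipschitz
functions is `L`-Lipschitz. -/
theorem lipschitzWith_of_continuous_selection {E ι : Type*} [NormedAddCommGroup E]
    [NormedSpace ℝ E] {f : E → ℝ} (hf : Continuous f) (s : Finset ι) {L : NNReal}
    {ℓ : ι → E → ℝ} (hℓ : ∀ i ∈ s, LipschitzWith L (ℓ i)) (h : ∀ x, ∃ i ∈ s, f x = ℓ i x) :
    LipschitzWith L f := by
  have key : ∀ x y : E, f y ≤ f x + L * ‖y - x‖ := by
    intro x y
    set p : ℝ → E := fun t => x + t • (y - x) with hp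
    have hpc : Continuous p := by fun_prop
    -- Along the segment from `x` to `y`, it is enough to find, to the right of each `t`, slopes at
    -- most `L ‖y - x‖` at points accumulating at `t`.
    have hbound := image_le_of_liminf_slope_right_le_deriv_boundary (a := 0) (b := 1)
      (f := fun t => f (p t)) (B := fun t => f x + L * ‖y - x‖ * t)
      (B' := fun _ => L * ‖y - x‖) (hf.comp hpc).continuousOn (by simp [hp])
      (by fun_prop) (fun t _ => by
        simpa using (((hasDerivAt_id t).const_mul (L * ‖y - x‖)).const_add
          (f x)).hasDerivWithinAt) (fun t _ r hr => ?_)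
    · simpa [hp] using hbound (Set.right_mem_Icc.2 zero_le_one)
    · have hex : ∃ᶠ z in 𝓝[>] t, ∃ i ∈ s, f (p z) = ℓ i (p z) :=
        (Eventually.of_forall fun z => h (p z)).frequently
      -- By finiteness one of the Lipschitz functions agrees with `f` at points accumulating at `t`
      -- from the right, and by continuity at `t` itself; the slopes of `f` at those points are
      -- slopes of that function.
      obtain ⟨i, hi, hfr⟩ : ∃ i ∈ s, ∃ᶠ z in 𝓝[>] t, f (p z) = ℓ i (p z) := by
        by_contra hcon
        push Not at hcon
        have : ∀ᶠ z in 𝓝[>] t, ∀ i ∈ s, ¬ f (p z) = ℓ i (p z) :=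
          (Filter.eventually_all_finset s).2 fun i hi => by simpa using hcon i hi
        obtain ⟨z, hz⟩ := this.exists
        obtain ⟨i, hi, hz'⟩ := h (p z)
        exact hz i hi hz'
      have hclosed : IsClosed {z | f (p z) = ℓ i (p z)} :=
        isClosed_eq (hf.comp hpc) ((hℓ i hi).continuous.comp hpc)
      have ht : f (p t) = ℓ i (p t) :=
        hclosed.mem_of_frequently_of_tendsto hfr (tendsto_id.mono_left nhdsWithin_le_nhds)
      refine (hfr.and_eventually self_mem_nhdsWithin).mono ?_
      rintro z ⟨hz, hzt⟩
      have hzt : 0 < z - t := sub_pos.2 hzt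
      refine lt_of_le_of_lt ?_ hr
      rw [slope_def_field, div_le_iff₀ hzt, hz, ht]
      have h1 := (hℓ i hi).dist_le_mul (p z) (p t)
      rw [Real.dist_eq, dist_eq_norm] at h1
      have h2 : p z - p t = (z - t) • (y - x) := by simp only [hp]; rw [sub_smul]; abel
      rw [h2, norm_smul, Real.norm_of_nonneg hzt.le] at h1
      calc _ ≤ |ℓ i (p z) - ℓ i (p t)| := le_abs_self _
        _ ≤ _ := h1
        _ = _ := by ring
  refine LipschitzWith.of_dist_le_mul fun x y => ?_
  rw [Real.dist_eq, abs_sub_le_iff, dist_eq_norm]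
  have h1 := key x y
  have h2 := key y x
  rw [norm_sub_rev] at h1
  constructor <;> linarith

namespace Discretisation

variable {d : ℕ} {Ω : Set (Pt d)} (D : Discretisation d Ω)

theorem isBounded_cell (hΩb : Bornology.IsBounded Ω) (K : D.Cell) :
    Bornology.IsBounded (D.cell K) := hΩb.subset (D.cell_subset K)

/-- The gauge of the cell `K` with respect to its centre. -/
def cellGauge (K : D.Cell) (x : Pt d) : ℝ :=
  gauge ((fun z => D.center K + z) ⁻¹' D.cell K) (x - D.center K)

theorem cellGauge_nonneg (K : D.Cell) (x : Pt d) : 0 ≤ D.cellGauge K x := gauge_nonneg _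

theorem cellGauge_center (K : D.Cell) : D.cellGauge K (D.center K) = 0 := by
  simp [cellGauge]

theorem isOpen_preimage_cell (K : D.Cell) : IsOpen ((fun z => D.center K + z) ⁻¹' D.cell K) :=
  (D.cell_isOpen K).preimage (by fun_prop)

theorem preimage_cell_mem_nhds (K : D.Cell) :
    (fun z => D.center K + z) ⁻¹' D.cell K ∈ 𝓝 (0 : Pt d) :=
  (D.isOpen_preimage_cell K).mem_nhds (by simpa using D.center_mem K)

theorem cellGauge_homothety (K : D.Cell) (x : Pt d) {t : ℝ} (ht : 0 ≤ t) :
    D.cellGauge K (D.center K + t • (x - D.center K)) = t * D.cellGauge K x := by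
  simp only [cellGauge, add_sub_cancel_left]
  rw [gauge_smul_of_nonneg ht, smul_eq_mul]

theorem cellGauge_lt_one_iff {K : D.Cell} {x : Pt d} : D.cellGauge K x < 1 ↔ x ∈ D.cell K := by
  constructor
  · intro h
    obtain ⟨r, hr0, hr1, z, hz, hzx⟩ :=
      exists_lt_of_gauge_lt (absorbent_nhds_zero (D.preimage_cell_mem_nhds K)) h
    have := (D.starShaped K).add_smul_sub_mem hz hr0.le hr1.le
    simp only [add_sub_cancel_left] at this
    simp only at hzx
    rwa [hzx, add_sub_cancel] at this
  · intro h
    exact gauge_lt_one_of_mem_of_isOpen (D.isOpen_preimage_cell K) (by simpa using h)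

theorem cellGauge_eq_one_of_mem_boundary {K : D.Cell} {y : Pt d}
    (hy : y ∈ closure (D.cell K) \ D.cell K) : D.cellGauge K y = 1 := by
  refine le_antisymm ?_ (not_lt.1 fun h => hy.2 (D.cellGauge_lt_one_iff.1 h))
  by_contra hlt
  rw [not_le] at hlt
  have hpos := one_pos.trans hlt
  have := D.segment_mem_cell hy (inv_nonneg.2 hpos.le) (inv_lt_one_of_one_lt₀ hlt)
  rw [← cellGauge_lt_one_iff, D.cellGauge_homothety K y (inv_nonneg.2 hpos.le),
    inv_mul_cancel₀ hpos.ne'] at this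
  exact this.false

theorem cellGauge_pos (hΩb : Bornology.IsBounded Ω) {K : D.Cell} {x : Pt d}
    (hx : x ≠ D.center K) : 0 < D.cellGauge K x := by
  have hb : Bornology.IsBounded ((fun z => D.center K + z) ⁻¹' D.cell K) := by
    have := (D.isBounded_cell hΩb K)
    obtain ⟨R, hR⟩ := this.subset_closedBall (D.center K)
    refine (Metric.isBounded_closedBall (x := (0 : Pt d)) (r := R)).subset fun z hz => ?_
    simpa [dist_eq_norm] using hR hz
  exact (gauge_pos (absorbent_nhds_zero (D.preimage_cell_mem_nhds K))
    (NormedSpace.isVonNBounded_iff ℝ |>.2 hb)).2 (sub_ne_zero.2 hx)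

theorem mem_boundary_of_cellGauge_eq_one {K : D.Cell} {y : Pt d} (hy : D.cellGauge K y = 1) :
    y ∈ closure (D.cell K) \ D.cell K := by
  refine ⟨?_, fun h => (D.cellGauge_lt_one_iff.2 h).ne hy⟩
  have h1 : Tendsto (fun t : ℝ => D.center K + t • (y - D.center K)) (𝓝[<] 1) (𝓝 y) := by
    have : Tendsto (fun t : ℝ => D.center K + t • (y - D.center K)) (𝓝 1)
        (𝓝 (D.center K + (1 : ℝ) • (y - D.center K))) := Continuous.tendsto (by fun_prop) 1
    rw [one_smul, add_sub_cancel] at this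
    exact this.mono_left nhdsWithin_le_nhds
  refine mem_closure_of_tendsto h1 ?_
  filter_upwards [Ioo_mem_nhdsLT (zero_lt_one (α := ℝ))] with t ht
  rw [← cellGauge_lt_one_iff, D.cellGauge_homothety K y ht.1.le, hy, mul_one]
  exact ht.2

theorem mem_boundary_of_ne_center (hΩb : Bornology.IsBounded Ω) {K : D.Cell} {x : Pt d}
    (hx : x ≠ D.center K) :
    D.center K + (D.cellGauge K x)⁻¹ • (x - D.center K) ∈ closure (D.cell K) \ D.cell K := by
  have hpos := D.cellGauge_pos hΩb hx
  apply D.mem_boundary_of_cellGauge_eq_one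
  rw [D.cellGauge_homothety K x (inv_nonneg.2 hpos.le), inv_mul_cancel₀ hpos.ne']

theorem cellGauge_le_one_iff {K : D.Cell} {x : Pt d} :
    D.cellGauge K x ≤ 1 ↔ x ∈ closure (D.cell K) := by
  constructor
  · intro h
    rcases h.lt_or_eq with h | h
    · exact subset_closure (D.cellGauge_lt_one_iff.1 h)
    · exact (D.mem_boundary_of_cellGauge_eq_one h).1
  · intro h
    by_cases hx : x ∈ D.cell K
    · exact (D.cellGauge_lt_one_iff.2 hx).le
    · exact (D.cellGauge_eq_one_of_mem_boundary ⟨h, hx⟩).le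

/-- The cell need not be convex, so the gauge need not be sublinear. Continuity comes from the sets
where it is below or above `a > 0`, which are homothetic to the cell and to the complement of its
closure. At `a = 0` boundedness of the cell is used: the gauge vanishes only at the centre. -/
theorem continuous_cellGauge (hΩb : Bornology.IsBounded Ω) (K : D.Cell) :
    Continuous (D.cellGauge K) := by
  have hscale : ∀ {a : ℝ} (_ : 0 < a) (x : Pt d),
      D.cellGauge K (D.center K + a⁻¹ • (x - D.center K)) = a⁻¹ * D.cellGauge K x :=
    fun ha x => D.cellGauge_homothety K x (inv_nonneg.2 ha.le)
  rw [OrderTopology.continuous_iff]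
  intro a
  rcases lt_trichotomy a 0 with ha | ha | ha
  · constructor
    · convert isOpen_univ
      exact Set.eq_univ_of_forall fun x => ha.trans_le (D.cellGauge_nonneg K x)
    · convert isOpen_empty
      exact Set.eq_empty_of_forall_notMem fun x hx =>
        (hx.trans ha).not_ge (D.cellGauge_nonneg K x)
  · subst ha
    constructor
    · convert isOpen_compl_singleton (x := D.center K)
      ext x
      simp only [Set.mem_preimage, Set.mem_Ioi, Set.mem_compl_iff, Set.mem_singleton_iff]
      exact ⟨fun h hx => by rw [hx, cellGauge_center] at h; exact h.false,
        fun h => D.cellGauge_pos hΩb h⟩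
    · convert isOpen_empty
      exact Set.eq_empty_of_forall_notMem fun x hx => (hx : _ < _).not_ge (D.cellGauge_nonneg K x)
  · have hcont : Continuous fun x => D.center K + a⁻¹ • (x - D.center K) := by fun_prop
    constructor
    · convert (isClosed_closure (s := D.cell K)).isOpen_compl.preimage hcont
      ext x
      simp only [Set.mem_preimage, Set.mem_Ioi, Set.mem_compl_iff, ← cellGauge_le_one_iff,
        hscale ha, not_le]
      rw [← div_eq_inv_mul, one_lt_div ha]
    · convert (D.cell_isOpen K).preimage hcont
      ext x
      simp only [Set.mem_preimage, Set.mem_Iio, ← cellGauge_lt_one_iff, hscale ha]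
      rw [← div_eq_inv_mul, div_lt_one ha]

/-- The radial projection to the boundary lies in the closure of some edge, where both functions
equal `1`; both are positively homogeneous about the centre. -/
theorem exists_cellGauge_eq_level (hd : 0 < d) (hΩb : Bornology.IsBounded Ω) (K : D.Cell)
    (x : Pt d) : ∃ σ ∈ D.edgesOf K,
      D.cellGauge K x = level (D.center K) (D.normal K σ) (D.dist K σ) x := by
  have : Nonempty (Fin d) := ⟨⟨0, hd⟩⟩
  have hne : ∀ x, x ≠ D.center K → ∃ σ ∈ D.edgesOf K,
      D.cellGauge K x = level (D.center K) (D.normal K σ) (D.dist K σ) x := by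
    intro x hx
    have hpos := D.cellGauge_pos hΩb hx
    obtain ⟨σ, hσ, hy⟩ := D.exists_edge_of_mem_boundary (D.mem_boundary_of_ne_center hΩb hx)
    refine ⟨σ, hσ, ?_⟩
    have h1 := ((D.normal_spec hσ).2.1 _).1 (D.closure_edge_subset_plane σ hy)
    rw [add_sub_cancel_left, inner_smul_right] at h1
    rw [level, eq_div_iff (D.dist_pos hσ).ne', ← h1]
    field_simp
  by_cases hx : x = D.center K
  -- At the centre both functions vanish, so any edge will do; that one exists is seen from any
  -- other point of the space, available because `0 < d`.
  · obtain ⟨z, hz⟩ := exists_ne (D.center K)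
    obtain ⟨σ, hσ, -⟩ := hne z hz
    exact ⟨σ, hσ, by rw [hx, cellGauge_center]; simp [level]⟩
  · exact hne x hx

/-- The gauge is a continuous selection among affine functions with Lipschitz constants `1 /
d_{K,σ}`; their sum serves as a common constant. -/
theorem exists_lipschitzWith_cellGauge (hd : 0 < d) (hΩb : Bornology.IsBounded Ω) (K : D.Cell) :
    ∃ L : NNReal, LipschitzWith L (D.cellGauge K) := by
  set L : NNReal := ∑ σ ∈ D.edgesOf K, Real.toNNReal (D.dist K σ)⁻¹ with hL
  refine ⟨L, lipschitzWith_of_continuous_selection (D.continuous_cellGauge hΩb K) (D.edgesOf K)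
    (ℓ := fun σ => level (D.center K) (D.normal K σ) (D.dist K σ)) (fun σ hσ => ?_)
    (D.exists_cellGauge_eq_level hd hΩb K)⟩
  have hδ := D.dist_pos hσ
  refine LipschitzWith.weaken (K := Real.toNNReal (D.dist K σ)⁻¹) ?_
    (Finset.single_le_sum (f := fun σ => Real.toNNReal (D.dist K σ)⁻¹)
      (fun _ _ => zero_le) hσ)
  refine LipschitzWith.of_dist_le_mul fun x y => ?_
  rw [Real.dist_eq, level, level, ← sub_div, ← inner_sub_right, sub_sub_sub_cancel_right, abs_div,
    abs_of_pos hδ, Real.coe_toNNReal _ (inv_nonneg.2 hδ.le), div_eq_inv_mul, dist_eq_norm]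
  gcongr
  have := abs_real_inner_le_norm (D.normal K σ) (x - y)
  rwa [D.norm_normal hσ, one_mul] at this

theorem cellGauge_of_mem_cone {K : D.Cell} {σ : D.Edge} (hσ : σ ∈ D.edgesOf K) {x : Pt d}
    (hx : x ∈ D.cone K σ) :
    D.cellGauge K x = level (D.center K) (D.normal K σ) (D.dist K σ) x := by
  obtain ⟨y, hy, t, ht, rfl⟩ := hx
  rw [level_homothety (D.dist_pos hσ) (D.inner_normal_of_mem_edge hσ hy),
    D.cellGauge_homothety K y ht.1.le,
    D.cellGauge_eq_one_of_mem_boundary (D.edge_subset_boundary hσ hy), mul_one]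

end Discretisation

/-! ### Measures, barycentres and the two geometric identities of a cell. -/

theorem hasDerivAt_add_mul_zero (a b : ℝ) : HasDerivAt (fun t : ℝ => a + t * b) b 0 := by
  simpa using ((hasDerivAt_id (0 : ℝ)).mul_const b).const_add a

theorem lineDeriv_fun_const {E : Type*} [AddCommGroup E] [Module ℝ E] (a : ℝ) (x v : E) :
    lineDeriv ℝ (fun _ : E => a) x v = 0 := by
  simp [lineDeriv]

namespace Discretisation

variable {d : ℕ} {Ω : Set (Pt d)} (D : Discretisation d Ω)

theorem volume_cone (hd : 0 < d) {K : D.Cell} {σ : D.Edge} (hσ : σ ∈ D.edgesOf K) :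
    volume (D.cone K σ) = ENNReal.ofReal (D.dist K σ / d) * μHE[d - 1] (D.edge σ) :=
  volume_coneOver hd (D.norm_normal hσ) (D.dist_pos hσ)
    (fun _ hy => D.inner_normal_of_mem_edge hσ hy) (D.measurableSet_edge σ)

theorem volume_cell_lt_top (hΩb : Bornology.IsBounded Ω) (K : D.Cell) :
    volume (D.cell K) < ⊤ := (D.isBounded_cell hΩb K).measure_lt_top

theorem volume_cone_lt_top (hΩb : Bornology.IsBounded Ω) {K : D.Cell} {σ : D.Edge}
    (hσ : σ ∈ D.edgesOf K) : volume (D.cone K σ) < ⊤ :=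
  (measure_mono (D.cone_subset_cell hσ)).trans_lt (D.volume_cell_lt_top hΩb K)

/-- An edge of infinite measure would be the basis of a cone of infinite volume inside a bounded
cell. -/
theorem edge_measure_ne_top (hd : 0 < d) (hΩb : Bornology.IsBounded Ω) {K : D.Cell} {σ : D.Edge}
    (hσ : σ ∈ D.edgesOf K) : μHE[d - 1] (D.edge σ) ≠ ⊤ := by
  intro h
  have h1 := D.volume_cone_lt_top hΩb hσ
  have hpos : 0 < D.dist K σ / d := div_pos (D.dist_pos hσ) (by exact_mod_cast hd)
  rw [D.volume_cone hd hσ, h, ENNReal.mul_top (by simpa using hpos)] at h1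
  exact h1.false

theorem edgeVol_pos (hd : 0 < d) (hΩb : Bornology.IsBounded Ω) {K : D.Cell} {σ : D.Edge}
    (hσ : σ ∈ D.edgesOf K) : 0 < D.edgeVol σ :=
  ENNReal.toReal_pos (D.edge_measure_pos σ).ne' (D.edge_measure_ne_top hd hΩb hσ)

theorem cellVol_pos (hΩb : Bornology.IsBounded Ω) (K : D.Cell) : 0 < D.cellVol K :=
  ENNReal.toReal_pos ((D.cell_isOpen K).measure_pos volume ⟨_, D.center_mem K⟩).ne'
    (D.volume_cell_lt_top hΩb K).ne

theorem volume_real_cone (hd : 0 < d) {K : D.Cell} {σ : D.Edge} (hσ : σ ∈ D.edgesOf K) :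
    volume.real (D.cone K σ) = D.edgeVol σ * D.dist K σ / d := by
  have hpos : 0 < D.dist K σ / d := div_pos (D.dist_pos hσ) (by exact_mod_cast hd)
  rw [measureReal_def, D.volume_cone hd hσ, ENNReal.toReal_mul, ENNReal.toReal_ofReal hpos.le,
    edgeVol, measureReal_def]
  ring

theorem norm_sub_center_le (hΩb : Bornology.IsBounded Ω) {K : D.Cell} {x : Pt d}
    (hx : x ∈ closure (D.cell K)) : ‖x - D.center K‖ ≤ D.cellDiam K := by
  rw [← dist_eq_norm, cellDiam, ← Metric.diam_closure]
  exact Metric.dist_le_diam_of_mem (D.isBounded_cell hΩb K).closure hx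
    (subset_closure (D.center_mem K))

theorem integrableOn_edge_id (hd : 0 < d) (hΩb : Bornology.IsBounded Ω) {K : D.Cell} {σ : D.Edge}
    (hσ : σ ∈ D.edgesOf K) : IntegrableOn (fun y : Pt d => y) (D.edge σ) (μHE[d - 1]) := by
  have hfin := (D.edge_measure_ne_top hd hΩb hσ).lt_top
  have : IsFiniteMeasure ((μHE[d - 1] : Measure (Pt d)).restrict (D.edge σ)) :=
    ⟨by rwa [Measure.restrict_apply_univ]⟩
  refine Integrable.of_bound (C := D.cellDiam K + ‖D.center K‖) (by fun_prop) ?_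
  filter_upwards [ae_restrict_mem (D.measurableSet_edge σ)] with y hy
  have h1 := D.norm_sub_center_le hΩb (D.edge_subset_boundary hσ hy).1
  calc ‖y‖ = ‖(y - D.center K) + D.center K‖ := by rw [sub_add_cancel]
    _ ≤ ‖y - D.center K‖ + ‖D.center K‖ := norm_add_le _ _
    _ ≤ _ := by gcongr

theorem setIntegral_edge_sub (hd : 0 < d) (hΩb : Bornology.IsBounded Ω) {K : D.Cell} {σ : D.Edge}
    (hσ : σ ∈ D.edgesOf K) (c : Pt d) :
    ∫ y in D.edge σ, (y - c) ∂(μHE[d - 1]) = D.edgeVol σ • (D.bary σ - c) := by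
  have hfin := (D.edge_measure_ne_top hd hΩb hσ).lt_top
  have : IsFiniteMeasure ((μHE[d - 1] : Measure (Pt d)).restrict (D.edge σ)) :=
    ⟨by rwa [Measure.restrict_apply_univ]⟩
  rw [integral_sub (D.integrableOn_edge_id hd hΩb hσ) (integrable_const c), integral_const,
    bary, setAverage_eq, smul_sub, measureReal_restrict_apply_univ, ← edgeVol, smul_smul,
    mul_inv_cancel₀ (D.edgeVol_pos hd hΩb hσ).ne', one_smul]

theorem setIntegral_cone_sub (hd : 0 < d) (hΩb : Bornology.IsBounded Ω) {K : D.Cell} {σ : D.Edge}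
    (hσ : σ ∈ D.edgesOf K) :
    ∫ x in D.cone K σ, (x - D.center K) =
      (D.edgeVol σ * D.dist K σ / (d + 1)) • (D.bary σ - D.center K) := by
  rw [cone_eq_coneOver, setIntegral_coneOver_sub hd (D.norm_normal hσ) (D.dist_pos hσ)
    (fun _ hy => D.inner_normal_of_mem_edge hσ hy) (D.measurableSet_edge σ)
    (D.edge_measure_ne_top hd hΩb hσ), D.setIntegral_edge_sub hd hΩb hσ, smul_smul]
  congr 1; ring

/-- The barycentre of a non-convex edge may lie off the edge, so the bound is obtained by averaging
over the edge, not by membership; `inner_normal_bary` proceeds in the same way. -/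
theorem norm_bary_sub_center_le (hd : 0 < d) (hΩb : Bornology.IsBounded Ω) {K : D.Cell}
    {σ : D.Edge} (hσ : σ ∈ D.edgesOf K) : ‖D.bary σ - D.center K‖ ≤ D.cellDiam K := by
  have hm := D.edgeVol_pos hd hΩb hσ
  have h := D.setIntegral_edge_sub hd hΩb hσ (D.center K)
  have h1 : ‖∫ y in D.edge σ, (y - D.center K) ∂(μHE[d - 1])‖ ≤ D.cellDiam K * D.edgeVol σ :=
    norm_setIntegral_le_of_norm_le_const (D.edge_measure_ne_top hd hΩb hσ).lt_top
      fun y hy => D.norm_sub_center_le hΩb (D.edge_subset_boundary hσ hy).1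
  rw [h, norm_smul, Real.norm_of_nonneg hm.le, mul_comm] at h1
  exact le_of_mul_le_mul_right h1 hm

theorem inner_normal_bary (hd : 0 < d) (hΩb : Bornology.IsBounded Ω) {K : D.Cell}
    {σ : D.Edge} (hσ : σ ∈ D.edgesOf K) :
    inner ℝ (D.normal K σ) (D.bary σ - D.center K) = D.dist K σ := by
  have hm := D.edgeVol_pos hd hΩb hσ
  have hfin := (D.edge_measure_ne_top hd hΩb hσ).lt_top
  have : IsFiniteMeasure ((μHE[d - 1] : Measure (Pt d)).restrict (D.edge σ)) :=
    ⟨by rwa [Measure.restrict_apply_univ]⟩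
  have h := D.setIntegral_edge_sub hd hΩb hσ (D.center K)
  have h1 := integral_inner (𝕜 := ℝ) ((D.integrableOn_edge_id hd hΩb hσ).sub
    (integrable_const (D.center K))) (D.normal K σ)
  simp only [Pi.sub_apply] at h1
  rw [h, setIntegral_congr_fun (D.measurableSet_edge σ)
    (fun y hy => D.inner_normal_of_mem_edge hσ hy), setIntegral_const, inner_smul_right,
    ← edgeVol, smul_eq_mul] at h1
  exact (mul_left_cancel₀ hm.ne' h1).symm

theorem volume_plane (σ : D.Edge) {K : D.Cell} (hσ : σ ∈ D.edgesOf K) :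
    volume (D.plane σ : Set (Pt d)) = 0 := by
  refine Measure.addHaar_affineSubspace _ _ fun h => ?_
  have h1 : D.center K ∈ D.plane σ := by rw [h]; trivial
  rw [(D.normal_spec hσ).2.1] at h1
  simp only [sub_self, inner_zero_right] at h1
  exact (D.dist_pos hσ).ne h1

theorem volume_boundary (K : D.Cell) : volume (closure (D.cell K) \ D.cell K) = 0 := by
  rw [D.boundary_eq K]
  refine (measure_biUnion_null_iff (Finset.countable_toSet _)).2 fun σ hσ => ?_
  exact measure_mono_null (D.closure_edge_subset_plane σ) (D.volume_plane σ hσ)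

/-- Apart from the centre, a point of the cell in no cone projects radially to the relative boundary
of an edge. That boundary is null for the `(d-1)`-dimensional measure, so the cone over it has zero
volume. -/
theorem volume_cell_diff_cones (hd : 0 < d) (hΩb : Bornology.IsBounded Ω) (K : D.Cell) :
    volume (D.cell K \ ⋃ σ ∈ D.edgesOf K, D.cone K σ) = 0 := by
  have : Nonempty (Fin d) := ⟨⟨0, hd⟩⟩
  have hsub : D.cell K \ ⋃ σ ∈ D.edgesOf K, D.cone K σ ⊆ {D.center K} ∪
      ⋃ σ ∈ D.edgesOf K, coneOver (D.center K) (closure (D.edge σ) \ D.edge σ) := by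
    rintro x ⟨hxK, hx⟩
    by_cases hxc : x = D.center K
    · exact Or.inl hxc
    right
    have hpos := D.cellGauge_pos hΩb hxc
    have hlt := D.cellGauge_lt_one_iff.2 hxK
    obtain ⟨σ, hσ, hy⟩ := D.exists_edge_of_mem_boundary (D.mem_boundary_of_ne_center hΩb hxc)
    have hxy : x = D.center K + D.cellGauge K x •
        (D.center K + (D.cellGauge K x)⁻¹ • (x - D.center K) - D.center K) := by
      rw [add_sub_cancel_left, smul_smul, mul_inv_cancel₀ hpos.ne', one_smul, add_sub_cancel]
    simp only [Set.mem_iUnion] at hx ⊢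
    refine ⟨σ, hσ, _, ⟨hy, fun hy' => hx ⟨σ, hσ, _, hy', _, ⟨hpos, hlt⟩, hxy⟩⟩, _,
      ⟨hpos, hlt⟩, hxy⟩
  refine measure_mono_null hsub (measure_union_null (measure_singleton _) ?_)
  refine (measure_biUnion_null_iff (Finset.countable_toSet _)).2 fun σ hσ => ?_
  rw [volume_coneOver hd (D.norm_normal hσ) (D.dist_pos hσ)
    (fun y hy => ((D.normal_spec hσ).2.1 y).1 (D.closure_edge_subset_plane σ hy.1))
    (isClosed_closure.measurableSet.diff (D.measurableSet_edge σ)), D.edge_boundary_null, mul_zero]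

theorem cell_ae_eq_cones (hd : 0 < d) (hΩb : Bornology.IsBounded Ω) (K : D.Cell) :
    (⋃ σ ∈ D.edgesOf K, D.cone K σ : Set (Pt d)) =ᵐ[volume] D.cell K := by
  refine Filter.EventuallyLE.antisymm ?_ ?_
  · have : (⋃ σ ∈ D.edgesOf K, D.cone K σ) ⊆ D.cell K :=
      Set.iUnion₂_subset fun σ hσ => D.cone_subset_cell hσ
    exact this.eventuallyLE
  · exact ae_le_set.2 (D.volume_cell_diff_cones hd hΩb K)

theorem setIntegral_cell_eq_sum {E : Type*} [NormedAddCommGroup E] [NormedSpace ℝ E]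
    (hd : 0 < d) (hΩb : Bornology.IsBounded Ω)
    (K : D.Cell) {f : Pt d → E} (hf : ∀ σ ∈ D.edgesOf K, IntegrableOn f (D.cone K σ)) :
    ∫ x in D.cell K, f x = ∑ σ ∈ D.edgesOf K, ∫ x in D.cone K σ, f x := by
  rw [← setIntegral_congr_set (D.cell_ae_eq_cones hd hΩb K),
    integral_biUnion_finset _ (fun σ hσ => D.measurableSet_cone hσ)
      (fun σ hσ τ hτ h => D.disjoint_cone hσ hτ h) hf]

theorem iUnion_cell_ae_eq : (⋃ K, D.cell K : Set (Pt d)) =ᵐ[volume] Ω := by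
  refine Filter.EventuallyLE.antisymm ?_ ?_
  · exact (Set.iUnion_subset fun K => D.cell_subset K).eventuallyLE
  · refine ae_le_set.2 (measure_mono_null (t := ⋃ K, closure (D.cell K) \ D.cell K) ?_
      (measure_iUnion_null fun K => D.volume_boundary K))
    rintro x ⟨hx, hxK⟩
    have := subset_closure hx
    rw [D.closure_eq] at this
    simp only [Set.mem_iUnion, not_exists] at this hxK ⊢
    obtain ⟨K, hK⟩ := this
    exact ⟨K, hK, hxK K⟩

theorem cellVol_eq_sum (hd : 0 < d) (hΩb : Bornology.IsBounded Ω) (K : D.Cell) :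
    D.cellVol K = ∑ σ ∈ D.edgesOf K, D.edgeVol σ * D.dist K σ / d := by
  have h := D.setIntegral_cell_eq_sum hd hΩb K (f := fun _ => (1 : ℝ))
    (fun σ hσ => integrableOn_const (D.volume_cone_lt_top hΩb hσ).ne)
  simp only [setIntegral_const, smul_eq_mul, mul_one] at h
  rw [cellVol, h]
  exact Finset.sum_congr rfl fun σ hσ => D.volume_real_cone hd hσ

theorem sum_edgeVol_mul_dist (hd : 0 < d) (hΩb : Bornology.IsBounded Ω) (K : D.Cell) :
    ∑ σ ∈ D.edgesOf K, D.edgeVol σ * D.dist K σ = d * D.cellVol K := by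
  have : (d : ℝ) ≠ 0 := by exact_mod_cast hd.ne'
  rw [D.cellVol_eq_sum hd hΩb, ← Finset.sum_div]
  field_simp

/-- The hat function of a cell: positive in the cell, zero outside. -/
def hat (K : D.Cell) (x : Pt d) : ℝ := max (1 - D.cellGauge K x) 0

theorem hat_eq_zero {K : D.Cell} {x : Pt d} (hx : x ∉ D.cell K) : D.hat K x = 0 := by
  rw [← cellGauge_lt_one_iff, not_lt] at hx
  exact max_eq_right (by linarith)

theorem exists_lipschitzWith_hat (hd : 0 < d) (hΩb : Bornology.IsBounded Ω) (K : D.Cell) :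
    ∃ L : NNReal, LipschitzWith L (D.hat K) := by
  obtain ⟨L, hL⟩ := D.exists_lipschitzWith_cellGauge hd hΩb K
  exact ⟨_, ((LipschitzWith.const (1 : ℝ)).sub hL).max_const 0⟩

theorem hasCompactSupport_hat (hΩb : Bornology.IsBounded Ω) (K : D.Cell) :
    HasCompactSupport (D.hat K) :=
  HasCompactSupport.intro (D.isBounded_cell hΩb K).isCompact_closure
    fun _ hx => D.hat_eq_zero fun h => hx (subset_closure h)

theorem hat_of_mem_cone {K : D.Cell} {σ : D.Edge} (hσ : σ ∈ D.edgesOf K) {x : Pt d}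
    (hx : x ∈ D.cone K σ) :
    D.hat K x = 1 - level (D.center K) (D.normal K σ) (D.dist K σ) x := by
  have h1 := D.cellGauge_lt_one_iff.2 (D.cone_subset_cell hσ hx)
  rw [hat, max_eq_left (by linarith), D.cellGauge_of_mem_cone hσ hx]

theorem lineDeriv_hat_of_mem_cone {K : D.Cell} {σ : D.Edge} (hσ : σ ∈ D.edgesOf K) {x : Pt d}
    (hx : x ∈ D.cone K σ) (e : Pt d) :
    lineDeriv ℝ (D.hat K) x (-e) = inner ℝ (D.normal K σ) e / D.dist K σ := by
  have hev : D.hat K =ᶠ[𝓝 x]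
      fun x => 1 - level (D.center K) (D.normal K σ) (D.dist K σ) x := by
    filter_upwards [(D.isOpen_cone hσ).mem_nhds hx] with z hz using D.hat_of_mem_cone hσ hz
  rw [hev.lineDeriv_eq]
  refine HasLineDerivAt.lineDeriv ?_
  unfold HasLineDerivAt
  have : (fun t : ℝ => 1 - level (D.center K) (D.normal K σ) (D.dist K σ) (x + t • -e)) =
      fun t => (1 - level (D.center K) (D.normal K σ) (D.dist K σ) x) +
        t * (inner ℝ (D.normal K σ) e / D.dist K σ) := by
    funext t
    simp only [level]
    rw [show x + t • -e - D.center K = (x - D.center K) - t • e by rw [smul_neg]; abel,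
      inner_sub_right, inner_smul_right]
    ring
  rw [this]
  exact hasDerivAt_add_mul_zero _ _

theorem lineDeriv_hat_of_notMem_closure {K : D.Cell} {x : Pt d}
    (hx : x ∉ closure (D.cell K)) (v : Pt d) : lineDeriv ℝ (D.hat K) x v = 0 := by
  have hev : D.hat K =ᶠ[𝓝 x] fun _ => 0 := by
    filter_upwards [isClosed_closure.isOpen_compl.mem_nhds hx] with z hz
    exact D.hat_eq_zero fun h => hz (subset_closure h)
  rw [hev.lineDeriv_eq, lineDeriv_fun_const]

theorem integrableOn_cone_of_continuous {E : Type*} [NormedAddCommGroup E]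
    (hΩb : Bornology.IsBounded Ω) {K : D.Cell} {σ : D.Edge}
    (hσ : σ ∈ D.edgesOf K) {f : Pt d → E} (hf : Continuous f) : IntegrableOn f (D.cone K σ) :=
  (hf.continuousOn.integrableOn_compact (D.isBounded_cell hΩb K).isCompact_closure).mono_set
    ((D.cone_subset_cell hσ).trans subset_closure)

/-- Integration by parts against the hat function of a cell. -/
theorem integral_lineDeriv_mul_hat (hd : 0 < d) (hΩb : Bornology.IsBounded Ω) (K : D.Cell)
    {f : Pt d → ℝ} {C : NNReal} (hf : LipschitzWith C f) (e : Pt d) :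
    ∫ x, lineDeriv ℝ f x e * D.hat K x =
      ∑ σ ∈ D.edgesOf K, inner ℝ (D.normal K σ) e / D.dist K σ * ∫ x in D.cone K σ, f x := by
  obtain ⟨L, hL⟩ := D.exists_lipschitzWith_hat hd hΩb K
  -- Both functions are Lipschitz and the hat function has compact support, so the derivative moves
  -- onto the latter, where it is constant on each cone and zero off the closed cell; no boundary
  -- term appears.
  rw [hf.integral_lineDeriv_mul_eq hL (D.hasCompactSupport_hat hΩb K)]
  have hint : ∀ σ ∈ D.edgesOf K, ∀ x ∈ D.cone K σ, lineDeriv ℝ (D.hat K) x (-e) * f x =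
      inner ℝ (D.normal K σ) e / D.dist K σ * f x :=
    fun σ hσ x hx => by rw [D.lineDeriv_hat_of_mem_cone hσ hx]
  have hae : (fun x => lineDeriv ℝ (D.hat K) x (-e) * f x) =ᵐ[volume]
      (D.cell K).indicator fun x => lineDeriv ℝ (D.hat K) x (-e) * f x := by
    filter_upwards [measure_eq_zero_iff_ae_notMem.1 (D.volume_boundary K)] with x hx
    by_cases hxK : x ∈ D.cell K
    · rw [Set.indicator_of_mem hxK]
    · rw [Set.indicator_of_notMem hxK, D.lineDeriv_hat_of_notMem_closure (fun h => hx ⟨h, hxK⟩),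
        zero_mul]
  rw [integral_congr_ae hae, integral_indicator (D.cell_isOpen K).measurableSet,
    D.setIntegral_cell_eq_sum hd hΩb K fun σ hσ => ?_]
  · refine Finset.sum_congr rfl fun σ hσ => ?_
    rw [setIntegral_congr_fun (D.measurableSet_cone hσ) (hint σ hσ), integral_const_mul]
  · refine IntegrableOn.congr_fun ?_ (fun x hx => (hint σ hσ x hx).symm) (D.measurableSet_cone hσ)
    exact (D.integrableOn_cone_of_continuous hΩb hσ hf.continuous).const_mul _

/-- The outward normals of a cell, weighted by the areas of the edges, sum up to zero. -/
theorem sum_edgeVol_smul_normal (hd : 0 < d) (hΩb : Bornology.IsBounded Ω) (K : D.Cell) :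
    ∑ σ ∈ D.edgesOf K, D.edgeVol σ • D.normal K σ = 0 := by
  have hd' : (d : ℝ) ≠ 0 := by exact_mod_cast hd.ne'
  refine ext_inner_right ℝ fun e => ?_
  rw [inner_zero_left, sum_inner]
  -- For the test function `1` the left side vanishes, and the cone volume `|σ| d_{K,σ} / d` cancels
  -- the slope `1 / d_{K,σ}`.
  have h := D.integral_lineDeriv_mul_hat hd hΩb K (LipschitzWith.const (1 : ℝ)) e
  simp only [lineDeriv_fun_const, zero_mul, integral_zero, setIntegral_const, smul_eq_mul,
    mul_one] at h
  have h2 : (∑ σ ∈ D.edgesOf K, inner ℝ (D.edgeVol σ • D.normal K σ) e) / d = 0 := by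
    rw [h, Finset.sum_div]
    refine Finset.sum_congr rfl fun σ hσ => ?_
    rw [D.volume_real_cone hd hσ, inner_smul_left]
    have := (D.dist_pos hσ).ne'
    simp only [conj_trivial]
    field_simp
  exact (div_eq_zero_iff.1 h2).resolve_right hd'

/-- The level has mean `d / (d + 1)` on each cone, by the first moment of the cone and because the
barycentre has level `1`. -/
theorem integral_hat (hd : 0 < d) (hΩb : Bornology.IsBounded Ω) (K : D.Cell) :
    ∫ x, D.hat K x = D.cellVol K / (d + 1) := by
  have hd' : (d : ℝ) ≠ 0 := by exact_mod_cast hd.ne'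
  have hd1 : (d : ℝ) + 1 ≠ 0 := by positivity
  obtain ⟨L, hL⟩ := D.exists_lipschitzWith_hat hd hΩb K
  have : ∫ x, D.hat K x = ∫ x in D.cell K, D.hat K x := by
    rw [← integral_indicator (D.cell_isOpen K).measurableSet]
    congr 1
    funext x
    by_cases hx : x ∈ D.cell K
    · rw [Set.indicator_of_mem hx]
    · rw [Set.indicator_of_notMem hx, D.hat_eq_zero hx]
  rw [this, D.setIntegral_cell_eq_sum hd hΩb K
    fun σ hσ => D.integrableOn_cone_of_continuous hΩb hσ hL.continuous, D.cellVol_eq_sum hd hΩb,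
    Finset.sum_div]
  refine Finset.sum_congr rfl fun σ hσ => ?_
  have hδ := (D.dist_pos hσ).ne'
  have hone : Integrable (fun _ : Pt d => (1 : ℝ)) (volume.restrict (D.cone K σ)) :=
    integrableOn_const (D.volume_cone_lt_top hΩb hσ).ne
  rw [setIntegral_congr_fun (D.measurableSet_cone hσ) fun x hx => D.hat_of_mem_cone hσ hx,
    integral_sub hone
      (D.integrableOn_cone_of_continuous hΩb hσ (continuous_level _ _ _))]
  simp only [level]
  rw [integral_div, integral_inner (D.integrableOn_cone_of_continuous hΩb hσ (by fun_prop)),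
    D.setIntegral_cone_sub hd hΩb hσ, inner_smul_right, D.inner_normal_bary hd hΩb hσ,
    setIntegral_const, D.volume_real_cone hd hσ]
  simp only [smul_eq_mul]
  field_simp
  ring

/-- The normals and the barycentres of the edges of a cell form a discrete resolution of the
identity. -/
theorem sum_inner_bary_smul_normal (hd : 0 < d) (hΩb : Bornology.IsBounded Ω) (K : D.Cell)
    (a : Pt d) :
    ∑ σ ∈ D.edgesOf K, (D.edgeVol σ * inner ℝ a (D.bary σ - D.center K)) • D.normal K σ =
      D.cellVol K • a := by
  have hd1 : (d : ℝ) + 1 ≠ 0 := by positivity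
  refine ext_inner_right ℝ fun e => ?_
  have hlip : LipschitzWith ‖a‖₊ fun x : Pt d => inner ℝ a (x - D.center K) := by
    refine LipschitzWith.of_dist_le_mul fun x y => ?_
    rw [Real.dist_eq, ← inner_sub_right, sub_sub_sub_cancel_right, dist_eq_norm]
    exact abs_real_inner_le_norm _ _
  have hline : ∀ x, lineDeriv ℝ (fun x : Pt d => inner ℝ a (x - D.center K)) x e =
      inner ℝ a e := by
    intro x
    refine HasLineDerivAt.lineDeriv ?_
    unfold HasLineDerivAt
    have : (fun t : ℝ => inner ℝ a (x + t • e - D.center K)) =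
        fun t => inner ℝ a (x - D.center K) + t * inner ℝ a e := by
      funext t
      rw [add_sub_right_comm, inner_add_right, inner_smul_right]
    rw [this]
    exact hasDerivAt_add_mul_zero _ _
  -- For an affine test function the hat function on the left and the first moments of the cones on
  -- the right carry the same factor `1 / (d + 1)`.
  have h := D.integral_lineDeriv_mul_hat hd hΩb K hlip e
  simp only [hline] at h
  rw [integral_const_mul, D.integral_hat hd hΩb] at h
  rw [sum_inner, inner_smul_left]
  simp only [conj_trivial]
  have h2 : D.cellVol K * inner ℝ a e = (d + 1) * (inner ℝ a e * (D.cellVol K / (d + 1))) := by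
    field_simp
  rw [h2, h, Finset.mul_sum]
  refine Finset.sum_congr rfl fun σ hσ => ?_
  have hδ := (D.dist_pos hσ).ne'
  rw [integral_inner (D.integrableOn_cone_of_continuous hΩb hσ (by fun_prop)),
    D.setIntegral_cone_sub hd hΩb hσ, inner_smul_right, inner_smul_left]
  simp only [conj_trivial]
  field_simp

end Discretisation

/-! ### Bounds on a symmetric matrix from its spectrum. -/

section SymmetricMatrix

variable {d : ℕ} {M : Matrix (Fin d) (Fin d) ℝ} {lo hi : ℝ}

theorem isHermitian_of_isSymm (hM : M.IsSymm) : M.IsHermitian := by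
  rw [Matrix.IsHermitian, Matrix.conjTranspose_eq_transpose_of_trivial]
  exact hM

theorem inner_toEuclideanLin_comm (hM : M.IsSymm) (a b : Pt d) :
    inner ℝ (Matrix.toEuclideanLin M a) b = inner ℝ a (Matrix.toEuclideanLin M b) :=
  Matrix.isSymmetric_toEuclideanLin_iff.2 (isHermitian_of_isSymm hM) a b

theorem exists_eigenbasis (hM : M.IsSymm) (hs : spectrum ℝ M ⊆ Set.Icc lo hi) :
    ∃ (b : OrthonormalBasis (Fin d) ℝ (Pt d)) (l : Fin d → ℝ), (∀ j, l j ∈ Set.Icc lo hi) ∧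
      ∀ j v, inner ℝ (b j) (Matrix.toEuclideanLin M v) = l j * inner ℝ (b j) v := by
  have hH := isHermitian_of_isSymm hM
  refine ⟨hH.eigenvectorBasis, hH.eigenvalues, fun j => hs (hH.eigenvalues_mem_spectrum_real j),
    fun j v => ?_⟩
  rw [← inner_toEuclideanLin_comm hM]
  have : Matrix.toEuclideanLin M (hH.eigenvectorBasis j) =
      hH.eigenvalues j • hH.eigenvectorBasis j := by
    rw [Matrix.toLpLin_apply, hH.mulVec_eigenvectorBasis]
    rfl
  rw [this, inner_smul_left]
  rfl

theorem norm_toEuclideanLin_le (hlo : 0 ≤ lo) (hlohi : lo ≤ hi) (hM : M.IsSymm)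
    (hs : spectrum ℝ M ⊆ Set.Icc lo hi) (v : Pt d) :
    ‖Matrix.toEuclideanLin M v‖ ≤ hi * ‖v‖ := by
  obtain ⟨b, l, hl, hb⟩ := exists_eigenbasis hM hs
  have hhi : 0 ≤ hi := hlo.trans hlohi
  refine le_of_sq_le_sq ?_ (by positivity)
  rw [mul_pow, ← b.sum_sq_norm_inner_right, ← b.sum_sq_norm_inner_right v, Finset.mul_sum]
  refine Finset.sum_le_sum fun j _ => ?_
  rw [hb, norm_mul, mul_pow, Real.norm_of_nonneg (hlo.trans (hl j).1)]
  gcongr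
  · exact hlo.trans (hl j).1
  · exact (hl j).2

theorem mul_norm_sq_le_inner_toEuclideanLin (hM : M.IsSymm)
    (hs : spectrum ℝ M ⊆ Set.Icc lo hi) (v : Pt d) :
    lo * ‖v‖ ^ 2 ≤ inner ℝ v (Matrix.toEuclideanLin M v) := by
  obtain ⟨b, l, hl, hb⟩ := exists_eigenbasis hM hs
  rw [← b.sum_sq_norm_inner_right v, ← b.sum_inner_mul_inner, Finset.mul_sum]
  refine Finset.sum_le_sum fun j _ => ?_
  rw [hb, real_inner_comm, Real.norm_eq_abs, sq_abs]
  nlinarith [(hl j).1, sq_nonneg (inner ℝ (b j) v)]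

end SymmetricMatrix

/-! ### Almost everywhere bounds and integrability of the diffusion field. -/

section DiffusionField

variable {d : ℕ} {Ω : Set (Pt d)} {lo hi : ℝ} {Λ : Pt d → Matrix (Fin d) (Fin d) ℝ}

theorem IsDiffusionField.ae_symm (hΛ : IsDiffusionField Ω lo hi Λ) :
    ∀ᵐ x ∂(volume.restrict Ω), ∀ a b : Pt d,
      inner ℝ (Matrix.toEuclideanLin (Λ x) a) b = inner ℝ a (Matrix.toEuclideanLin (Λ x) b) := by
  filter_upwards [hΛ.2] with x hx a b using inner_toEuclideanLin_comm hx.1 a b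

theorem IsDiffusionField.ae_norm_le (hΛ : IsDiffusionField Ω lo hi Λ) (hlo : 0 ≤ lo)
    (hlohi : lo ≤ hi) :
    ∀ᵐ x ∂(volume.restrict Ω), ∀ a : Pt d, ‖Matrix.toEuclideanLin (Λ x) a‖ ≤ hi * ‖a‖ := by
  filter_upwards [hΛ.2] with x hx a using norm_toEuclideanLin_le hlo hlohi hx.1 hx.2 a

theorem IsDiffusionField.ae_coercive (hΛ : IsDiffusionField Ω lo hi Λ) :
    ∀ᵐ x ∂(volume.restrict Ω), ∀ a : Pt d,
      lo * ‖a‖ ^ 2 ≤ inner ℝ a (Matrix.toEuclideanLin (Λ x) a) := by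
  filter_upwards [hΛ.2] with x hx a using mul_norm_sq_le_inner_toEuclideanLin hx.1 hx.2 a

theorem inner_toEuclideanLin_eq_sum (M : Matrix (Fin d) (Fin d) ℝ) (a b : Pt d) :
    inner ℝ a (Matrix.toEuclideanLin M b) = ∑ i, ∑ j, a i * (M i j * b j) := by
  rw [PiLp.inner_apply]
  refine Finset.sum_congr rfl fun i _ => ?_
  rw [Matrix.toLpLin_apply]
  simp only [Matrix.mulVec, dotProduct, RCLike.inner_apply, conj_trivial]
  rw [mul_comm, Finset.mul_sum]

theorem IsDiffusionField.aestronglyMeasurable_apply (hΛ : IsDiffusionField Ω lo hi Λ)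
    (hΩ : MeasurableSet Ω) {g : Pt d → Pt d}
    (hg : AEStronglyMeasurable g (volume.restrict Ω)) :
    AEStronglyMeasurable (fun x => Matrix.toEuclideanLin (Λ x) (g x)) (volume.restrict Ω) := by
  have hij : ∀ i j, AEMeasurable (fun x => Λ x i j) (volume.restrict Ω) :=
    fun i j => aemeasurable_restrict_of_measurable_subtype hΩ (hΛ.1 i j)
  have hgj : ∀ j, AEMeasurable (fun x => g x j) (volume.restrict Ω) := fun j =>
    (EuclideanSpace.proj (𝕜 := ℝ) j).continuous.measurable.comp_aemeasurable hg.aemeasurable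
  have h : AEMeasurable (fun x i => ∑ j, Λ x i j * g x j) (volume.restrict Ω) :=
    aemeasurable_pi_lambda _ fun i => Finset.aemeasurable_fun_sum _ fun j _ =>
      (hij i j).mul (hgj j)
  have h2 := (PiLp.continuous_toLp 2 (fun _ : Fin d => ℝ)).measurable.comp_aemeasurable h
  exact h2.aestronglyMeasurable

theorem IsDiffusionField.integrableOn_entry (hΛ : IsDiffusionField Ω lo hi Λ) (hlo : 0 ≤ lo)
    (hlohi : lo ≤ hi) (hΩ : MeasurableSet Ω) (hΩb : Bornology.IsBounded Ω) (i j : Fin d) :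
    IntegrableOn (fun x => Λ x i j) Ω := by
  have : IsFiniteMeasure (volume.restrict Ω) :=
    ⟨by rw [Measure.restrict_apply_univ]; exact hΩb.measure_lt_top⟩
  refine Integrable.of_bound (C := hi)
    (aemeasurable_restrict_of_measurable_subtype hΩ (hΛ.1 i j)).aestronglyMeasurable ?_
  filter_upwards [hΛ.ae_norm_le hlo hlohi] with x hx
  have h1 := hx (EuclideanSpace.single j 1)
  have h2 : Λ x i j = (Matrix.toEuclideanLin (Λ x) (EuclideanSpace.single j 1)) i := by
    rw [Matrix.toLpLin_apply]
    simp
  rw [h2]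
  refine (PiLp.norm_apply_le _ i).trans (h1.trans ?_)
  simp

end DiffusionField

/-! ### Equivalence of the seminorm and the energy of the discrete gradient. -/

namespace Discretisation

variable {d : ℕ} {Ω : Set (Pt d)} (D : Discretisation d Ω)

/-- A real `sSup` dominates the elements of a set only if the set is bounded above; finiteness
guarantees this for `theta`. -/
theorem finite_ratios :
    ({r | ∃ σ, D.IsInt σ ∧ ∃ K ∈ D.cellsOf σ, ∃ L ∈ D.cellsOf σ, r = D.dist K σ / D.dist L σ} ∪
    {r | ∃ K, ∃ σ ∈ D.edgesOf K, r = D.cellDiam K / D.dist K σ}).Finite := by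
  refine Set.Finite.union ?_ ?_
  · refine (Set.finite_range fun p : D.Edge × D.Cell × D.Cell =>
      D.dist p.2.1 p.1 / D.dist p.2.2 p.1).subset ?_
    rintro r ⟨σ, -, K, -, L, -, rfl⟩
    exact ⟨(σ, K, L), rfl⟩
  · refine (Set.finite_range fun p : D.Cell × D.Edge => D.cellDiam p.1 / D.dist p.1 p.2).subset ?_
    rintro r ⟨K, σ, -, rfl⟩
    exact ⟨(K, σ), rfl⟩

theorem cellDiam_le {θ : ℝ} (hθ : D.theta ≤ θ) {K : D.Cell} {σ : D.Edge} (hσ : σ ∈ D.edgesOf K) :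
    D.cellDiam K ≤ θ * D.dist K σ := by
  rw [← div_le_iff₀ (D.dist_pos hσ)]
  exact (le_csSup D.finite_ratios.bddAbove (Or.inr ⟨K, σ, hσ, rfl⟩)).trans hθ

theorem cellDiam_nonneg (K : D.Cell) : 0 ≤ D.cellDiam K := Metric.diam_nonneg

theorem cellDiam_le_size (K : D.Cell) : D.cellDiam K ≤ D.size :=
  le_ciSup (Set.finite_range _).bddAbove K

theorem size_nonneg : 0 ≤ D.size := Real.iSup_nonneg fun K => D.cellDiam_nonneg K

/-- The square of the seminorm on `X_D`, restricted to one cell. -/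
def cellEnergy (u : D.X) (K : D.Cell) : ℝ :=
  ∑ σ ∈ D.edgesOf K, D.edgeVol σ / D.dist K σ * (u.2 σ - u.1 K) ^ 2

/-- The square of the `L²` norm of the discrete gradient on one cell. -/
def gradEnergy (u : D.X) (K : D.Cell) : ℝ :=
  ∑ σ ∈ D.edgesOf K, volume.real (D.cone K σ) * ‖D.gradCone u K σ‖ ^ 2

theorem cellEnergy_nonneg (hd : 0 < d) (hΩb : Bornology.IsBounded Ω) (u : D.X) (K : D.Cell) :
    0 ≤ D.cellEnergy u K :=
  Finset.sum_nonneg fun _ hσ => mul_nonneg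
    (div_nonneg (D.edgeVol_pos hd hΩb hσ).le (D.dist_pos hσ).le) (sq_nonneg _)

theorem seminormX_sq (hd : 0 < d) (hΩb : Bornology.IsBounded Ω) (u : D.X) :
    D.seminormX u ^ 2 = ∑ K, D.cellEnergy u K :=
  Real.sq_sqrt (Finset.sum_nonneg fun K _ => D.cellEnergy_nonneg hd hΩb u K)

theorem cellVol_smul_gradCell (hΩb : Bornology.IsBounded Ω) (u : D.X) (K : D.Cell) :
    D.cellVol K • D.gradCell u K =
      ∑ σ ∈ D.edgesOf K, (D.edgeVol σ * (u.2 σ - u.1 K)) • D.normal K σ := by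
  rw [gradCell, smul_smul, mul_inv_cancel₀ (D.cellVol_pos hΩb K).ne', one_smul]

/-- Up to the factor `1 / √d`, the sum is the difference of two expressions of `|K| ∇_K u`: its
definition, and `sum_inner_bary_smul_normal` applied to `∇_K u`. This orthogonality removes the
cross terms from the energy. -/
theorem sum_stab_smul_normal (hd : 0 < d) (hΩb : Bornology.IsBounded Ω) (u : D.X) (K : D.Cell) :
    ∑ σ ∈ D.edgesOf K, (volume.real (D.cone K σ) * D.stab u K σ) • D.normal K σ = 0 := by
  have h1 : ∀ σ ∈ D.edgesOf K, (volume.real (D.cone K σ) * D.stab u K σ) • D.normal K σ =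
      (√(d : ℝ) / d) • ((D.edgeVol σ * (u.2 σ - u.1 K)) • D.normal K σ -
        (D.edgeVol σ * inner ℝ (D.gradCell u K) (D.bary σ - D.center K)) • D.normal K σ) := by
    intro σ hσ
    rw [← sub_smul, smul_smul, D.volume_real_cone hd hσ, stab]
    congr 1
    have := (D.dist_pos hσ).ne'
    field_simp
  rw [Finset.sum_congr rfl h1, ← Finset.smul_sum, Finset.sum_sub_distrib,
    D.sum_inner_bary_smul_normal hd hΩb, D.cellVol_smul_gradCell hΩb, sub_self, smul_zero]

theorem sum_volume_real_cone (hd : 0 < d) (hΩb : Bornology.IsBounded Ω) (K : D.Cell) :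
    ∑ σ ∈ D.edgesOf K, volume.real (D.cone K σ) = D.cellVol K := by
  rw [D.cellVol_eq_sum hd hΩb]
  exact Finset.sum_congr rfl fun σ hσ => D.volume_real_cone hd hσ

/-- The mean of the discrete gradient on a cell is the consistent gradient of the cell. -/
theorem sum_volume_smul_gradCone (hd : 0 < d) (hΩb : Bornology.IsBounded Ω) (u : D.X)
    (K : D.Cell) :
    ∑ σ ∈ D.edgesOf K, volume.real (D.cone K σ) • D.gradCone u K σ =
      D.cellVol K • D.gradCell u K := by
  simp only [gradCone, smul_add, smul_smul]
  rw [Finset.sum_add_distrib, D.sum_stab_smul_normal hd hΩb, add_zero, ← Finset.sum_smul,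
    D.sum_volume_real_cone hd hΩb]

theorem gradEnergy_eq (hd : 0 < d) (hΩb : Bornology.IsBounded Ω) (u : D.X) (K : D.Cell) :
    D.gradEnergy u K = D.cellVol K * ‖D.gradCell u K‖ ^ 2 +
      ∑ σ ∈ D.edgesOf K, volume.real (D.cone K σ) * D.stab u K σ ^ 2 := by
  have h0 : ∑ σ ∈ D.edgesOf K, 2 * inner ℝ (D.gradCell u K)
      ((volume.real (D.cone K σ) * D.stab u K σ) • D.normal K σ) = 0 := by
    rw [← Finset.mul_sum, ← inner_sum, D.sum_stab_smul_normal hd hΩb, inner_zero_right, mul_zero]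
  rw [← D.sum_volume_real_cone hd hΩb, Finset.sum_mul, ← Finset.sum_add_distrib, gradEnergy,
    ← add_zero (∑ σ ∈ D.edgesOf K, (_ + _)), ← h0, ← Finset.sum_add_distrib]
  refine Finset.sum_congr rfl fun σ hσ => ?_
  rw [gradCone, norm_add_sq_real, norm_smul, D.norm_normal hσ, inner_smul_right, inner_smul_right,
    mul_one, Real.norm_eq_abs, sq_abs]
  ring

/-- Cauchy–Schwarz with the weights `|σ| d_{K,σ}`, whose sum is `d |K|`, and `|σ| / d_{K,σ}`, which
are those of the seminorm. -/
theorem cellVol_mul_norm_gradCell_sq_le (hd : 0 < d) (hΩb : Bornology.IsBounded Ω) (u : D.X)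
    (K : D.Cell) : D.cellVol K * ‖D.gradCell u K‖ ^ 2 ≤ d * D.cellEnergy u K := by
  have hV := D.cellVol_pos hΩb K
  have h1 : D.cellVol K * ‖D.gradCell u K‖ ≤
      ∑ σ ∈ D.edgesOf K, D.edgeVol σ * |u.2 σ - u.1 K| := by
    have : D.cellVol K * ‖D.gradCell u K‖ = ‖D.cellVol K • D.gradCell u K‖ := by
      rw [norm_smul, Real.norm_of_nonneg hV.le]
    rw [this, D.cellVol_smul_gradCell hΩb]
    refine (norm_sum_le _ _).trans (Finset.sum_le_sum fun σ hσ => ?_)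
    rw [norm_smul, D.norm_normal hσ, mul_one, norm_mul, Real.norm_eq_abs, Real.norm_eq_abs,
      abs_of_pos (D.edgeVol_pos hd hΩb hσ)]
  have h2 : (∑ σ ∈ D.edgesOf K, D.edgeVol σ * |u.2 σ - u.1 K|) ^ 2 ≤
      (∑ σ ∈ D.edgesOf K, D.edgeVol σ * D.dist K σ) * D.cellEnergy u K := by
    refine Finset.sum_sq_le_sum_mul_sum_of_sq_le_mul _
      (fun σ hσ => (mul_pos (D.edgeVol_pos hd hΩb hσ) (D.dist_pos hσ)).le)
      (fun σ hσ => mul_nonneg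
        (div_nonneg (D.edgeVol_pos hd hΩb hσ).le (D.dist_pos hσ).le) (sq_nonneg _))
      (fun σ hσ => le_of_eq ?_)
    have := (D.dist_pos hσ).ne'
    rw [mul_pow, sq_abs]
    field_simp
  rw [D.sum_edgeVol_mul_dist hd hΩb] at h2
  have h3 := (pow_le_pow_left₀ (by positivity) h1 2).trans h2
  refine le_of_mul_le_mul_left ?_ hV
  calc _ = (D.cellVol K * ‖D.gradCell u K‖) ^ 2 := by ring
    _ ≤ _ := h3
    _ = _ := by ring

theorem abs_inner_gradCell_le (hd : 0 < d) (hΩb : Bornology.IsBounded Ω) {θ : ℝ}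
    (hθ : D.theta ≤ θ) (g : Pt d) {K : D.Cell} {σ : D.Edge} (hσ : σ ∈ D.edgesOf K) :
    inner ℝ g (D.bary σ - D.center K) ^ 2 ≤ θ ^ 2 * D.dist K σ ^ 2 * ‖g‖ ^ 2 := by
  have h1 := abs_real_inner_le_norm g (D.bary σ - D.center K)
  have h2 := (D.norm_bary_sub_center_le hd hΩb hσ).trans (D.cellDiam_le hθ hσ)
  rw [← sq_abs, ← mul_pow, ← mul_pow]
  refine pow_le_pow_left₀ (abs_nonneg _) (h1.trans ?_) 2
  rw [mul_comm]
  gcongr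

/-- The factor `√d` in the stabilisation compensates the `1 / d` in the volume of a cone, leaving
exactly the weight of the seminorm. -/
theorem volume_cone_mul_stab_sq (hd : 0 < d) (u : D.X) {K : D.Cell} {σ : D.Edge}
    (hσ : σ ∈ D.edgesOf K) : volume.real (D.cone K σ) * D.stab u K σ ^ 2 =
      D.edgeVol σ / D.dist K σ *
        (u.2 σ - u.1 K - inner ℝ (D.gradCell u K) (D.bary σ - D.center K)) ^ 2 := by
  have hd' : (0 : ℝ) < d := by exact_mod_cast hd
  have := (D.dist_pos hσ).ne'
  rw [D.volume_real_cone hd hσ, stab, mul_pow, div_pow, Real.sq_sqrt hd'.le]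
  field_simp

/-- The term `d` comes from the mean gradient. The rest comes from `(a - b)² ≤ 2a² + 2b²` in the
stabilisation, where `|x_σ - x_K| ≤ θ d_{K,σ}` bounds `b` by the mean gradient. -/
theorem gradEnergy_le (hd : 0 < d) (hΩb : Bornology.IsBounded Ω) {θ : ℝ}
    (hθ : D.theta ≤ θ) (u : D.X) (K : D.Cell) :
    D.gradEnergy u K ≤ (d + 2 + 2 * θ ^ 2 * d ^ 2) * D.cellEnergy u K := by
  have h1 := D.cellVol_mul_norm_gradCell_sq_le hd hΩb u K
  have h2 : ∑ σ ∈ D.edgesOf K, volume.real (D.cone K σ) * D.stab u K σ ^ 2 ≤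
      2 * D.cellEnergy u K + 2 * θ ^ 2 * ‖D.gradCell u K‖ ^ 2 * (d * D.cellVol K) := by
    rw [← D.sum_edgeVol_mul_dist hd hΩb, cellEnergy, Finset.mul_sum, Finset.mul_sum,
      ← Finset.sum_add_distrib]
    refine Finset.sum_le_sum fun σ hσ => ?_
    have hδ := D.dist_pos hσ
    have hm := D.edgeVol_pos hd hΩb hσ
    have h3 := D.abs_inner_gradCell_le hd hΩb hθ (D.gradCell u K) hσ
    rw [D.volume_cone_mul_stab_sq hd u hσ]
    set a := u.2 σ - u.1 K
    set b := inner ℝ (D.gradCell u K) (D.bary σ - D.center K)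
    calc D.edgeVol σ / D.dist K σ * (a - b) ^ 2
        ≤ D.edgeVol σ / D.dist K σ *
          (2 * a ^ 2 + 2 * (θ ^ 2 * D.dist K σ ^ 2 * ‖D.gradCell u K‖ ^ 2)) := by
          gcongr
          nlinarith [sq_nonneg (a + b)]
      _ = _ := by field_simp
  rw [D.gradEnergy_eq hd hΩb]
  nlinarith [mul_le_mul_of_nonneg_left h1 (by positivity : 0 ≤ 2 * θ ^ 2 * (d : ℝ))]

/-- Each difference `u_σ - u_K` is the residual penalised by the stabilisation plus `∇_K u · (x_σ -
x_K)`, and the energy controls both. Coercivity is thus local to a cell. -/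
theorem cellEnergy_le (hd : 0 < d) (hΩb : Bornology.IsBounded Ω) {θ : ℝ}
    (hθ : D.theta ≤ θ) (u : D.X) (K : D.Cell) :
    D.cellEnergy u K ≤ 2 * (1 + d * θ ^ 2) * D.gradEnergy u K := by
  have hV := D.cellVol_pos hΩb K
  have h2 : D.cellEnergy u K ≤ 2 * ∑ σ ∈ D.edgesOf K, volume.real (D.cone K σ) * D.stab u K σ ^ 2
      + 2 * θ ^ 2 * ‖D.gradCell u K‖ ^ 2 * (d * D.cellVol K) := by
    rw [← D.sum_edgeVol_mul_dist hd hΩb, cellEnergy, Finset.mul_sum, Finset.mul_sum,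
      ← Finset.sum_add_distrib]
    refine Finset.sum_le_sum fun σ hσ => ?_
    have hδ := D.dist_pos hσ
    have hm := D.edgeVol_pos hd hΩb hσ
    have h3 := D.abs_inner_gradCell_le hd hΩb hθ (D.gradCell u K) hσ
    rw [D.volume_cone_mul_stab_sq hd u hσ]
    set a := u.2 σ - u.1 K
    set b := inner ℝ (D.gradCell u K) (D.bary σ - D.center K)
    calc D.edgeVol σ / D.dist K σ * a ^ 2
        ≤ D.edgeVol σ / D.dist K σ *
          (2 * (a - b) ^ 2 + 2 * (θ ^ 2 * D.dist K σ ^ 2 * ‖D.gradCell u K‖ ^ 2)) := by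
          gcongr
          nlinarith [sq_nonneg (a - 2 * b)]
      _ = _ := by field_simp
  have h4 : 0 ≤ ∑ σ ∈ D.edgesOf K, volume.real (D.cone K σ) * D.stab u K σ ^ 2 :=
    Finset.sum_nonneg fun σ _ => by positivity
  have h5 : 0 ≤ D.cellVol K * ‖D.gradCell u K‖ ^ 2 := by positivity
  rw [D.gradEnergy_eq hd hΩb]
  have : 0 ≤ d * θ ^ 2 := by positivity
  nlinarith [mul_nonneg this h4]

theorem sum_gradEnergy_le (hd : 0 < d) (hΩb : Bornology.IsBounded Ω) {θ : ℝ}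
    (hθ : D.theta ≤ θ) (u : D.X) :
    ∑ K, D.gradEnergy u K ≤ (d + 2 + 2 * θ ^ 2 * d ^ 2) * D.seminormX u ^ 2 := by
  rw [D.seminormX_sq hd hΩb, Finset.mul_sum]
  exact Finset.sum_le_sum fun K _ => D.gradEnergy_le hd hΩb hθ u K

theorem seminormX_sq_le (hd : 0 < d) (hΩb : Bornology.IsBounded Ω) {θ : ℝ}
    (hθ : D.theta ≤ θ) (u : D.X) :
    D.seminormX u ^ 2 ≤ 2 * (1 + d * θ ^ 2) * ∑ K, D.gradEnergy u K := by
  rw [D.seminormX_sq hd hΩb, Finset.mul_sum]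
  exact Finset.sum_le_sum fun K _ => D.cellEnergy_le hd hΩb hθ u K

/-! ### The flux form as an integral; symmetry, continuity, coercivity. -/

theorem cone_subset {K : D.Cell} {σ : D.Edge} (hσ : σ ∈ D.edgesOf K) : D.cone K σ ⊆ Ω :=
  (D.cone_subset_cell hσ).trans (D.cell_subset K)

theorem ae_cone {p : Pt d → Prop} (hp : ∀ᵐ x ∂(volume.restrict Ω), p x)
    {K : D.Cell} {σ : D.Edge} (hσ : σ ∈ D.edgesOf K) :
    ∀ᵐ x ∂(volume.restrict (D.cone K σ)), p x :=
  ae_restrict_of_ae_restrict_of_subset (D.cone_subset hσ) hp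

theorem integrableOn_cell_of_cone {E : Type*} [NormedAddCommGroup E]
    (hd : 0 < d) (hΩb : Bornology.IsBounded Ω) {K : D.Cell} {f : Pt d → E}
    (hf : ∀ σ ∈ D.edgesOf K, IntegrableOn f (D.cone K σ)) : IntegrableOn f (D.cell K) :=
  (integrableOn_finset_iUnion.2 hf).congr_set_ae (D.cell_ae_eq_cones hd hΩb K).symm

theorem setIntegral_eq_sum_cell {E : Type*} [NormedAddCommGroup E] [NormedSpace ℝ E]
    {f : Pt d → E} (hf : ∀ K, IntegrableOn f (D.cell K)) :
    ∫ x in Ω, f x = ∑ K, ∫ x in D.cell K, f x := by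
  rw [← setIntegral_congr_set D.iUnion_cell_ae_eq,
    integral_iUnion_fintype (fun K => (D.cell_isOpen K).measurableSet) D.cell_disjoint hf]

theorem setIntegral_eq_sum_cone {E : Type*} [NormedAddCommGroup E] [NormedSpace ℝ E]
    (hd : 0 < d) (hΩb : Bornology.IsBounded Ω) {f : Pt d → E}
    (hf : ∀ K, ∀ σ ∈ D.edgesOf K, IntegrableOn f (D.cone K σ)) :
    ∫ x in Ω, f x = ∑ K, ∑ σ ∈ D.edgesOf K, ∫ x in D.cone K σ, f x := by
  rw [D.setIntegral_eq_sum_cell fun K => D.integrableOn_cell_of_cone hd hΩb (hf K)]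
  exact Finset.sum_congr rfl fun K _ => D.setIntegral_cell_eq_sum hd hΩb K (hf K)

theorem sum_cellVol (hΩb : Bornology.IsBounded Ω) : ∑ K, D.cellVol K = volume.real Ω := by
  have h := D.setIntegral_eq_sum_cell (f := fun _ => (1 : ℝ))
    fun K => integrableOn_const (D.volume_cell_lt_top hΩb K).ne
  simp only [setIntegral_const, smul_eq_mul, mul_one] at h
  exact h.symm

theorem grad_of_mem_cone (u : D.X) {K : D.Cell} {σ : D.Edge} (hσ : σ ∈ D.edgesOf K) {x : Pt d}
    (hx : x ∈ D.cone K σ) : D.grad u x = D.gradCone u K σ := by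
  rw [grad, Finset.sum_eq_single K, Finset.sum_eq_single σ, Set.indicator_of_mem hx]
  · intro τ hτ h
    exact Set.indicator_of_notMem (Set.disjoint_left.1 (D.disjoint_cone hσ hτ h.symm) hx) _
  · exact fun h => absurd hσ h
  · intro L _ h
    refine Finset.sum_eq_zero fun τ hτ => Set.indicator_of_notMem (fun hx' => ?_) _
    exact Set.disjoint_left.1 (D.cell_disjoint h) (D.cone_subset_cell hτ hx')
      (D.cone_subset_cell hσ hx)
  · exact fun h => absurd (Finset.mem_univ _) h

theorem grad_of_notMem (u : D.X) {x : Pt d} (hx : x ∉ Ω) : D.grad u x = 0 :=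
  Finset.sum_eq_zero fun _ _ => Finset.sum_eq_zero fun _ hσ =>
    Set.indicator_of_notMem (fun h => hx (D.cone_subset hσ h)) _

/-- The vectors `y^{τσ}` are the coefficients of the differences `u_σ - u_K` in `∇_{K,τ} u`; the
diagonal case carries the extra term `u_τ - u_K` of the stabilisation. -/
theorem gradCone_eq_sum (hΩb : Bornology.IsBounded Ω) (u : D.X) {K : D.Cell} {τ : D.Edge}
    (hτ : τ ∈ D.edgesOf K) :
    D.gradCone u K τ = ∑ σ ∈ D.edgesOf K, (u.2 σ - u.1 K) • D.yVec K τ σ := by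
  have hδ := (D.dist_pos hτ).ne'
  have hV := (D.cellVol_pos hΩb K).ne'
  have hy : ∀ σ, (u.2 σ - u.1 K) • D.yVec K τ σ =
      (D.cellVol K)⁻¹ • (D.edgeVol σ * (u.2 σ - u.1 K)) • D.normal K σ +
      (√(d : ℝ) / D.dist K τ * ((if σ = τ then u.2 σ - u.1 K else 0) -
        (D.cellVol K)⁻¹ * (D.edgeVol σ * (u.2 σ - u.1 K) *
          inner ℝ (D.normal K σ) (D.bary τ - D.center K)))) • D.normal K τ := by
    intro σ
    rw [yVec]
    by_cases h : τ = σ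
    · subst h
      simp only [if_true]
      rw [smul_add, smul_smul, smul_smul, smul_smul]
      congr 2 <;> field_simp
    · rw [if_neg h, if_neg (Ne.symm h), smul_sub, smul_smul, smul_smul, smul_smul, sub_eq_add_neg,
        ← neg_smul]
      congr 2 <;> field_simp
      ring
  rw [Finset.sum_congr rfl fun σ _ => hy σ, Finset.sum_add_distrib, ← Finset.smul_sum, ← gradCell,
    gradCone, ← Finset.sum_smul, stab, ← Finset.mul_sum, Finset.sum_sub_distrib,
    Finset.sum_ite_eq_of_mem' _ _ _ hτ, ← Finset.mul_sum, gradCell, inner_smul_left, sum_inner]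
  simp only [inner_smul_left, conj_trivial]

variable {lo hi : ℝ} {Λ : Pt d → Matrix (Fin d) (Fin d) ℝ}

theorem integrableOn_cone_inner (hΛ : IsDiffusionField Ω lo hi Λ) (hlo : 0 ≤ lo)
    (hlohi : lo ≤ hi) (hΩo : IsOpen Ω) (hΩb : Bornology.IsBounded Ω) {K : D.Cell} {σ : D.Edge}
    (hσ : σ ∈ D.edgesOf K) (a b : Pt d) :
    IntegrableOn (fun x => inner ℝ a (Matrix.toEuclideanLin (Λ x) b)) (D.cone K σ) := by
  simp_rw [inner_toEuclideanLin_eq_sum]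
  refine integrable_finsetSum _ fun i _ => integrable_finsetSum _ fun j _ => ?_
  exact (((hΛ.integrableOn_entry hlo hlohi hΩo.measurableSet hΩb i j).mono_set
    (D.cone_subset hσ)).mul_const _).const_mul _

theorem inner_coneIntegral (hΛ : IsDiffusionField Ω lo hi Λ) (hlo : 0 ≤ lo)
    (hlohi : lo ≤ hi) (hΩo : IsOpen Ω) (hΩb : Bornology.IsBounded Ω) {K : D.Cell} {σ : D.Edge}
    (hσ : σ ∈ D.edgesOf K) (a b : Pt d) :
    inner ℝ a (Matrix.toEuclideanLin (D.coneIntegral Λ K σ) b) =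
      ∫ x in D.cone K σ, inner ℝ a (Matrix.toEuclideanLin (Λ x) b) := by
  have hint : ∀ i j, Integrable (fun x => a i * (Λ x i j * b j))
      (volume.restrict (D.cone K σ)) := fun i j =>
    (((hΛ.integrableOn_entry hlo hlohi hΩo.measurableSet hΩb i j).mono_set
      (D.cone_subset hσ)).mul_const _).const_mul _
  simp_rw [inner_toEuclideanLin_eq_sum]
  rw [integral_finsetSum _ fun i _ => integrable_finsetSum _ fun j _ => hint i j]
  refine Finset.sum_congr rfl fun i _ => ?_
  rw [integral_finsetSum _ fun j _ => hint i j]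
  refine Finset.sum_congr rfl fun j _ => ?_
  rw [integral_const_mul, integral_mul_const, coneIntegral, Matrix.of_apply]

/-- Expanding both cone gradients in the vectors `y` and exchanging the finite sums gives the local
matrix. The flux form has `u` in the right slot of that matrix, so the symmetry of `Λ` is used to
exchange the roles of `u` and `v`. -/
theorem form_sushiFlux_eq_sum (hΛ : IsDiffusionField Ω lo hi Λ) (hlo : 0 ≤ lo)
    (hlohi : lo ≤ hi) (hΩo : IsOpen Ω) (hΩb : Bornology.IsBounded Ω) (u v : D.X) :
    D.form (D.sushiFlux Λ) u v = ∑ K, ∑ σ ∈ D.edgesOf K, ∫ x in D.cone K σ,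
      inner ℝ (D.gradCone u K σ) (Matrix.toEuclideanLin (Λ x) (D.gradCone v K σ)) := by
  refine Finset.sum_congr rfl fun K _ => ?_
  have h1 : ∀ τ ∈ D.edgesOf K, ∫ x in D.cone K τ,
      inner ℝ (D.gradCone u K τ) (Matrix.toEuclideanLin (Λ x) (D.gradCone v K τ)) =
      inner ℝ (D.gradCone v K τ)
        (Matrix.toEuclideanLin (D.coneIntegral Λ K τ) (D.gradCone u K τ)) := by
    intro τ hτ
    rw [D.inner_coneIntegral hΛ hlo hlohi hΩo hΩb hτ]
    refine integral_congr_ae ?_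
    filter_upwards [D.ae_cone hΛ.ae_symm hτ] with x hx
    rw [← hx, real_inner_comm]
  rw [Finset.sum_congr rfl h1]
  have h2 : ∀ σ, D.sushiFlux Λ K σ u * (v.1 K - v.2 σ) =
      ∑ σ' ∈ D.edgesOf K, ∑ τ ∈ D.edgesOf K, (v.2 σ - v.1 K) * ((u.2 σ' - u.1 K) *
        inner ℝ (D.yVec K τ σ)
          (Matrix.toEuclideanLin (D.coneIntegral Λ K τ) (D.yVec K τ σ'))) := by
    intro σ
    have : D.sushiFlux Λ K σ u =
        ∑ σ' ∈ D.edgesOf K, D.localMatrix Λ K σ σ' * (u.1 K - u.2 σ') := by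
      simp [sushiFlux, diffForm]
    rw [this, Finset.sum_mul]
    refine Finset.sum_congr rfl fun σ' _ => ?_
    rw [localMatrix, Finset.sum_mul, Finset.sum_mul]
    refine Finset.sum_congr rfl fun τ _ => ?_
    ring
  rw [Finset.sum_congr rfl fun σ _ => h2 σ]
  have h3 : ∀ τ ∈ D.edgesOf K, inner ℝ (D.gradCone v K τ)
        (Matrix.toEuclideanLin (D.coneIntegral Λ K τ) (D.gradCone u K τ)) =
      ∑ σ ∈ D.edgesOf K, ∑ σ' ∈ D.edgesOf K, (v.2 σ - v.1 K) * ((u.2 σ' - u.1 K) *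
        inner ℝ (D.yVec K τ σ)
          (Matrix.toEuclideanLin (D.coneIntegral Λ K τ) (D.yVec K τ σ'))) := by
    intro τ hτ
    rw [D.gradCone_eq_sum hΩb u hτ, D.gradCone_eq_sum hΩb v hτ, sum_inner]
    refine Finset.sum_congr rfl fun σ _ => ?_
    rw [map_sum, inner_sum]
    refine Finset.sum_congr rfl fun σ' _ => ?_
    rw [map_smul, inner_smul_left, inner_smul_right]
    rfl
  rw [Finset.sum_congr rfl h3]
  conv_rhs => rw [Finset.sum_comm]
  exact Finset.sum_congr rfl fun σ _ => Finset.sum_comm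

theorem form_sushiFlux_eq_integral (hd : 0 < d) (hΛ : IsDiffusionField Ω lo hi Λ) (hlo : 0 ≤ lo)
    (hlohi : lo ≤ hi) (hΩo : IsOpen Ω) (hΩb : Bornology.IsBounded Ω) (u v : D.X) :
    D.form (D.sushiFlux Λ) u v =
      ∫ x in Ω, inner ℝ (D.grad u x) (Matrix.toEuclideanLin (Λ x) (D.grad v x)) := by
  have heq : ∀ K, ∀ σ ∈ D.edgesOf K, Set.EqOn
      (fun x => inner ℝ (D.gradCone u K σ) (Matrix.toEuclideanLin (Λ x) (D.gradCone v K σ)))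
      (fun x => inner ℝ (D.grad u x) (Matrix.toEuclideanLin (Λ x) (D.grad v x)))
      (D.cone K σ) := by
    intro K σ hσ x hx
    simp only [D.grad_of_mem_cone _ hσ hx]
  rw [D.form_sushiFlux_eq_sum hΛ hlo hlohi hΩo hΩb, D.setIntegral_eq_sum_cone hd hΩb]
  · exact Finset.sum_congr rfl fun K _ => Finset.sum_congr rfl fun σ hσ =>
      setIntegral_congr_fun (D.measurableSet_cone hσ) (heq K σ hσ)
  · exact fun K σ hσ => (D.integrableOn_cone_inner hΛ hlo hlohi hΩo hΩb hσ _ _).congr_fun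
      (heq K σ hσ) (D.measurableSet_cone hσ)

theorem form_sushiFlux_comm (hΛ : IsDiffusionField Ω lo hi Λ) (hlo : 0 ≤ lo)
    (hlohi : lo ≤ hi) (hΩo : IsOpen Ω) (hΩb : Bornology.IsBounded Ω) (u v : D.X) :
    D.form (D.sushiFlux Λ) u v = D.form (D.sushiFlux Λ) v u := by
  rw [D.form_sushiFlux_eq_sum hΛ hlo hlohi hΩo hΩb, D.form_sushiFlux_eq_sum hΛ hlo hlohi hΩo hΩb]
  refine Finset.sum_congr rfl fun K _ => Finset.sum_congr rfl fun σ hσ => integral_congr_ae ?_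
  filter_upwards [D.ae_cone hΛ.ae_symm hσ] with x hx
  rw [← hx, real_inner_comm]

theorem sum_volume_mul_norm_mul_norm_le (a b : D.Cell → D.Edge → Pt d) :
    ∑ K, ∑ σ ∈ D.edgesOf K, volume.real (D.cone K σ) * (‖a K σ‖ * ‖b K σ‖) ≤
      √(∑ K, ∑ σ ∈ D.edgesOf K, volume.real (D.cone K σ) * ‖a K σ‖ ^ 2) *
      √(∑ K, ∑ σ ∈ D.edgesOf K, volume.real (D.cone K σ) * ‖b K σ‖ ^ 2) := by
  rw [Finset.sum_sigma', Finset.sum_sigma', Finset.sum_sigma']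
  have h := Real.sum_mul_le_sqrt_mul_sqrt (Finset.univ.sigma D.edgesOf)
    (fun p => √(volume.real (D.cone p.1 p.2)) * ‖a p.1 p.2‖)
    (fun p => √(volume.real (D.cone p.1 p.2)) * ‖b p.1 p.2‖)
  simp only [mul_pow, Real.sq_sqrt measureReal_nonneg] at h
  refine le_trans (le_of_eq (Finset.sum_congr rfl fun p _ => ?_)) h
  rw [mul_mul_mul_comm, Real.mul_self_sqrt measureReal_nonneg]

theorem form_sushiFlux_le (hd : 0 < d) (hΛ : IsDiffusionField Ω lo hi Λ) (hlo : 0 ≤ lo)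
    (hlohi : lo ≤ hi) (hΩo : IsOpen Ω) (hΩb : Bornology.IsBounded Ω) {θ : ℝ}
    (hθ : D.theta ≤ θ) (u v : D.X) :
    D.form (D.sushiFlux Λ) u v ≤
      hi * (d + 2 + 2 * θ ^ 2 * d ^ 2) * D.seminormX u * D.seminormX v := by
  have hhi : 0 ≤ hi := hlo.trans hlohi
  have hsn : ∀ u, 0 ≤ D.seminormX u := fun u => Real.sqrt_nonneg _
  set C : ℝ := d + 2 + 2 * θ ^ 2 * d ^ 2 with hC
  have hC0 : 0 ≤ C := by positivity
  have h1 : D.form (D.sushiFlux Λ) u v ≤ hi * ∑ K, ∑ σ ∈ D.edgesOf K,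
      volume.real (D.cone K σ) * (‖D.gradCone u K σ‖ * ‖D.gradCone v K σ‖) := by
    rw [D.form_sushiFlux_eq_sum hΛ hlo hlohi hΩo hΩb, Finset.mul_sum]
    refine Finset.sum_le_sum fun K _ => ?_
    rw [Finset.mul_sum]
    refine Finset.sum_le_sum fun σ hσ => (le_abs_self _).trans ?_
    rw [← Real.norm_eq_abs]
    refine (norm_setIntegral_le_of_norm_le_const_ae
      (C := hi * (‖D.gradCone u K σ‖ * ‖D.gradCone v K σ‖)) (D.volume_cone_lt_top hΩb hσ) ?_).trans
      (le_of_eq (by ring))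
    filter_upwards [D.ae_cone (hΛ.ae_norm_le hlo hlohi) hσ] with x hx
    refine (norm_inner_le_norm _ _).trans ?_
    calc _ ≤ ‖D.gradCone u K σ‖ * (hi * ‖D.gradCone v K σ‖) := by gcongr; exact hx _
      _ = _ := by ring
  have h2 := D.sum_volume_mul_norm_mul_norm_le (D.gradCone u) (D.gradCone v)
  have h3 : ∀ u : D.X, √(∑ K, ∑ σ ∈ D.edgesOf K,
      volume.real (D.cone K σ) * ‖D.gradCone u K σ‖ ^ 2) ≤ √C * D.seminormX u := by
    intro u
    refine Real.sqrt_le_iff.2 ⟨by have := hsn u; positivity, ?_⟩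
    rw [mul_pow, Real.sq_sqrt hC0]
    exact D.sum_gradEnergy_le hd hΩb hθ u
  calc _ ≤ hi * ((√C * D.seminormX u) * (√C * D.seminormX v)) := by
        refine h1.trans (mul_le_mul_of_nonneg_left (h2.trans ?_) hhi)
        exact mul_le_mul (h3 u) (h3 v) (Real.sqrt_nonneg _) (by have := hsn u; positivity)
    _ = hi * (√C * √C) * D.seminormX u * D.seminormX v := by ring
    _ = _ := by rw [Real.mul_self_sqrt hC0]

theorem le_form_sushiFlux (hd : 0 < d) (hΛ : IsDiffusionField Ω lo hi Λ) (hlo : 0 ≤ lo)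
    (hlohi : lo ≤ hi) (hΩo : IsOpen Ω) (hΩb : Bornology.IsBounded Ω) {θ : ℝ}
    (hθ : D.theta ≤ θ) (u : D.X) :
    lo / (2 * (1 + d * θ ^ 2)) * D.seminormX u ^ 2 ≤ D.form (D.sushiFlux Λ) u u := by
  have h1 : lo * ∑ K, D.gradEnergy u K ≤ D.form (D.sushiFlux Λ) u u := by
    rw [D.form_sushiFlux_eq_sum hΛ hlo hlohi hΩo hΩb, Finset.mul_sum]
    refine Finset.sum_le_sum fun K _ => ?_
    rw [gradEnergy, Finset.mul_sum]
    refine Finset.sum_le_sum fun σ hσ => ?_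
    have hconst : lo * (volume.real (D.cone K σ) * ‖D.gradCone u K σ‖ ^ 2) =
        ∫ _ in D.cone K σ, lo * ‖D.gradCone u K σ‖ ^ 2 := by
      rw [setIntegral_const, smul_eq_mul]; ring
    rw [hconst]
    refine integral_mono_ae (integrableOn_const (D.volume_cone_lt_top hΩb hσ).ne)
      (D.integrableOn_cone_inner hΛ hlo hlohi hΩo hΩb hσ _ _) ?_
    filter_upwards [D.ae_cone hΛ.ae_coercive hσ] with x hx using hx _
  refine le_trans ?_ h1
  have h2 := D.seminormX_sq_le hd hΩb hθ u
  have hpos : 0 < 2 * (1 + d * θ ^ 2) := by positivity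
  calc _ ≤ lo / (2 * (1 + d * θ ^ 2)) * (2 * (1 + d * θ ^ 2) * ∑ K, D.gradEnergy u K) := by
        gcongr
    _ = _ := by field_simp

end Discretisation

/-! ### Accuracy of the discrete gradient on interpolants of smooth functions. -/

/-- `B` bounds the gradient of `φ` and the Lipschitz constants of `φ` and of its gradient. -/
structure IsSmoothBound {d : ℕ} (φ : Pt d → ℝ) (B : ℝ) : Prop where
  nonneg : 0 ≤ B
  norm_gradient_le : ∀ x, ‖gradient φ x‖ ≤ B
  abs_sub_le : ∀ x y, |φ y - φ x| ≤ B * ‖y - x‖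
  norm_gradient_sub_le : ∀ x y, ‖gradient φ y - gradient φ x‖ ≤ B * ‖y - x‖
  abs_taylor_le : ∀ x y, |φ y - φ x - inner ℝ (gradient φ x) (y - x)| ≤ B * ‖y - x‖ ^ 2

theorem continuous_gradient {d : ℕ} {φ : Pt d → ℝ} (hφ : ContDiff ℝ ∞ φ) :
    Continuous (gradient φ) :=
  (InnerProductSpace.toDual ℝ (Pt d)).symm.continuous.comp (hφ.continuous_fderiv (by simp))

theorem exists_isSmoothBound {d : ℕ} {φ : Pt d → ℝ} (hφ : ContDiff ℝ ∞ φ)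
    (hc : HasCompactSupport φ) : ∃ B, IsSmoothBound φ B := by
  obtain ⟨C₁, h₁⟩ := ContDiff.lipschitzWith_of_hasCompactSupport hc hφ (by simp)
  obtain ⟨C₂, h₂⟩ := ContDiff.lipschitzWith_of_hasCompactSupport (hc.fderiv ℝ)
    (hφ.fderiv_right (m := ∞) (by simp)) (by simp)
  have hdist : ∀ x y, ‖gradient φ y - gradient φ x‖ = ‖fderiv ℝ φ y - fderiv ℝ φ x‖ := by
    intro x y
    rw [gradient, gradient, ← map_sub, LinearIsometryEquiv.norm_map]
  have h₂' : ∀ x y, ‖fderiv ℝ φ y - fderiv ℝ φ x‖ ≤ C₂ * ‖y - x‖ := by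
    intro x y
    simpa [dist_eq_norm] using h₂.dist_le_mul y x
  have hle₁ : (C₁ : ℝ) ≤ (max C₁ C₂ : NNReal) := by exact_mod_cast le_max_left _ _
  have hle₂ : (C₂ : ℝ) ≤ (max C₁ C₂ : NNReal) := by exact_mod_cast le_max_right _ _
  refine ⟨(max C₁ C₂ : NNReal), ⟨NNReal.coe_nonneg _, fun x => ?_, fun x y => ?_, fun x y => ?_,
    fun x y => ?_⟩⟩
  · rw [gradient, LinearIsometryEquiv.norm_map]
    exact (norm_fderiv_le_of_lipschitz ℝ h₁).trans hle₁
  · have := h₁.dist_le_mul y x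
    rw [Real.dist_eq, dist_eq_norm] at this
    exact this.trans (by gcongr)
  · rw [hdist]
    exact (h₂' x y).trans (by gcongr)
  · rw [inner_gradient_left, ← Real.norm_eq_abs]
    have h := (convex_segment x y).norm_image_sub_le_of_norm_fderiv_le' (𝕜 := ℝ) (f := φ)
      (φ := fderiv ℝ φ x) (C := C₂ * ‖y - x‖)
      (fun z _ => hφ.differentiable (by simp) z) (fun z hz => ?_)
      (left_mem_segment ℝ x y) (right_mem_segment ℝ x y)
    · refine h.trans ?_
      rw [mul_assoc, ← sq]
      gcongr
    · refine (h₂' x z).trans ?_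
      gcongr
      obtain ⟨a, b, ha, hb, hab, rfl⟩ := hz
      have : a • x + b • y - x = b • (y - x) := by
        rw [show a = 1 - b by linarith, sub_smul, one_smul, smul_sub]; abel
      rw [this, norm_smul, Real.norm_of_nonneg hb]
      exact mul_le_of_le_one_left (norm_nonneg _) (by linarith)

namespace Discretisation

variable {d : ℕ} {Ω : Set (Pt d)} (D : Discretisation d Ω) {φ : Pt d → ℝ} {B θ : ℝ}

theorem norm_sub_center_le_of_mem_cone (hΩb : Bornology.IsBounded Ω) {K : D.Cell} {σ : D.Edge}
    (hσ : σ ∈ D.edgesOf K) {x : Pt d} (hx : x ∈ D.cone K σ) :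
    ‖x - D.center K‖ ≤ D.cellDiam K :=
  D.norm_sub_center_le hΩb (subset_closure (D.cone_subset_cell hσ hx))

/-- A sum over the edges of a cell of terms of second order is of first order with respect to the
volume of the cell. -/
theorem norm_sum_smul_normal_le (hd : 0 < d) (hΩb : Bornology.IsBounded Ω)
    (hθ : D.theta ≤ θ) (hB : 0 ≤ B) (K : D.Cell) {ρ : D.Edge → ℝ}
    (hρ : ∀ σ ∈ D.edgesOf K, |ρ σ| ≤ B * D.cellDiam K ^ 2) :
    ‖∑ σ ∈ D.edgesOf K, (D.edgeVol σ * ρ σ) • D.normal K σ‖ ≤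
      B * θ * d * D.cellDiam K * D.cellVol K := by
  have hh := D.cellDiam_nonneg K
  refine (norm_sum_le _ _).trans ?_
  -- One of the two factors `h_K` is traded for `θ d_{K,σ}`, so that the sum over the edges becomes
  -- `∑ |σ| d_{K,σ} = d |K|`.
  have : B * θ * d * D.cellDiam K * D.cellVol K =
      ∑ σ ∈ D.edgesOf K, B * θ * D.cellDiam K * (D.edgeVol σ * D.dist K σ) := by
    rw [← Finset.mul_sum, D.sum_edgeVol_mul_dist hd hΩb]; ring
  rw [this]
  refine Finset.sum_le_sum fun σ hσ => ?_
  have hm := D.edgeVol_pos hd hΩb hσ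
  rw [norm_smul, D.norm_normal hσ, mul_one, norm_mul, Real.norm_of_nonneg hm.le, Real.norm_eq_abs]
  calc D.edgeVol σ * |ρ σ| ≤ D.edgeVol σ * (B * D.cellDiam K ^ 2) := by
        gcongr; exact hρ σ hσ
    _ = D.edgeVol σ * (B * D.cellDiam K * D.cellDiam K) := by ring
    _ ≤ D.edgeVol σ * (B * D.cellDiam K * (θ * D.dist K σ)) := by
        gcongr; exact D.cellDiam_le hθ hσ
    _ = _ := by ring

theorem abs_taylor_bary_le (hd : 0 < d) (hΩb : Bornology.IsBounded Ω)
    (hφ : IsSmoothBound φ B) {K : D.Cell} {σ : D.Edge} (hσ : σ ∈ D.edgesOf K) :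
    |φ (D.bary σ) - φ (D.center K) -
      inner ℝ (gradient φ (D.center K)) (D.bary σ - D.center K)| ≤ B * D.cellDiam K ^ 2 := by
  refine (hφ.abs_taylor_le _ _).trans ?_
  have := hφ.nonneg
  gcongr
  exact D.norm_bary_sub_center_le hd hΩb hσ

/-- By `sum_inner_bary_smul_normal`, `∇_K` is exact on affine functions; only the second-order
Taylor remainders at the barycentres contribute. -/
theorem norm_gradCell_interp_sub_le (hd : 0 < d) (hΩb : Bornology.IsBounded Ω)
    (hθ : D.theta ≤ θ) (hφ : IsSmoothBound φ B) (K : D.Cell) :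
    ‖D.gradCell (D.interp φ) K - gradient φ (D.center K)‖ ≤ B * θ * d * D.cellDiam K := by
  have hV := D.cellVol_pos hΩb K
  have h := D.norm_sum_smul_normal_le hd hΩb hθ hφ.nonneg K
    fun σ hσ => D.abs_taylor_bary_le hd hΩb hφ hσ
  have h2 : ∑ σ ∈ D.edgesOf K, (D.edgeVol σ * (φ (D.bary σ) - φ (D.center K) -
      inner ℝ (gradient φ (D.center K)) (D.bary σ - D.center K))) • D.normal K σ =
      D.cellVol K • (D.gradCell (D.interp φ) K - gradient φ (D.center K)) := by
    rw [smul_sub, D.cellVol_smul_gradCell hΩb, ← D.sum_inner_bary_smul_normal hd hΩb,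
      ← Finset.sum_sub_distrib]
    refine Finset.sum_congr rfl fun σ _ => ?_
    rw [← sub_smul, ← mul_sub]
    rfl
  rw [h2, norm_smul, Real.norm_of_nonneg hV.le, mul_comm] at h
  exact le_of_mul_le_mul_right h hV

/-- The discrete gradient of the interpolant of a smooth function is close to the gradient. -/
theorem norm_gradCone_interp_sub_le (hd : 0 < d) (hΩb : Bornology.IsBounded Ω)
    (hθ0 : 0 ≤ θ) (hθ : D.theta ≤ θ) (hφ : IsSmoothBound φ B) {K : D.Cell} {σ : D.Edge}
    (hσ : σ ∈ D.edgesOf K) {x : Pt d} (hx : x ∈ D.cone K σ) :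
    ‖D.gradCone (D.interp φ) K σ - gradient φ x‖ ≤
      B * (θ * d + √(d : ℝ) * θ * (θ * d + 1) + 1) * D.size := by
  have hB := hφ.nonneg
  have hh := D.cellDiam_nonneg K
  have hδ := D.dist_pos hσ
  set g := gradient φ (D.center K)
  set G := D.gradCell (D.interp φ) K
  have h1 : ‖G - g‖ ≤ B * θ * d * D.cellDiam K := D.norm_gradCell_interp_sub_le hd hΩb hθ hφ K
  have h2 : ‖g - gradient φ x‖ ≤ B * D.cellDiam K := by
    refine (hφ.norm_gradient_sub_le _ _).trans ?_
    rw [norm_sub_rev]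
    gcongr
    exact D.norm_sub_center_le_of_mem_cone hΩb hσ hx
  -- The residual is of second order in `h_K`; the division by `d_{K,σ}` costs one order, through
  -- `h_K ≤ θ d_{K,σ}`.
  have h3 : |D.stab (D.interp φ) K σ| ≤ √(d : ℝ) * θ * (B * θ * d + B) * D.cellDiam K := by
    have hr := D.norm_bary_sub_center_le hd hΩb hσ
    have h4 : |(D.interp φ).2 σ - (D.interp φ).1 K - inner ℝ G (D.bary σ - D.center K)| ≤
        (B * θ * d + B) * D.cellDiam K * D.cellDiam K := by
      have h5 := D.abs_taylor_bary_le hd hΩb hφ hσ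
      have h6 := (abs_real_inner_le_norm (G - g) (D.bary σ - D.center K)).trans
        (mul_le_mul h1 hr (norm_nonneg _) (by positivity))
      have h7 : (D.interp φ).2 σ - (D.interp φ).1 K - inner ℝ G (D.bary σ - D.center K) =
          (φ (D.bary σ) - φ (D.center K) - inner ℝ g (D.bary σ - D.center K)) -
            inner ℝ (G - g) (D.bary σ - D.center K) := by
        rw [inner_sub_left]; simp only [interp]; ring
      rw [h7]
      refine (abs_sub _ _).trans ((add_le_add h5 h6).trans (le_of_eq (by ring)))
    rw [stab, abs_mul, abs_of_nonneg (by positivity : 0 ≤ √(d : ℝ) / D.dist K σ)]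
    calc _ ≤ √(d : ℝ) / D.dist K σ * ((B * θ * d + B) * D.cellDiam K * D.cellDiam K) := by
          gcongr
      _ ≤ √(d : ℝ) / D.dist K σ * ((B * θ * d + B) * D.cellDiam K * (θ * D.dist K σ)) := by
          gcongr
          exact D.cellDiam_le hθ hσ
      _ = _ := by field_simp
  calc ‖D.gradCone (D.interp φ) K σ - gradient φ x‖
      = ‖(G - g) + D.stab (D.interp φ) K σ • D.normal K σ + (g - gradient φ x)‖ := by
        rw [gradCone]; congr 1; abel
    _ ≤ ‖G - g‖ + ‖D.stab (D.interp φ) K σ • D.normal K σ‖ + ‖g - gradient φ x‖ :=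
        norm_add₃_le
    _ ≤ B * θ * d * D.cellDiam K + √(d : ℝ) * θ * (B * θ * d + B) * D.cellDiam K +
        B * D.cellDiam K := by
        rw [norm_smul, D.norm_normal hσ, mul_one, Real.norm_eq_abs]
        gcongr
    _ = B * (θ * d + √(d : ℝ) * θ * (θ * d + 1) + 1) * D.cellDiam K := by ring
    _ ≤ _ := by
        gcongr
        exact D.cellDiam_le_size K

/-! ### Discrete integration by parts. -/

theorem setIntegral_cell_smul_grad (hd : 0 < d) (hΩb : Bornology.IsBounded Ω)
    (hφ : Continuous φ) (w : D.X) (K : D.Cell) :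
    ∫ x in D.cell K, φ x • D.grad w x =
      ∑ σ ∈ D.edgesOf K, (∫ x in D.cone K σ, φ x) • D.gradCone w K σ := by
  have heq : ∀ σ ∈ D.edgesOf K, Set.EqOn (fun x => φ x • D.gradCone w K σ)
      (fun x => φ x • D.grad w x) (D.cone K σ) := by
    intro σ hσ x hx
    simp only [D.grad_of_mem_cone w hσ hx]
  rw [D.setIntegral_cell_eq_sum hd hΩb K]
  · refine Finset.sum_congr rfl fun σ hσ => ?_
    rw [← setIntegral_congr_fun (D.measurableSet_cone hσ) (heq σ hσ), integral_smul_const]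
  · exact fun σ hσ => IntegrableOn.congr_fun
      ((D.integrableOn_cone_of_continuous hΩb hσ hφ).smul_const (D.gradCone w K σ)) (heq σ hσ) (D.measurableSet_cone hσ)

/-- If `φ` is replaced by `φ(x_K)`, the two expressions agree, because the mean of the discrete
gradient over the cell is `∇_K w`. What remains carries the oscillation of `φ`, at most `B h_K`. -/
theorem norm_setIntegral_cell_smul_grad_sub_le (hd : 0 < d) (hΩb : Bornology.IsBounded Ω)
    (hφ : IsSmoothBound φ B) (hφc : Continuous φ) (w : D.X) (K : D.Cell) :
    ‖(∫ x in D.cell K, φ x • D.grad w x) -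
      ∑ σ ∈ D.edgesOf K, (D.edgeVol σ * (w.2 σ - w.1 K) * φ (D.bary σ)) • D.normal K σ‖ ≤
      B * D.cellDiam K * (∑ σ ∈ D.edgesOf K, volume.real (D.cone K σ) * ‖D.gradCone w K σ‖ +
        ∑ σ ∈ D.edgesOf K, D.edgeVol σ * |w.2 σ - w.1 K|) := by
  have hB := hφ.nonneg
  have hmean : ∑ σ ∈ D.edgesOf K, (φ (D.center K) * volume.real (D.cone K σ)) • D.gradCone w K σ =
      ∑ σ ∈ D.edgesOf K,
        (φ (D.center K) * (D.edgeVol σ * (w.2 σ - w.1 K))) • D.normal K σ := by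
    simp only [mul_smul _ (volume.real _)]
    simp only [mul_smul (φ (D.center K)) (_ * _)]
    rw [← Finset.smul_sum, ← Finset.smul_sum, D.sum_volume_smul_gradCone hd hΩb,
      D.cellVol_smul_gradCell hΩb]
  have hsplit : (∫ x in D.cell K, φ x • D.grad w x) -
      ∑ σ ∈ D.edgesOf K, (D.edgeVol σ * (w.2 σ - w.1 K) * φ (D.bary σ)) • D.normal K σ =
      ∑ σ ∈ D.edgesOf K, (∫ x in D.cone K σ, (φ x - φ (D.center K))) • D.gradCone w K σ -
      ∑ σ ∈ D.edgesOf K, (D.edgeVol σ * (w.2 σ - w.1 K) * (φ (D.bary σ) - φ (D.center K))) •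
        D.normal K σ := by
    have e1 : ∑ σ ∈ D.edgesOf K,
        (∫ x in D.cone K σ, (φ x - φ (D.center K))) • D.gradCone w K σ =
        (∫ x in D.cell K, φ x • D.grad w x) -
        ∑ σ ∈ D.edgesOf K, (φ (D.center K) * volume.real (D.cone K σ)) • D.gradCone w K σ := by
      rw [D.setIntegral_cell_smul_grad hd hΩb hφc, ← Finset.sum_sub_distrib]
      refine Finset.sum_congr rfl fun σ hσ => ?_
      have hone : Integrable (fun _ : Pt d => φ (D.center K)) (volume.restrict (D.cone K σ)) :=
        integrableOn_const (D.volume_cone_lt_top hΩb hσ).ne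
      rw [integral_sub (D.integrableOn_cone_of_continuous hΩb hσ hφc) hone, setIntegral_const,
        smul_eq_mul, mul_comm (volume.real _), sub_smul]
    have e2 : ∑ σ ∈ D.edgesOf K,
        (D.edgeVol σ * (w.2 σ - w.1 K) * (φ (D.bary σ) - φ (D.center K))) • D.normal K σ =
        ∑ σ ∈ D.edgesOf K, (D.edgeVol σ * (w.2 σ - w.1 K) * φ (D.bary σ)) • D.normal K σ -
        ∑ σ ∈ D.edgesOf K,
          (φ (D.center K) * (D.edgeVol σ * (w.2 σ - w.1 K))) • D.normal K σ := by
      rw [← Finset.sum_sub_distrib]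
      refine Finset.sum_congr rfl fun σ _ => ?_
      rw [← sub_smul]; congr 1; ring
    rw [e1, e2, hmean]
    abel
  rw [hsplit, mul_add]
  refine (norm_sub_le _ _).trans (add_le_add ?_ ?_)
  · refine (norm_sum_le _ _).trans ?_
    rw [Finset.mul_sum]
    refine Finset.sum_le_sum fun σ hσ => ?_
    rw [norm_smul, ← mul_assoc]
    gcongr
    refine norm_setIntegral_le_of_norm_le_const (D.volume_cone_lt_top hΩb hσ) fun x hx => ?_
    refine (hφ.abs_sub_le _ _).trans ?_
    gcongr
    exact D.norm_sub_center_le_of_mem_cone hΩb hσ hx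
  · refine (norm_sum_le _ _).trans ?_
    rw [Finset.mul_sum]
    refine Finset.sum_le_sum fun σ hσ => ?_
    have hm := D.edgeVol_pos hd hΩb hσ
    rw [norm_smul, D.norm_normal hσ, mul_one, norm_mul, norm_mul, Real.norm_of_nonneg hm.le,
      Real.norm_eq_abs, Real.norm_eq_abs, mul_comm]
    gcongr
    refine (hφ.abs_sub_le _ _).trans ?_
    gcongr
    exact D.norm_bary_sub_center_le hd hΩb hσ

/-- A one-point quadrature of the divergence theorem: in the expansion of `φ` at `x_K`, the constant
term is removed by `sum_edgeVol_smul_normal` and the linear term yields `|K| ∇φ(x_K)`. -/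
theorem norm_sum_bary_smul_normal_sub_le (hd : 0 < d) (hΩb : Bornology.IsBounded Ω)
    (hθ : D.theta ≤ θ) (hφ : IsSmoothBound φ B) (hφc : Continuous (gradient φ)) (K : D.Cell) :
    ‖∑ σ ∈ D.edgesOf K, (D.edgeVol σ * φ (D.bary σ)) • D.normal K σ -
      ∫ x in D.cell K, gradient φ x‖ ≤ B * (θ * d + 1) * D.cellDiam K * D.cellVol K := by
  have hB := hφ.nonneg
  have h1 := D.norm_sum_smul_normal_le hd hΩb hθ hB K
    fun σ hσ => D.abs_taylor_bary_le hd hΩb hφ hσ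
  have h2 : ∑ σ ∈ D.edgesOf K, (D.edgeVol σ * (φ (D.bary σ) - φ (D.center K) -
      inner ℝ (gradient φ (D.center K)) (D.bary σ - D.center K))) • D.normal K σ =
      ∑ σ ∈ D.edgesOf K, (D.edgeVol σ * φ (D.bary σ)) • D.normal K σ -
        D.cellVol K • gradient φ (D.center K) := by
    have h3 : φ (D.center K) • ∑ σ ∈ D.edgesOf K, D.edgeVol σ • D.normal K σ = 0 := by
      rw [D.sum_edgeVol_smul_normal hd hΩb, smul_zero]
    rw [← D.sum_inner_bary_smul_normal hd hΩb,
      ← sub_zero (∑ σ ∈ D.edgesOf K, (D.edgeVol σ * φ (D.bary σ)) • D.normal K σ), ← h3,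
      Finset.smul_sum, ← Finset.sum_sub_distrib, ← Finset.sum_sub_distrib]
    refine Finset.sum_congr rfl fun σ _ => ?_
    rw [smul_smul, ← sub_smul, ← sub_smul]
    congr 1; ring
  have hint : IntegrableOn (gradient φ) (D.cell K) :=
    (hφc.continuousOn.integrableOn_compact (D.isBounded_cell hΩb K).isCompact_closure).mono_set
      subset_closure
  have hone : Integrable (fun _ : Pt d => gradient φ (D.center K))
      (volume.restrict (D.cell K)) := integrableOn_const (D.volume_cell_lt_top hΩb K).ne
  have h4 : D.cellVol K • gradient φ (D.center K) - ∫ x in D.cell K, gradient φ x =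
      ∫ x in D.cell K, (gradient φ (D.center K) - gradient φ x) := by
    rw [integral_sub hone hint, setIntegral_const, cellVol]
  have h5 : ‖D.cellVol K • gradient φ (D.center K) - ∫ x in D.cell K, gradient φ x‖ ≤
      B * D.cellDiam K * D.cellVol K := by
    rw [h4]
    refine norm_setIntegral_le_of_norm_le_const (D.volume_cell_lt_top hΩb K) fun x hx => ?_
    refine (hφ.norm_gradient_sub_le _ _).trans ?_
    rw [norm_sub_rev]
    gcongr
    exact D.norm_sub_center_le hΩb (subset_closure hx)
  rw [h2] at h1
  refine (norm_sub_le_norm_sub_add_norm_sub _ (D.cellVol K • gradient φ (D.center K)) _).trans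
    ((add_le_add h1 h5).trans (le_of_eq (by ring)))

/-- Edge contributions cancel for unknowns that vanish on the boundary interfaces. -/
theorem sum_edge_smul_normal_eq_zero {w : D.X} (hw : D.MemX0 w) (f : D.Edge → ℝ) :
    ∑ K, ∑ σ ∈ D.edgesOf K, (f σ * w.2 σ) • D.normal K σ = 0 := by
  rw [Finset.sum_comm' (s' := D.cellsOf) (t' := Finset.univ) (by simp [cellsOf])]
  refine Finset.sum_eq_zero fun σ _ => ?_
  rw [← Finset.smul_sum]
  rcases D.edge_cells σ with h | h
  · rw [hw σ h.1, mul_zero, zero_smul]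
  · obtain ⟨K, L, hKL, hc⟩ := Finset.card_eq_two.1 h
    have hK : σ ∈ D.edgesOf K := by
      have : K ∈ D.cellsOf σ := by rw [cellsOf, hc]; simp
      simpa [cellsOf] using this
    have hL : σ ∈ D.edgesOf L := by
      have : L ∈ D.cellsOf σ := by rw [cellsOf, hc]; simp
      simpa [cellsOf] using this
    rw [cellsOf, hc, Finset.sum_pair hKL, D.normal_eq_neg hKL hK hL, add_neg_cancel, smul_zero]

theorem proj_of_mem_cell (w : D.X) {K : D.Cell} {x : Pt d} (hx : x ∈ D.cell K) :
    D.proj w x = w.1 K := by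
  rw [proj, Finset.sum_eq_single K, Set.indicator_of_mem hx]
  · exact fun L _ h => Set.indicator_of_notMem
      (fun hx' => Set.disjoint_left.1 (D.cell_disjoint h) hx' hx) _
  · exact fun h => absurd (Finset.mem_univ _) h

theorem integrableOn_proj (hΩb : Bornology.IsBounded Ω) (w : D.X) :
    IntegrableOn (D.proj w) Ω := by
  refine integrable_finsetSum _ fun K _ => ?_
  exact ((integrableOn_const hΩb.measure_lt_top.ne).indicator (D.cell_isOpen K).measurableSet)

theorem setIntegral_abs_proj (hΩb : Bornology.IsBounded Ω) (w : D.X) :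
    ∫ x in Ω, |D.proj w x| = ∑ K, |w.1 K| * D.cellVol K := by
  rw [D.setIntegral_eq_sum_cell
    fun K => ((D.integrableOn_proj hΩb w).mono_set (D.cell_subset K)).abs]
  refine Finset.sum_congr rfl fun K _ => ?_
  rw [setIntegral_congr_fun (g := fun _ => |w.1 K|) (D.cell_isOpen K).measurableSet
    fun x hx => by simp only [D.proj_of_mem_cell w hx], setIntegral_const, smul_eq_mul, mul_comm]
  rfl

theorem setIntegral_proj_smul (hΩb : Bornology.IsBounded Ω) (w : D.X) {g : Pt d → Pt d}
    (hg : Continuous g) :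
    ∫ x in Ω, D.proj w x • g x = ∑ K, w.1 K • ∫ x in D.cell K, g x := by
  have heq : ∀ K, Set.EqOn (fun x => w.1 K • g x) (fun x => D.proj w x • g x) (D.cell K) := by
    intro K x hx
    simp only [D.proj_of_mem_cell w hx]
  have hint : ∀ K, IntegrableOn g (D.cell K) := fun K =>
    (hg.continuousOn.integrableOn_compact (D.isBounded_cell hΩb K).isCompact_closure).mono_set
      subset_closure
  rw [D.setIntegral_eq_sum_cell fun K => IntegrableOn.congr_fun ((hint K).smul (w.1 K)) (heq K)
    (D.cell_isOpen K).measurableSet]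
  refine Finset.sum_congr rfl fun K _ => ?_
  rw [← setIntegral_congr_fun (D.cell_isOpen K).measurableSet (heq K), integral_smul]

/-- The elementary bound `t ≤ 1 + t²` suffices, since this quantity is always multiplied by the mesh
size and only has to stay bounded. The next lemma uses `t ≤ d_{K,σ} + t² / d_{K,σ}` in the same way.
-/
theorem sum_volume_mul_norm_gradCone_le (hd : 0 < d) (hΩb : Bornology.IsBounded Ω)
    (hθ : D.theta ≤ θ) (w : D.X) :
    ∑ K, ∑ σ ∈ D.edgesOf K, volume.real (D.cone K σ) * ‖D.gradCone w K σ‖ ≤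
      volume.real Ω + (d + 2 + 2 * θ ^ 2 * d ^ 2) * D.seminormX w ^ 2 := by
  refine le_trans ?_ (add_le_add_right (D.sum_gradEnergy_le hd hΩb hθ w) _)
  rw [← D.sum_cellVol hΩb, ← Finset.sum_add_distrib]
  refine Finset.sum_le_sum fun K _ => ?_
  rw [← D.sum_volume_real_cone hd hΩb, gradEnergy, ← Finset.sum_add_distrib]
  refine Finset.sum_le_sum fun σ _ => ?_
  have : 0 ≤ volume.real (D.cone K σ) := measureReal_nonneg
  nlinarith [sq_nonneg (‖D.gradCone w K σ‖ - 1), mul_nonneg this (sq_nonneg (‖D.gradCone w K σ‖ - 1)),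
    mul_nonneg this (sq_nonneg (‖D.gradCone w K σ‖)), norm_nonneg (D.gradCone w K σ)]

theorem sum_edgeVol_mul_abs_le (hd : 0 < d) (hΩb : Bornology.IsBounded Ω) (w : D.X) :
    ∑ K, ∑ σ ∈ D.edgesOf K, D.edgeVol σ * |w.2 σ - w.1 K| ≤
      d * volume.real Ω + D.seminormX w ^ 2 := by
  rw [← D.sum_cellVol hΩb, D.seminormX_sq hd hΩb, Finset.mul_sum, ← Finset.sum_add_distrib]
  refine Finset.sum_le_sum fun K _ => ?_
  rw [← D.sum_edgeVol_mul_dist hd hΩb, cellEnergy, ← Finset.sum_add_distrib]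
  refine Finset.sum_le_sum fun σ hσ => ?_
  have hδ := D.dist_pos hσ
  have hm := D.edgeVol_pos hd hΩb hσ
  have h1 : |w.2 σ - w.1 K| ≤ D.dist K σ + |w.2 σ - w.1 K| ^ 2 / D.dist K σ := by
    rw [← sub_nonneg]
    have : D.dist K σ + |w.2 σ - w.1 K| ^ 2 / D.dist K σ - |w.2 σ - w.1 K| =
        (D.dist K σ ^ 2 + |w.2 σ - w.1 K| ^ 2 - |w.2 σ - w.1 K| * D.dist K σ) / D.dist K σ := by
      field_simp
    rw [this]
    refine div_nonneg ?_ hδ.le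
    nlinarith [sq_nonneg (D.dist K σ - |w.2 σ - w.1 K|), sq_nonneg (D.dist K σ),
      sq_nonneg |w.2 σ - w.1 K|]
  calc _ ≤ D.edgeVol σ * (D.dist K σ + |w.2 σ - w.1 K| ^ 2 / D.dist K σ) := by gcongr
    _ = _ := by rw [sq_abs]; ring

/-- Discrete integration by parts, up to an error of the order of the mesh size. -/
theorem norm_setIntegral_smul_grad_add_le (hd : 0 < d) (hΩb : Bornology.IsBounded Ω)
    (hθ0 : 0 ≤ θ) (hθ : D.theta ≤ θ) (hφ : IsSmoothBound φ B) (hφ' : ContDiff ℝ ∞ φ) {w : D.X}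
    (hw : D.MemX0 w) :
    ‖(∫ x in Ω, φ x • D.grad w x) + ∫ x in Ω, D.proj w x • gradient φ x‖ ≤
      B * D.size * ((1 + d) * volume.real Ω + (d + 3 + 2 * θ ^ 2 * d ^ 2) * D.seminormX w ^ 2 +
        (θ * d + 1) * ∫ x in Ω, |D.proj w x|) := by
  have hB := hφ.nonneg
  have hgc := continuous_gradient hφ'
  have hφc := hφ'.continuous
  have hint : ∀ K, IntegrableOn (fun x => φ x • D.grad w x) (D.cell K) := fun K =>
    D.integrableOn_cell_of_cone hd hΩb fun σ hσ =>
      IntegrableOn.congr_fun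
        ((D.integrableOn_cone_of_continuous hΩb hσ hφc).smul_const (D.gradCone w K σ))
        (fun x hx => by simp only [D.grad_of_mem_cone w hσ hx]) (D.measurableSet_cone hσ)
  have hzero := D.sum_edge_smul_normal_eq_zero hw fun σ => D.edgeVol σ * φ (D.bary σ)
  -- Subtracting the vanishing sum `hzero` turns the differences `w_σ - w_K` into `-w_K`; the total
  -- is then a sum over the cells of the two local errors estimated above.
  have hsplit : (∫ x in Ω, φ x • D.grad w x) + ∫ x in Ω, D.proj w x • gradient φ x =
      ∑ K, (((∫ x in D.cell K, φ x • D.grad w x) - ∑ σ ∈ D.edgesOf K,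
        (D.edgeVol σ * (w.2 σ - w.1 K) * φ (D.bary σ)) • D.normal K σ) -
        w.1 K • (∑ σ ∈ D.edgesOf K, (D.edgeVol σ * φ (D.bary σ)) • D.normal K σ -
          ∫ x in D.cell K, gradient φ x)) := by
    rw [D.setIntegral_eq_sum_cell hint, D.setIntegral_proj_smul hΩb w hgc,
      ← add_zero (_ + _), ← neg_zero, ← hzero, ← sub_eq_add_neg, ← Finset.sum_add_distrib,
      ← Finset.sum_sub_distrib]
    refine Finset.sum_congr rfl fun K _ => ?_
    have : ∑ σ ∈ D.edgesOf K, (D.edgeVol σ * φ (D.bary σ) * w.2 σ) • D.normal K σ =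
        ∑ σ ∈ D.edgesOf K, (D.edgeVol σ * (w.2 σ - w.1 K) * φ (D.bary σ)) • D.normal K σ +
        w.1 K • ∑ σ ∈ D.edgesOf K, (D.edgeVol σ * φ (D.bary σ)) • D.normal K σ := by
      rw [Finset.smul_sum, ← Finset.sum_add_distrib]
      refine Finset.sum_congr rfl fun σ _ => ?_
      rw [smul_smul, ← add_smul]
      congr 1; ring
    rw [this, smul_sub]
    abel
  have h1 : ‖(∫ x in Ω, φ x • D.grad w x) + ∫ x in Ω, D.proj w x • gradient φ x‖ ≤
      ∑ K, (B * D.size * (∑ σ ∈ D.edgesOf K, volume.real (D.cone K σ) * ‖D.gradCone w K σ‖ +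
        ∑ σ ∈ D.edgesOf K, D.edgeVol σ * |w.2 σ - w.1 K|) +
        B * (θ * d + 1) * D.size * (|w.1 K| * D.cellVol K)) := by
    rw [hsplit]
    refine (norm_sum_le _ _).trans (Finset.sum_le_sum fun K _ => ?_)
    have hV := (D.cellVol_pos hΩb K).le
    refine (norm_sub_le _ _).trans (add_le_add ?_ ?_)
    · refine (D.norm_setIntegral_cell_smul_grad_sub_le hd hΩb hφ hφc w K).trans ?_
      have h0 : 0 ≤ ∑ σ ∈ D.edgesOf K, volume.real (D.cone K σ) * ‖D.gradCone w K σ‖ +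
          ∑ σ ∈ D.edgesOf K, D.edgeVol σ * |w.2 σ - w.1 K| :=
        add_nonneg (Finset.sum_nonneg fun σ _ => by positivity)
          (Finset.sum_nonneg fun σ hσ => mul_nonneg (D.edgeVol_pos hd hΩb hσ).le (abs_nonneg _))
      gcongr
      exact D.cellDiam_le_size K
    · rw [norm_smul, Real.norm_eq_abs]
      calc _ ≤ |w.1 K| * (B * (θ * d + 1) * D.cellDiam K * D.cellVol K) := by
            gcongr
            exact D.norm_sum_bary_smul_normal_sub_le hd hΩb hθ hφ hgc K
        _ ≤ |w.1 K| * (B * (θ * d + 1) * D.size * D.cellVol K) := by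
            gcongr
            exact D.cellDiam_le_size K
        _ = _ := by ring
  refine h1.trans ?_
  rw [Finset.sum_add_distrib, ← Finset.mul_sum, ← Finset.mul_sum, Finset.sum_add_distrib,
    ← D.setIntegral_abs_proj hΩb]
  have h2 := D.sum_volume_mul_norm_gradCone_le hd hΩb hθ w
  have h3 := D.sum_edgeVol_mul_abs_le hd hΩb w
  have h4 : 0 ≤ B * D.size := mul_nonneg hB D.size_nonneg
  have h5 := mul_le_mul_of_nonneg_left (add_le_add h2 h3) h4
  refine (add_le_add_left h5 _).trans (le_of_eq (by ring))

end Discretisation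

/-! ### Weak limits, and the error from interpolating the test function. -/

/-- Along an ultrafilter, a bounded family in `L²` has a weak limit. -/
theorem exists_weak_limit {d : ℕ} {ι : Type*} (U : Ultrafilter ι) {g : ι → Pt d → Pt d}
    (hg : ∀ i, MemLp (g i) 2) {C : ℝ} (hC : ∀ i, ∫ x, ‖g i x‖ ^ 2 ≤ C) :
    ∃ G : Pt d → Pt d, MemLp G 2 ∧ ∀ F : Pt d → Pt d, MemLp F 2 →
      Tendsto (fun i => ∫ x, inner ℝ (F x) (g i x)) U (𝓝 (∫ x, inner ℝ (F x) (G x))) := by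
  set γ : ι → Lp (Pt d) 2 (volume : Measure (Pt d)) := fun i => (hg i).toLp (g i) with hγ
  have hnorm : ∀ i, ‖γ i‖ ≤ √C := by
    intro i
    refine Real.le_sqrt_of_sq_le ?_
    refine le_trans (le_of_eq ?_) (hC i)
    rw [← real_inner_self_eq_norm_sq, L2.inner_def]
    refine integral_congr_ae ?_
    filter_upwards [(hg i).coeFn_toLp] with x hx
    rw [hγ, real_inner_self_eq_norm_sq]
    simp only [hx]
  set f : ι → WeakDual ℝ (Lp (Pt d) 2 (volume : Measure (Pt d))) := fun i =>
    StrongDual.toWeakDual (InnerProductSpace.toDual ℝ _ (γ i)) with hf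
  have hcomp := WeakDual.isCompact_closedBall (𝕜 := ℝ)
    (0 : StrongDual ℝ (Lp (Pt d) 2 (volume : Measure (Pt d)))) (√C)
  -- Banach–Alaoglu in the dual of `L²`: an ultrafilter containing a compact set converges, so no
  -- subsequence is extracted. The Riesz isometry then represents the limit by a field.
  obtain ⟨L, -, hL⟩ := hcomp.ultrafilter_le_nhds (U.map f) (by
    rw [Ultrafilter.coe_map, le_principal_iff, mem_map]
    refine univ_mem' fun i => ?_
    simp only [Set.mem_preimage, Metric.mem_closedBall, dist_zero_right]
    refine le_trans (le_of_eq ?_) (hnorm i)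
    exact (InnerProductSpace.toDual ℝ _).norm_map (γ i))
  set Γ : Lp (Pt d) 2 (volume : Measure (Pt d)) :=
    (InnerProductSpace.toDual ℝ _).symm (WeakDual.toStrongDual L) with hΓ
  refine ⟨Γ, Lp.memLp Γ, fun F hF => ?_⟩
  have hLF : Tendsto (fun i => f i (hF.toLp F)) U (𝓝 (L (hF.toLp F))) :=
    ((WeakDual.eval_continuous (hF.toLp F)).tendsto L).comp hL
  have h1 : ∀ i, f i (hF.toLp F) = ∫ x, inner ℝ (F x) (g i x) := by
    intro i
    have : f i (hF.toLp F) = inner ℝ (γ i) (hF.toLp F) := rfl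
    rw [this, L2.inner_def]
    refine integral_congr_ae ?_
    filter_upwards [(hg i).coeFn_toLp, hF.coeFn_toLp] with x hx hx'
    rw [real_inner_comm, hγ]
    simp only [hx, hx']
  have h2 : L (hF.toLp F) = ∫ x, inner ℝ (F x) (Γ x) := by
    have : L (hF.toLp F) = inner ℝ Γ (hF.toLp F) := by
      rw [hΓ, InnerProductSpace.toDual_symm_apply]; rfl
    rw [this, L2.inner_def]
    refine integral_congr_ae ?_
    filter_upwards [hF.coeFn_toLp] with x hx'
    rw [real_inner_comm]
    simp only [hx']
  simp only [h1, h2] at hLF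
  exact hLF

theorem integrableOn_of_memLp_two {d : ℕ} {E : Type*} [NormedAddCommGroup E] {Ω : Set (Pt d)}
    (hΩb : Bornology.IsBounded Ω) {f : Pt d → E} (hf : MemLp f 2 (volume.restrict Ω)) :
    IntegrableOn f Ω := by
  have : IsFiniteMeasure (volume.restrict Ω) :=
    ⟨by rw [Measure.restrict_apply_univ]; exact hΩb.measure_lt_top⟩
  exact hf.integrable (by norm_num)

/-- On a bounded set, convergence in `L²` implies convergence in `L¹`. -/
theorem tendsto_setIntegral_abs_of_eLpNorm {d : ℕ} {Ω : Set (Pt d)}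
    (hΩb : Bornology.IsBounded Ω) {ι : Type*} {l : Filter ι} {f : ι → Pt d → ℝ}
    (hf : ∀ i, AEStronglyMeasurable (f i) (volume.restrict Ω))
    (h : Tendsto (fun i => eLpNorm (f i) 2 (volume.restrict Ω)) l (𝓝 0)) :
    Tendsto (fun i => ∫ x in Ω, |f i x|) l (𝓝 0) := by
  have hfin : volume.restrict Ω Set.univ ≠ ⊤ := by
    rw [Measure.restrict_apply_univ]; exact hΩb.measure_lt_top.ne
  have h1 : Tendsto (fun i => eLpNorm (f i) 1 (volume.restrict Ω)) l (𝓝 0) := by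
    set c := volume.restrict Ω Set.univ ^ (1 / (1 : ENNReal).toReal - 1 / (2 : ENNReal).toReal)
      with hc
    have hct : c ≠ ⊤ := ENNReal.rpow_ne_top_of_nonneg (by norm_num) hfin
    have h2 : Tendsto (fun i => eLpNorm (f i) 2 (volume.restrict Ω) * c) l (𝓝 0) := by
      have := ENNReal.Tendsto.mul_const h (Or.inr hct)
      rwa [zero_mul] at this
    exact tendsto_of_tendsto_of_tendsto_of_le_of_le tendsto_const_nhds h2 (fun _ => zero_le)
      fun i => eLpNorm_le_eLpNorm_mul_rpow_measure_univ (by norm_num) (hf i)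
  have h3 := (ENNReal.tendsto_toReal ENNReal.zero_ne_top).comp h1
  rw [ENNReal.toReal_zero] at h3
  refine h3.congr fun i => ?_
  simp only [Function.comp, eLpNorm_one_eq_lintegral_enorm]
  rw [← integral_norm_eq_lintegral_enorm (hf i)]
  rfl

namespace Discretisation

variable {d : ℕ} {Ω : Set (Pt d)} (D : Discretisation d Ω)

theorem memLp_grad (hΩb : Bornology.IsBounded Ω) (u : D.X) : MemLp (D.grad u) 2 := by
  refine memLp_finsetSum _ fun K _ => memLp_finsetSum _ fun σ hσ => ?_
  exact memLp_indicator_const 2 (D.measurableSet_cone hσ) _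
    (Or.inr (D.volume_cone_lt_top hΩb hσ).ne)

theorem integral_norm_grad_sq_le (hd : 0 < d) (hΩb : Bornology.IsBounded Ω) {θ : ℝ}
    (hθ : D.theta ≤ θ) (u : D.X) :
    ∫ x, ‖D.grad u x‖ ^ 2 ≤ (d + 2 + 2 * θ ^ 2 * d ^ 2) * D.seminormX u ^ 2 := by
  refine le_trans (le_of_eq ?_) (D.sum_gradEnergy_le hd hΩb hθ u)
  rw [← setIntegral_eq_integral_of_forall_compl_eq_zero (s := Ω)
    (fun x hx => by rw [D.grad_of_notMem u hx]; simp)]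
  have heq : ∀ K, ∀ σ ∈ D.edgesOf K, Set.EqOn (fun _ => ‖D.gradCone u K σ‖ ^ 2)
      (fun x => ‖D.grad u x‖ ^ 2) (D.cone K σ) :=
    fun K σ hσ x hx => by simp only [D.grad_of_mem_cone u hσ hx]
  rw [D.setIntegral_eq_sum_cone hd hΩb fun K σ hσ => IntegrableOn.congr_fun
    (integrableOn_const (D.volume_cone_lt_top hΩb hσ).ne) (heq K σ hσ) (D.measurableSet_cone hσ)]
  refine Finset.sum_congr rfl fun K _ => Finset.sum_congr rfl fun σ hσ => ?_
  rw [← setIntegral_congr_fun (D.measurableSet_cone hσ) (heq K σ hσ), setIntegral_const,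
    smul_eq_mul]

/-- Replacing the discrete gradient of an interpolant by the exact gradient changes the bilinear
form by a quantity of the order of the mesh size. -/
theorem abs_form_interp_sub_le {lo hi : ℝ} {Λ : Pt d → Matrix (Fin d) (Fin d) ℝ}
    {φ : Pt d → ℝ} {B θ : ℝ}
    (hd : 0 < d) (hΛ : IsDiffusionField Ω lo hi Λ) (hlo : 0 ≤ lo)
    (hlohi : lo ≤ hi) (hΩo : IsOpen Ω) (hΩb : Bornology.IsBounded Ω) (hθ0 : 0 ≤ θ)
    (hθ : D.theta ≤ θ) (hφ : IsSmoothBound φ B) (hφc : Continuous (gradient φ)) (w : D.X) :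
    |D.form (D.sushiFlux Λ) w (D.interp φ) -
      ∫ x in Ω, inner ℝ (Matrix.toEuclideanLin (Λ x) (gradient φ x)) (D.grad w x)| ≤
      hi * (B * (θ * d + √(d : ℝ) * θ * (θ * d + 1) + 1) * D.size) *
        (volume.real Ω + (d + 2 + 2 * θ ^ 2 * d ^ 2) * D.seminormX w ^ 2) := by
  have hB := hφ.nonneg
  have hhi : 0 ≤ hi := hlo.trans hlohi
  set ε := B * (θ * d + √(d : ℝ) * θ * (θ * d + 1) + 1) * D.size with hε
  have hε0 : 0 ≤ ε := mul_nonneg (by positivity) D.size_nonneg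
  have hmeas : ∀ K, ∀ σ ∈ D.edgesOf K, AEStronglyMeasurable
      (fun x => inner ℝ (Matrix.toEuclideanLin (Λ x) (gradient φ x)) (D.gradCone w K σ))
      (volume.restrict (D.cone K σ)) := fun K σ hσ =>
    ((hΛ.aestronglyMeasurable_apply hΩo.measurableSet
      hφc.aestronglyMeasurable).mono_measure (Measure.restrict_mono_set _ (D.cone_subset hσ))).inner
      aestronglyMeasurable_const
  have hint : ∀ K, ∀ σ ∈ D.edgesOf K, IntegrableOn
      (fun x => inner ℝ (Matrix.toEuclideanLin (Λ x) (gradient φ x)) (D.gradCone w K σ))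
      (D.cone K σ) := by
    intro K σ hσ
    have : IsFiniteMeasure (volume.restrict (D.cone K σ)) :=
      ⟨by rw [Measure.restrict_apply_univ]; exact D.volume_cone_lt_top hΩb hσ⟩
    refine Integrable.of_bound (C := hi * B * ‖D.gradCone w K σ‖) (hmeas K σ hσ) ?_
    filter_upwards [D.ae_cone (hΛ.ae_norm_le hlo hlohi) hσ] with x hx
    refine (norm_inner_le_norm _ _).trans ?_
    gcongr
    refine (hx _).trans ?_
    gcongr
    exact hφ.norm_gradient_le x
  have heq : ∀ K, ∀ σ ∈ D.edgesOf K, Set.EqOn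
      (fun x => inner ℝ (Matrix.toEuclideanLin (Λ x) (gradient φ x)) (D.gradCone w K σ))
      (fun x => inner ℝ (Matrix.toEuclideanLin (Λ x) (gradient φ x)) (D.grad w x))
      (D.cone K σ) := fun K σ hσ x hx => by simp only [D.grad_of_mem_cone w hσ hx]
  rw [D.form_sushiFlux_eq_sum hΛ hlo hlohi hΩo hΩb, D.setIntegral_eq_sum_cone hd hΩb
    fun K σ hσ => (hint K σ hσ).congr_fun (heq K σ hσ) (D.measurableSet_cone hσ),
    ← Finset.sum_sub_distrib]
  refine le_trans ?_ (mul_le_mul_of_nonneg_left (D.sum_volume_mul_norm_gradCone_le hd hΩb hθ w)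
    (mul_nonneg hhi hε0))
  rw [Finset.mul_sum]
  refine (Finset.abs_sum_le_sum_abs _ _).trans (Finset.sum_le_sum fun K _ => ?_)
  rw [← Finset.sum_sub_distrib, Finset.mul_sum]
  refine (Finset.abs_sum_le_sum_abs _ _).trans (Finset.sum_le_sum fun σ hσ => ?_)
  rw [← setIntegral_congr_fun (D.measurableSet_cone hσ) (heq K σ hσ),
    ← integral_sub (D.integrableOn_cone_inner hΛ hlo hlohi hΩo hΩb hσ _ _) (hint K σ hσ),
    ← Real.norm_eq_abs]
  refine (norm_setIntegral_le_of_norm_le_const_ae (C := hi * ε * ‖D.gradCone w K σ‖)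
    (D.volume_cone_lt_top hΩb hσ) ?_).trans (le_of_eq (by ring))
  filter_upwards [D.ae_cone (hΛ.ae_norm_le hlo hlohi) hσ,
    ae_restrict_mem (D.measurableSet_cone hσ)] with x hx hxc
  rw [real_inner_comm, ← inner_sub_left, ← map_sub]
  refine (norm_inner_le_norm _ _).trans ?_
  gcongr
  refine (hx _).trans ?_
  gcongr
  exact D.norm_gradCone_interp_sub_le hd hΩb hθ0 hθ hφ hσ hxc

end Discretisation

/-! ### Passage to the limit. -/

section Consistency

variable {d : ℕ} {Ω : Set (Pt d)} {ι : Type*} {D : ι → Discretisation d Ω} {θ C : ℝ}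
  {w : ∀ i, (D i).X} {u : Pt d → ℝ}

theorem tendsto_size : Tendsto (fun i => (D i).size) (sizeToZero D) (𝓝 0) := tendsto_comap

/-- The discrete gradients converge to the gradient of the limit in the sense of distributions. -/
theorem tendsto_setIntegral_smul_grad (hd : 0 < d) (hΩb : Bornology.IsBounded Ω) (hθ : 0 ≤ θ)
    (hD : ∀ i, (D i).theta ≤ θ) (hw : ∀ i, (D i).MemX0 (w i))
    (hC : ∀ i, (D i).seminormX (w i) ≤ C) (hu : MemLp u 2 (volume.restrict Ω))
    (hlim : Tendsto (fun i => eLpNorm (fun x => (D i).proj (w i) x - u x) 2 (volume.restrict Ω))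
      (sizeToZero D) (𝓝 0)) {φ : Pt d → ℝ} (hφ : ContDiff ℝ ∞ φ) (hφc : HasCompactSupport φ) :
    Tendsto (fun i => ∫ x in Ω, φ x • (D i).grad (w i) x) (sizeToZero D)
      (𝓝 (-∫ x in Ω, u x • gradient φ x)) := by
  obtain ⟨B, hB⟩ := exists_isSmoothBound hφ hφc
  have hB0 := hB.nonneg
  have hgc := continuous_gradient hφ
  have hui := integrableOn_of_memLp_two hΩb hu
  have hpi : ∀ i, IntegrableOn (fun x => (D i).proj (w i) x - u x) Ω :=
    fun i => ((D i).integrableOn_proj hΩb (w i)).sub hui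
  set J : ι → ℝ := fun i => ∫ x in Ω, |(D i).proj (w i) x - u x| with hJ
  have hJ0 : Tendsto J (sizeToZero D) (𝓝 0) :=
    tendsto_setIntegral_abs_of_eLpNorm hΩb (fun i => (hpi i).aestronglyMeasurable) hlim
  set a : ℝ := (1 + d) * volume.real Ω + (d + 3 + 2 * θ ^ 2 * d ^ 2) * C ^ 2 with ha
  set b : ℝ := ∫ x in Ω, |u x| with hb
  have hsm : ∀ f : Pt d → ℝ, IntegrableOn f Ω → IntegrableOn (fun x => f x • gradient φ x) Ω :=
    fun f hf => Integrable.smul_bdd hf B hgc.aestronglyMeasurable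
      (Eventually.of_forall hB.norm_gradient_le)
  -- The `L¹` norm of `Π_M w` is at most `J i + b` and `J i` tends to zero, so the bracket
  -- multiplying the mesh size has a finite limit.
  have h1 : ∀ i, ‖(∫ x in Ω, φ x • (D i).grad (w i) x) +
      ∫ x in Ω, (D i).proj (w i) x • gradient φ x‖ ≤
      B * (D i).size * (a + (θ * d + 1) * (J i + b)) := by
    intro i
    refine ((D i).norm_setIntegral_smul_grad_add_le hd hΩb hθ (hD i) hB hφ (hw i)).trans ?_
    have hs := (D i).size_nonneg
    have hsn : 0 ≤ (D i).seminormX (w i) := Real.sqrt_nonneg _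
    have h3 : ∫ x in Ω, |(D i).proj (w i) x| ≤ J i + b := by
      rw [hJ, hb]
      simp only
      rw [← integral_add (hpi i).abs hui.abs]
      refine integral_mono ((D i).integrableOn_proj hΩb (w i)).abs
        ((hpi i).abs.add hui.abs) fun x => ?_
      have := abs_add_le ((D i).proj (w i) x - u x) (u x)
      rwa [sub_add_cancel] at this
    have hCi := hC i
    rw [ha]
    gcongr
  have h2 : ∀ i, ‖(∫ x in Ω, (D i).proj (w i) x • gradient φ x) -
      ∫ x in Ω, u x • gradient φ x‖ ≤ B * J i := by
    intro i
    rw [← integral_sub (hsm _ ((D i).integrableOn_proj hΩb (w i))) (hsm _ hui), hJ]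
    simp only
    rw [← integral_const_mul]
    refine norm_integral_le_of_norm_le ((hpi i).abs.const_mul B) (Eventually.of_forall fun x => ?_)
    rw [← sub_smul, norm_smul, mul_comm, Real.norm_eq_abs]
    gcongr
    exact hB.norm_gradient_le x
  have h3 : Tendsto (fun i => B * (D i).size * (a + (θ * d + 1) * (J i + b)) + B * J i)
      (sizeToZero D) (𝓝 0) := by
    have := ((tendsto_size (D := D)).const_mul B).mul
      ((((hJ0.add_const b).const_mul (θ * d + 1)).const_add a)) |>.add (hJ0.const_mul B)
    simpa using this
  rw [tendsto_iff_norm_sub_tendsto_zero]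
  refine squeeze_zero (fun _ => norm_nonneg _) (fun i => ?_) h3
  calc _ = ‖((∫ x in Ω, φ x • (D i).grad (w i) x) +
        ∫ x in Ω, (D i).proj (w i) x • gradient φ x) -
        ((∫ x in Ω, (D i).proj (w i) x • gradient φ x) - ∫ x in Ω, u x • gradient φ x)‖ := by
        congr 1; abel
    _ ≤ _ := (norm_sub_le _ _).trans (add_le_add (h1 i) (h2 i))

theorem memLp_smul_const_of_hasCompactSupport {φ : Pt d → ℝ} (hφ : Continuous φ)
    (hφc : HasCompactSupport φ) (e : Pt d) : MemLp (fun x => φ x • e) 2 :=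
  (hφ.smul continuous_const).memLp_of_hasCompactSupport hφc.smul_right

theorem integrable_smul_of_memLp {φ : Pt d → ℝ} (hφ : Continuous φ)
    (hφc : HasCompactSupport φ) {g : Pt d → Pt d} (hg : MemLp g 2) :
    Integrable fun x => φ x • g x :=
  memLp_one_iff_integrable.1
    (hg.smul (hφ.memLp_of_hasCompactSupport (p := 2) hφc))

theorem integral_inner_smul_const {φ : Pt d → ℝ} (hφ : Continuous φ)
    (hφc : HasCompactSupport φ) {g : Pt d → Pt d} (hg : MemLp g 2) (e : Pt d) :
    ∫ x, inner ℝ (φ x • e) (g x) = inner ℝ e (∫ x, φ x • g x) := by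
  rw [← integral_inner (integrable_smul_of_memLp hφ hφc hg)]
  simp only [inner_smul_left, inner_smul_right, conj_trivial]

/-- Every ultrafilter limit of the discrete gradients is a weak gradient of the limit, extended by
zero. -/
theorem exists_weak_limit_grad (hd : 0 < d) (hΩb : Bornology.IsBounded Ω) (hθ : 0 ≤ θ)
    (hD : ∀ i, (D i).theta ≤ θ) (hw : ∀ i, (D i).MemX0 (w i))
    (hC : ∀ i, (D i).seminormX (w i) ≤ C) (hu : MemLp u 2 (volume.restrict Ω))
    (hlim : Tendsto (fun i => eLpNorm (fun x => (D i).proj (w i) x - u x) 2 (volume.restrict Ω))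
      (sizeToZero D) (𝓝 0)) (U : Ultrafilter ι) (hU : ↑U ≤ sizeToZero D) :
    ∃ G : Pt d → Pt d, MemLp G 2 ∧
      (∀ F : Pt d → Pt d, MemLp F 2 → Tendsto (fun i => ∫ x, inner ℝ (F x) ((D i).grad (w i) x)) U
        (𝓝 (∫ x, inner ℝ (F x) (G x)))) ∧
      ∀ φ : Pt d → ℝ, ContDiff ℝ ∞ φ → HasCompactSupport φ →
        ∫ x in Ω, u x • gradient φ x = -∫ x, φ x • G x := by
  obtain ⟨G, hG, hconv⟩ := exists_weak_limit U (fun i => (D i).memLp_grad hΩb (w i))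
    (C := (d + 2 + 2 * θ ^ 2 * d ^ 2) * C ^ 2) (fun i => by
      refine ((D i).integral_norm_grad_sq_le hd hΩb (hD i) (w i)).trans ?_
      have : 0 ≤ (D i).seminormX (w i) := Real.sqrt_nonneg _
      gcongr
      exact hC i)
  refine ⟨G, hG, hconv, fun φ hφ hφc => ?_⟩
  have h1 := (tendsto_setIntegral_smul_grad hd hΩb hθ hD hw hC hu hlim hφ hφc).mono_left hU
  rw [← neg_eq_iff_eq_neg]
  -- Pairing with a constant vector `e` turns the vector identity into weak convergence against the
  -- field `φ • e`. The support of `φ` may leave `Ω`, which is what encodes the zero boundary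
  -- values.
  refine ext_inner_left ℝ fun e => ?_
  have h2 := hconv _ (memLp_smul_const_of_hasCompactSupport hφ.continuous hφc e)
  rw [integral_inner_smul_const hφ.continuous hφc hG] at h2
  refine tendsto_nhds_unique ?_ h2
  refine ((tendsto_const_nhds (x := e)).inner h1).congr fun i => ?_
  rw [integral_inner_smul_const hφ.continuous hφc ((D i).memLp_grad hΩb (w i)),
    setIntegral_eq_integral_of_forall_compl_eq_zero]
  intro x hx
  rw [(D i).grad_of_notMem _ hx, smul_zero]

/-- Uniqueness of weak gradients on `Ω`, by the fundamental lemma of the calculus of variations. It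
makes the weak limit on `Ω` independent of the ultrafilter. -/
theorem ae_eq_of_weak_gradient (hΩo : IsOpen Ω) (hΩb : Bornology.IsBounded Ω)
    {G G₀ : Pt d → Pt d} (hG : MemLp G 2)
    (hGu : ∀ φ : Pt d → ℝ, ContDiff ℝ ∞ φ → HasCompactSupport φ →
      ∫ x in Ω, u x • gradient φ x = -∫ x, φ x • G x)
    (hG₀ : HasWeakGradient Ω u G₀) : ∀ᵐ x ∂(volume.restrict Ω), G x = G₀ x := by
  have h1 := integrableOn_of_memLp_two hΩb (hG.restrict Ω)
  have h2 := integrableOn_of_memLp_two hΩb hG₀.2.1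
  rw [ae_restrict_iff' hΩo.measurableSet]
  have h := hΩo.ae_eq_zero_of_integral_contDiff_smul_eq_zero (f := fun x => G x - G₀ x)
    (μ := volume) (h1.sub h2).locallyIntegrableOn (fun φ hφ hφc hφs => ?_)
  · filter_upwards [h] with x hx hxΩ using sub_eq_zero.1 (hx hxΩ)
  have hzero : ∀ x, x ∉ Ω → φ x = 0 := fun x hx => by
    by_contra h0
    exact hx (hφs (subset_tsupport φ h0))
  have hbd : ∃ M, ∀ x, ‖φ x‖ ≤ M := hφ.continuous.bounded_above_of_compact_support hφc
  obtain ⟨M, hM⟩ := hbd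
  have hsm : ∀ f : Pt d → Pt d, IntegrableOn f Ω → IntegrableOn (fun x => φ x • f x) Ω :=
    fun f hf => Integrable.bdd_smul hf M hφ.continuous.aestronglyMeasurable
      (Eventually.of_forall hM)
  rw [← setIntegral_eq_integral_of_forall_compl_eq_zero (s := Ω)
    (fun x hx => by rw [hzero x hx, zero_smul])]
  simp only [smul_sub]
  rw [integral_sub (hsm _ h1) (hsm _ h2), setIntegral_eq_integral_of_forall_compl_eq_zero
    (fun x hx => by rw [hzero x hx, zero_smul]), sub_eq_zero, ← neg_inj, ← hGu φ hφ hφc,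
    hG₀.2.2 φ ⟨hφ, hφc, hφs⟩]

theorem isConsistentFamily_sushiFlux (hd : 0 < d) (hΩo : IsOpen Ω) (hΩb : Bornology.IsBounded Ω)
    {lo hi : ℝ} (hlo : 0 ≤ lo) (hlohi : lo ≤ hi) {Λ : Pt d → Matrix (Fin d) (Fin d) ℝ}
    (hΛ : IsDiffusionField Ω lo hi Λ) (hθ : 0 ≤ θ) (hD : ∀ i, (D i).theta ≤ θ) :
    IsConsistentFamily D Λ fun i => (D i).sushiFlux Λ := by
  rintro hne w u hw ⟨C, hC0, hC⟩ hu hlim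
  have hlimit := exists_weak_limit_grad hd hΩb hθ hD hw hC hu hlim
  constructor
  -- For the boundary values one ultrafilter is enough; it exists because the filter is nontrivial.
  · obtain ⟨G, hG, -, hGu⟩ := hlimit (Ultrafilter.of (sizeToZero D)) (Ultrafilter.of_le _)
    refine ⟨G, ?_, ?_, fun φ hφ => ?_⟩
    · rw [Measure.restrict_univ]
      exact (memLp_indicator_iff_restrict hΩo.measurableSet).2 hu
    · rwa [Measure.restrict_univ]
    · rw [Measure.restrict_univ, ← hGu φ hφ.1 hφ.2.1, ← integral_indicator hΩo.measurableSet]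
      congr 1
      funext x
      by_cases hx : x ∈ Ω
      · simp [hx]
      · simp [hx]
  intro G₀ hG₀ φ hφ
  obtain ⟨B, hB⟩ := exists_isSmoothBound hφ.1 hφ.2.1
  have hB0 := hB.nonneg
  have hhi : 0 ≤ hi := hlo.trans hlohi
  have hgc := continuous_gradient hφ.1
  set F : Pt d → Pt d := Ω.indicator fun x => Matrix.toEuclideanLin (Λ x) (gradient φ x) with hF
  have hFm : MemLp F 2 := by
    rw [hF, memLp_indicator_iff_restrict hΩo.measurableSet]
    have : IsFiniteMeasure (volume.restrict Ω) :=
      ⟨by rw [Measure.restrict_apply_univ]; exact hΩb.measure_lt_top⟩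
    refine MemLp.of_bound (hΛ.aestronglyMeasurable_apply hΩo.measurableSet
      hgc.aestronglyMeasurable) (hi * B) ?_
    filter_upwards [hΛ.ae_norm_le hlo hlohi] with x hx
    refine (hx _).trans ?_
    gcongr
    exact hB.norm_gradient_le x
  have hFint : ∀ g : Pt d → Pt d, ∫ x, inner ℝ (F x) (g x) =
      ∫ x in Ω, inner ℝ (Matrix.toEuclideanLin (Λ x) (gradient φ x)) (g x) := by
    intro g
    rw [← integral_indicator hΩo.measurableSet]
    congr 1
    funext x
    by_cases hx : x ∈ Ω
    · simp [hF, hx]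
    · simp [hF, hx]
  -- Each ultrafilter has its own weak limit `G`, but all of them equal `G₀` almost everywhere on
  -- `Ω`, so the limits of the forms coincide.
  rw [tendsto_iff_ultrafilter]
  intro U hU
  obtain ⟨G, hG, hconv, hGu⟩ := hlimit U hU
  have h1 := hconv F hFm
  have h2 : ∫ x, inner ℝ (F x) (G x) =
      ∫ x in Ω, inner ℝ (Matrix.toEuclideanLin (Λ x) (gradient φ x)) (G₀ x) := by
    rw [hFint]
    refine integral_congr_ae ?_
    filter_upwards [ae_eq_of_weak_gradient hΩo hΩb hG hGu hG₀] with x hx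
    rw [hx]
  rw [h2] at h1
  -- The discrete gradient of the interpolant can be replaced by `∇φ` at a cost proportional to the
  -- mesh size; what is left pairs the fixed field `F` with a weakly convergent family.
  have h3 : Tendsto (fun i => (D i).form ((D i).sushiFlux Λ) (w i) ((D i).interp φ) -
      ∫ x, inner ℝ (F x) ((D i).grad (w i) x)) (sizeToZero D) (𝓝 0) := by
    have hs : Tendsto (fun i => hi * (B * (θ * d + √(d : ℝ) * θ * (θ * d + 1) + 1) * (D i).size) *
        (volume.real Ω + (d + 2 + 2 * θ ^ 2 * d ^ 2) * C ^ 2)) (sizeToZero D) (𝓝 0) := by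
      have := (((tendsto_size (D := D)).const_mul
        (B * (θ * d + √(d : ℝ) * θ * (θ * d + 1) + 1))).const_mul hi).mul_const
        (volume.real Ω + (d + 2 + 2 * θ ^ 2 * d ^ 2) * C ^ 2)
      simpa using this
    refine squeeze_zero_norm (fun i => ?_) hs
    rw [hFint, Real.norm_eq_abs]
    refine ((D i).abs_form_interp_sub_le hd hΛ hlo hlohi hΩo hΩb hθ (hD i) hB hgc (w i)).trans ?_
    have hsz := (D i).size_nonneg
    have : 0 ≤ (D i).seminormX (w i) := Real.sqrt_nonneg _
    gcongr
    exact hC i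
  have h4 := (h3.mono_left hU).add h1
  simp only [sub_add_cancel, zero_add] at h4
  exact h4

end Consistency

end Sushi

end

theorem lemma4p4 {d : ℕ} (hd : 0 < d) {Ω : Set (Sushi.Pt d)} (hΩo : IsOpen Ω)
    (hΩb : Bornology.IsBounded Ω) (hΩc : IsConnected Ω)
    {lo hi : ℝ} (hlo : 0 < lo) (hlohi : lo ≤ hi)
    {Λ : Sushi.Pt d → Matrix (Fin d) (Fin d) ℝ} (hΛ : Sushi.IsDiffusionField Ω lo hi Λ)
    {ι : Type*} (D : ι → Sushi.Discretisation d Ω)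
    {θ : ℝ} (hθ : 0 < θ) (hD : ∀ i, (D i).theta ≤ θ) :
    (∀ i, ∀ u v : (D i).X, (D i).form ((D i).sushiFlux Λ) u v =
        ∫ x in Ω, inner ℝ ((D i).grad u x) (Matrix.toEuclideanLin (Λ x) ((D i).grad v x))) ∧
      Sushi.IsContinuousFamily D (fun i => (D i).sushiFlux Λ) ∧
      Sushi.IsCoerciveFamily D (fun i => (D i).sushiFlux Λ) ∧
      Sushi.IsConsistentFamily D Λ (fun i => (D i).sushiFlux Λ) ∧
      Sushi.IsSymmetricFamily D (fun i => (D i).sushiFlux Λ) := by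
  have hhi : 0 < hi := hlo.trans_le hlohi
  refine ⟨fun i u v => (D i).form_sushiFlux_eq_integral hd hΛ hlo.le hlohi hΩo hΩb u v,
    ⟨hi * (d + 2 + 2 * θ ^ 2 * d ^ 2), by positivity, fun i u v =>
      (D i).form_sushiFlux_le hd hΛ hlo.le hlohi hΩo hΩb (hD i) u v⟩,
    ⟨lo / (2 * (1 + d * θ ^ 2)), by positivity, fun i u =>
      (D i).le_form_sushiFlux hd hΛ hlo.le hlohi hΩo hΩb (hD i) u⟩,
    Sushi.isConsistentFamily_sushiFlux hd hΩo hΩb hlo.le hlohi hΛ hθ.le hD,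
    fun i u v => (D i).form_sushiFlux_comm hΛ hlo.le hlohi hΩo hΩb u v⟩
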